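/- Let $\mu$ be a probability measure on $[0,1]$ with a continuous density, whose distribution function $F_\mu$ is strictly increasing on $[0,1]$, and let $q_1,q_2>0$ with $q_1+q_2<1$. \emph{The game.} For $n$ agents at $\vec x\in[0,1]^n$ and two facilities at $\vec y=(y_1,y_2)\in[0,1]^2$, every agent selects one facility. Among the agents that selected facility $j$, the $\lfloor q_jn\rfloor$ closest to $y_j$ (ties being broken by an arbitrary fixed priority order) are accommodated, and agent $i$ then receives utility $1-|x_i-y_j|$; all other agents receive $0$. The social welfare of a pure Nash equilibrium is the sum of the utilities; $SW(\vec x,\vec y)$ is its largest value over the equilibria, and $SW_{opt}(\vec x)=\sup_{\vec y\in[0,1]^2}SW(\vec x,\vec y)$. \emph{Mechanisms.} For $\vec p\in[0,1]^2$, the percentile mechanism $\mathcal{PM}_{\vec p}$ places facility $j$ at the position of the $(\lfloor p_j(n-1)\rfloor+1)$-th leftmost agent. It is equilibrium stable (ES) if for every $n$ and every $\vec x\in[0,1]^n$ all Nash equilibria induced by its output have the same social welfare. It is asymptotically optimal if, for $\vec X_n$ a vector of $n$ independent agents with law $\mu$, $\mathbb E[SW_{opt}(\vec X_n)]/\mathbb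 E[SW(\vec X_n,\mathcal{PM}_{\vec p}(\vec X_n))]\to 1$ as $n\to\infty$. \emph{The functional.} For $y_1\le y_2$ let $R_1,R_2\in[0,1]$ be radii such that $\mu(A_1)=q_1$ and $\mu(A_2)=q_2$, where $$A_1=[y_1-R_1,z_1]\cup(y_2+R_2,\,y_1+R_1],\qquad A_2=[z_2,y_2+R_2]\cup[y_2-R_2,\,y_1-R_1),$$ $$z_1=\min\{\max\{\tfrac{y_1+y_2}2,\,y_2-R_2\},\,y_1+R_1\},\qquad z_2=\max\{\min\{\tfrac{y_1+y_2}2,\,y_1+R_1\},\,y_2-R_2\},$$ an interval being empty if its end points are in the wrong order. Put $\mathcal W(y_1,y_2)=\int_{A_1}|x-y_1|\,d\mu+\int_{A_2}|x-y_2|\,d\mu$; for $y_2<y_1$ exchange the roles of the two facilities. Let $\mathcal Y$ be the set of minimisers of $\mathcal W$ over $[0,1]^2$. \emph{Theorem.} The functional $\mathcal W$ is well defined on $[0,1]^2$ (such radii exist, and the value does not depend on their choice), and $\mathcal Y$ is non-empty. There is an ES and asymptotically optimal percentile mechanism with $p_1\le p_2$ if and only if some $(y_1,y_2)\in\mathcal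 Y$ satisfies $$F_\mu(y_2)-F_\mu(y_1)\ge q_1+q_2 .$$ Without the restriction $p_1\le p_2$, there is an ES and asymptotically optimal percentile mechanism if and only if some $(y_1,y_2)\in\mathcal Y$ satisfies $|F_\mu(y_2)-F_\mu(y_1)|\ge q_1+q_2$. -/

import Mathlib

open MeasureTheory ProbabilityTheory Set Filter Topology

noncomputable section

namespace FLPSR

/-! ### The finite First-Come-First-Served game

There are `n` agents at positions `x i`, and two facilities (indexed by `Fin 2`) at positions `y j`
with relative capacities `q j`.  Ties in the distance to facility `j` are broken by a fixed
priority order `tie j` of the agents. -/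

/-- Agent `l` is strictly ahead of agent `i` in the queue of facility `j`. -/
def Precedes {n : ℕ} (tie : Fin 2 → Equiv.Perm (Fin n)) (x : Fin n → ℝ) (y : Fin 2 → ℝ)
    (j : Fin 2) (l i : Fin n) : Prop :=
  |x l - y j| < |x i - y j| ∨ (|x l - y j| = |x i - y j| ∧ tie j l < tie j i)

/-- Under the profile `s`, agent `i` is among the `⌊q_j n⌋` first agents in the queue of the
facility `j = s i` that it selected. -/
def Accommodated {n : ℕ} (tie : Fin 2 → Equiv.Perm (Fin n)) (q : Fin 2 → ℝ) (x : Fin n → ℝ)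
    (y : Fin 2 → ℝ) (s : Fin n → Fin 2) (i : Fin n) : Prop :=
  {l : Fin n | s l = s i ∧ Precedes tie x y (s i) l i}.ncard < ⌊q (s i) * n⌋₊

open Classical in
/-- The utility of agent `i` under the profile `s`. -/
def utility {n : ℕ} (tie : Fin 2 → Equiv.Perm (Fin n)) (q : Fin 2 → ℝ) (x : Fin n → ℝ)
    (y : Fin 2 → ℝ) (s : Fin n → Fin 2) (i : Fin n) : ℝ :=
  if Accommodated tie q x y s i then 1 - |x i - y (s i)| else 0

/-- Pure Nash equilibria of the game. -/
def IsNash {n : ℕ} (tie : Fin 2 → Equiv.Perm (Fin n)) (q : Fin 2 → ℝ) (x : Fin n → ℝ)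
    (y : Fin 2 → ℝ) (s : Fin n → Fin 2) : Prop :=
  ∀ (i : Fin n) (j : Fin 2),
    utility tie q x y (Function.update s i j) i ≤ utility tie q x y s i

/-- The social welfare of the profile `s`. -/
def welfare {n : ℕ} (tie : Fin 2 → Equiv.Perm (Fin n)) (q : Fin 2 → ℝ) (x : Fin n → ℝ)
    (y : Fin 2 → ℝ) (s : Fin n → Fin 2) : ℝ :=
  ∑ i, utility tie q x y s i

/-- The social welfare of the facility locations `y`: the best one over the Nash equilibria. For an
equilibrium stable mechanism all equilibria attain this value. -/
def eqWelfare {n : ℕ} (tie : Fin 2 → Equiv.Perm (Fin n)) (q : Fin 2 → ℝ) (x : Fin n → ℝ)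
    (y : Fin 2 → ℝ) : ℝ :=
  sSup {w : ℝ | ∃ s, IsNash tie q x y s ∧ w = welfare tie q x y s}

/-- The set `[0,1]²` of facility locations (and of percentile vectors). -/
def square : Set (Fin 2 → ℝ) := {y | ∀ j, y j ∈ Icc (0 : ℝ) 1}

/-- The optimal social welfare over all facility locations in `[0,1]²` and all Nash equilibria. -/
def optWelfare {n : ℕ} (tie : Fin 2 → Equiv.Perm (Fin n)) (q : Fin 2 → ℝ) (x : Fin n → ℝ) : ℝ :=
  sSup {w : ℝ | ∃ y ∈ square, ∃ s, IsNash tie q x y s ∧ w = welfare tie q x y s}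

/-! ### Percentile mechanisms -/

/-- The position of the `(k+1)`-th leftmost agent (and `0` if there are at most `k` agents). -/
def leftmost {n : ℕ} (x : Fin n → ℝ) (k : ℕ) : ℝ :=
  if h : k < n then x (Tuple.sort x ⟨k, h⟩) else 0

/-- The percentile mechanism induced by `p`: facility `j` is placed at the position of the
`(⌊p_j (n-1)⌋ + 1)`-th leftmost agent. -/
def percentile (p : Fin 2 → ℝ) {n : ℕ} (x : Fin n → ℝ) : Fin 2 → ℝ :=
  fun j => leftmost x ⌊p j * ((n : ℝ) - 1)⌋₊

/-- Equilibrium stability of the percentile mechanism induced by `p`: for every number of agents and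
every input, all Nash equilibria induced by the output have the same social welfare. -/
def EquilibriumStable (tie : ∀ n : ℕ, Fin 2 → Equiv.Perm (Fin n)) (q p : Fin 2 → ℝ) : Prop :=
  ∀ (n : ℕ) (x : Fin n → ℝ), (∀ i, x i ∈ Icc (0 : ℝ) 1) →
    ∀ s s' : Fin n → Fin 2,
      IsNash (tie n) q x (percentile p x) s → IsNash (tie n) q x (percentile p x) s' →
        welfare (tie n) q x (percentile p x) s = welfare (tie n) q x (percentile p x) s'

/-- The Bayesian approximation ratio for `n` independent agents distributed as `μ`. The welfares
are nonnegative, so that expectations are taken in `[0,∞]`. -/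
def bayesRatio (tie : ∀ n : ℕ, Fin 2 → Equiv.Perm (Fin n)) (μ : Measure ℝ) (q p : Fin 2 → ℝ)
    (n : ℕ) : ENNReal :=
  (∫⁻ x : Fin n → ℝ, ENNReal.ofReal (optWelfare (tie n) q x) ∂(Measure.pi fun _ => μ)) /
    ∫⁻ x : Fin n → ℝ, ENNReal.ofReal (eqWelfare (tie n) q x (percentile p x))
      ∂(Measure.pi fun _ => μ)

/-- The percentile mechanism induced by `p` is asymptotically optimal. -/
def AsymptoticallyOptimal (tie : ∀ n : ℕ, Fin 2 → Equiv.Perm (Fin n)) (μ : Measure ℝ)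
    (q p : Fin 2 → ℝ) : Prop :=
  Tendsto (bayesRatio tie μ q p) atTop (𝓝 1)

/-! ### The two-facility functional -/

/-- For a facility at `a` with radius `r` to the left of one at `b` with radius `t`, the agents
served by the left one: those of `[a-r, a+r]` except the ones that lie in `[b-t, b+t]` to the right
of the midpoint `(a+b)/2`. The second piece is nonempty only if `a + r > b + t`. -/
def servedLeft (a b r t : ℝ) : Set ℝ :=
  Icc (a - r) (min (max ((a + b) / 2) (b - t)) (a + r)) ∪ Ioc (b + t) (a + r)

/-- The agents served by the right facility, in the same situation. The second piece is nonempty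
only if `b - t < a - r`. -/
def servedRight (a b r t : ℝ) : Set ℝ :=
  Icc (max (min ((a + b) / 2) (a + r)) (b - t)) (b + t) ∪ Ico (b - t) (a - r)

/-- The agents served by facility `j`, for facilities at `y` with radii `R`. -/
def served (y R : Fin 2 → ℝ) : Fin 2 → Set ℝ :=
  if y 0 ≤ y 1 then
    ![servedLeft (y 0) (y 1) (R 0) (R 1), servedRight (y 0) (y 1) (R 0) (R 1)]
  else
    ![servedRight (y 1) (y 0) (R 1) (R 0), servedLeft (y 1) (y 0) (R 1) (R 0)]

/-- `R ∈ [0,1]²` are equilibrium radii at `y`: facility `j` serves exactly the mass `q j`. -/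
def IsRadii (μ : Measure ℝ) (q y R : Fin 2 → ℝ) : Prop :=
  R ∈ square ∧ ∀ j, μ.real (served y R j) = q j

/-- The transport cost of the served agents. -/
def cost (μ : Measure ℝ) (y R : Fin 2 → ℝ) : ℝ :=
  ∑ j, ∫ x in served y R j, |x - y j| ∂μ

/-- The radius function: some choice of equilibrium radii at `y`. -/
def radii (μ : Measure ℝ) (q y : Fin 2 → ℝ) : Fin 2 → ℝ :=
  Classical.epsilon (IsRadii μ q y)

/-- The two-facility functional. -/
def functionalW (μ : Measure ℝ) (q y : Fin 2 → ℝ) : ℝ := cost μ y (radii μ q y)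

/-- The set of minimisers of the functional over `[0,1]²`. -/
def minimisers (μ : Measure ℝ) (q : Fin 2 → ℝ) : Set (Fin 2 → ℝ) :=
  {y | y ∈ square ∧ ∀ y' ∈ square, functionalW μ q y ≤ functionalW μ q y'}

end FLPSR

end

noncomputable section

namespace FLPSR

/-! ### Queues -/

/-! The theorem separates into a combinatorial condition for stability and an analytic one for
optimality, both expressed through the percentiles.

Stability. For `p j < p k`, the mechanism is ES exactly when `p k - p j ≥ q j + q k`. If the gap is
that large, at least `cap j + cap k` agents lie between the facilities. A facility failing to serve
its closest agents would force all agents between the facilities to be accommodated, and counting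
shows that there are too few seats for this; so every equilibrium has the same value at each
facility, `topValue` (`equilibriumStable_of_le`). If the gap is smaller, clusters of agents can be
placed so that one agent halfway between the facilities is indifferent, and its choice decides which
outlying agent loses a seat. Outlying agents on the two sides have different utilities, so two
equilibria differ in welfare (`not_equilibriumStable`).

Optimality. Let the empirical laws of a sequence of populations converge to `μ` and let the
locations converge to `y`. Attach to each equilibrium the radius reached by each facility. By
compactness the radii converge along subsequences, and a quantile coupling turns averages over
agents into integrals against `μ`. The limit radii solve the mass equations for `y`, except possibly
when the two limit locations coincide, where only the total covered mass matters. As the cost does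
not depend on the choice of radii (`IsRadii.cost_eq`), the welfare per agent of every such sequence
of equilibria tends to `q 0 + q 1 - functionalW μ q y` (`IsRegular.tendsto_welfare`). The same
argument produces radii, the continuity of the functional on the square and, by compactness, a
minimiser. Chebyshev's inequality supplies good samples with high probability, so expectations
converge as well. Percentile locations converge to the quantiles `F(y j) = p j`, whence the
mechanism is asymptotically optimal iff these quantiles form a minimiser
(`IsRegular.asymptoticallyOptimal_iff`).

Since `F` is a bijection of `[0,1]`, percentile vectors and locations correspond, and the two
conditions combine. The criterion for stability says nothing against `p 0 = p 1`; that case is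
excluded because coincident facilities are never optimal: moving one of them slightly towards a side
with enough agents lowers the cost (`IsRegular.ne_of_mem_minimisers`). -/

lemma Precedes.irrefl {n : ℕ} {tie : Fin 2 → Equiv.Perm (Fin n)} {x : Fin n → ℝ} {y : Fin 2 → ℝ}
    {j : Fin 2} {i : Fin n} : ¬ Precedes tie x y j i i := by
  simp [Precedes]

lemma Precedes.trans {n : ℕ} {tie : Fin 2 → Equiv.Perm (Fin n)} {x : Fin n → ℝ} {y : Fin 2 → ℝ}
    {j : Fin 2} {a b c : Fin n} (h : Precedes tie x y j a b) (h' : Precedes tie x y j b c) :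
    Precedes tie x y j a c := by
  unfold Precedes at *
  rcases h with h | ⟨h, h1⟩ <;> rcases h' with h' | ⟨h', h1'⟩
  · exact Or.inl (h.trans h')
  · exact Or.inl (h' ▸ h)
  · exact Or.inl (h ▸ h')
  · exact Or.inr ⟨h.trans h', h1.trans h1'⟩

lemma Precedes.total {n : ℕ} (tie : Fin 2 → Equiv.Perm (Fin n)) (x : Fin n → ℝ) (y : Fin 2 → ℝ)
    (j : Fin 2) {a b : Fin n} (hab : a ≠ b) :
    Precedes tie x y j a b ∨ Precedes tie x y j b a := by
  unfold Precedes
  have : tie j a ≠ tie j b := fun h => hab ((tie j).injective h)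
  rcases lt_trichotomy |x a - y j| |x b - y j| with h | h | h
  · exact Or.inl (Or.inl h)
  · rcases lt_or_gt_of_ne this with h' | h'
    · exact Or.inl (Or.inr ⟨h, h'⟩)
    · exact Or.inr (Or.inr ⟨h.symm, h'⟩)
  · exact Or.inr (Or.inl h)

lemma Precedes.of_lt {n : ℕ} {tie : Fin 2 → Equiv.Perm (Fin n)} {x : Fin n → ℝ} {y : Fin 2 → ℝ}
    {j : Fin 2} {a b : Fin n} (h : |x a - y j| < |x b - y j|) : Precedes tie x y j a b := Or.inl h

lemma Precedes.le {n : ℕ} {tie : Fin 2 → Equiv.Perm (Fin n)} {x : Fin n → ℝ} {y : Fin 2 → ℝ}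
    {j : Fin 2} {a b : Fin n} (h : Precedes tie x y j a b) : |x a - y j| ≤ |x b - y j| :=
  h.elim le_of_lt fun h => h.1.le

/-- In a finite strict total order exactly `min k |S|` elements have fewer than `k` predecessors. -/
lemma card_filter_rank_lt {α : Type*} (S : Finset α) (r : α → α → Prop) [DecidableRel r]
    (hirr : ∀ a, ¬ r a a) (htr : ∀ a b c, r a b → r b c → r a c)
    (htot : ∀ a b, a ≠ b → r a b ∨ r b a) (k : ℕ) :
    (S.filter fun i => (S.filter (r · i)).card < k).card = min k S.card := by
  classical
  set f : α → ℕ := fun i => (S.filter (r · i)).card with hf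
  have hlt : ∀ a ∈ S, ∀ b, r a b → f a < f b := by
    intro a ha b hab
    apply Finset.card_lt_card
    refine ⟨fun c hc => ?_, fun h => ?_⟩
    · simp only [Finset.mem_filter] at hc ⊢
      exact ⟨hc.1, htr _ _ _ hc.2 hab⟩
    · have := h (Finset.mem_filter.2 ⟨ha, hab⟩)
      exact hirr a (Finset.mem_filter.1 this).2
  -- The rank `f` is injective on `S` with values below `|S|`, hence takes each of these values
  -- exactly once.
  have hinj : Set.InjOn f S := by
    intro a ha b hb hab
    by_contra hne
    rcases htot a b hne with h | h
    · exact (hlt a ha b h).ne hab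
    · exact (hlt b hb a h).ne hab.symm
  have hsub : S.image f ⊆ Finset.range S.card := by
    intro m hm
    obtain ⟨i, hi, rfl⟩ := Finset.mem_image.1 hm
    refine Finset.mem_range.2 (Finset.card_lt_card ⟨Finset.filter_subset _ _, fun h => ?_⟩)
    exact hirr i (Finset.mem_filter.1 (h hi)).2
  have himg : S.image f = Finset.range S.card :=
    Finset.eq_of_subset_of_card_le hsub (by
      rw [Finset.card_image_of_injOn hinj, Finset.card_range])
  have h1 : (S.filter fun i => f i < k).card = ((S.image f).filter (· < k)).card := by
    rw [Finset.filter_image, Finset.card_image_of_injOn]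
    exact hinj.mono fun a ha => (Finset.mem_filter.1 ha).1
  rw [h1, himg]
  have : (Finset.range S.card).filter (· < k) = Finset.range (min k S.card) := by
    ext m; simp [and_comm]
  rw [this, Finset.card_range]

/-- The number of seats of facility `j`. -/
def cap (q : Fin 2 → ℝ) (n : ℕ) (j : Fin 2) : ℕ := ⌊q j * n⌋₊

open Classical in
/-- The agents accommodated by facility `j` under the profile `s`. -/
def servedBy {n : ℕ} (tie : Fin 2 → Equiv.Perm (Fin n)) (q : Fin 2 → ℝ) (x : Fin n → ℝ)
    (y : Fin 2 → ℝ) (s : Fin n → Fin 2) (j : Fin 2) : Finset (Fin n) :=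
  Finset.univ.filter fun i => s i = j ∧ Accommodated tie q x y s i

/-! ### Seats, radii and existence of equilibria -/

section Game

variable {n : ℕ} {tie : Fin 2 → Equiv.Perm (Fin n)} {q : Fin 2 → ℝ} {x : Fin n → ℝ}
  {y : Fin 2 → ℝ} {s : Fin n → Fin 2}

lemma mem_servedBy {j : Fin 2} {i : Fin n} :
    i ∈ servedBy tie q x y s j ↔ s i = j ∧ Accommodated tie q x y s i := by
  simp [servedBy]

lemma accommodated_iff {i : Fin n} : Accommodated tie q x y s i ↔
    {l : Fin n | s l = s i ∧ Precedes tie x y (s i) l i}.ncard < cap q n (s i) := Iff.rfl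

lemma ncard_setOf_and (P R : Fin n → Prop) [DecidablePred P] [DecidablePred R] :
    {l | P l ∧ R l}.ncard = ((Finset.univ.filter P).filter R).card := by
  rw [← Set.ncard_coe_finset]
  congr 1
  ext l; simp

lemma card_servedBy (j : Fin 2) : (servedBy tie q x y s j).card =
    min (cap q n j) {l | s l = j}.ncard := by
  classical
  have h := card_filter_rank_lt (Finset.univ.filter fun l => s l = j) (Precedes tie x y j)
    (fun _ => Precedes.irrefl) (fun _ _ _ => Precedes.trans)
    (fun _ _ => Precedes.total tie x y j) (cap q n j)
  have h2 : {l | s l = j}.ncard = (Finset.univ.filter fun l => s l = j).card := by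
    rw [← Set.ncard_coe_finset]; congr 1; ext l; simp
  rw [h2, ← h]
  congr 1
  ext i
  simp only [mem_servedBy, Finset.mem_filter, Finset.mem_univ, true_and]
  constructor
  · rintro ⟨rfl, ha⟩
    refine ⟨rfl, ?_⟩
    rwa [accommodated_iff, ncard_setOf_and] at ha
  · rintro ⟨rfl, ha⟩
    refine ⟨rfl, ?_⟩
    rwa [accommodated_iff, ncard_setOf_and]

lemma card_servedBy_le (j : Fin 2) : (servedBy tie q x y s j).card ≤ cap q n j := by
  rw [card_servedBy]; exact min_le_left _ _

lemma ncard_lt_cap_of_card_servedBy_lt {j : Fin 2}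
    (h : (servedBy tie q x y s j).card < cap q n j) (P : Fin n → Prop) :
    {l | s l = j ∧ P l}.ncard < cap q n j := by
  rw [card_servedBy] at h
  have : {l | s l = j ∧ P l}.ncard ≤ {l | s l = j}.ncard :=
    Set.ncard_le_ncard (fun l hl => hl.1) (Set.toFinite _)
  omega

lemma utility_of_accommodated {i : Fin n} (h : Accommodated tie q x y s i) :
    utility tie q x y s i = 1 - |x i - y (s i)| := by simp [utility, h]

lemma utility_of_not_accommodated {i : Fin n} (h : ¬ Accommodated tie q x y s i) :
    utility tie q x y s i = 0 := by simp [utility, h]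

lemma abs_sub_le_one {a b : ℝ} (ha : a ∈ Icc (0 : ℝ) 1) (hb : b ∈ Icc (0 : ℝ) 1) :
    |a - b| ≤ 1 := by
  rw [abs_le]; constructor <;> linarith [ha.1, ha.2, hb.1, hb.2]

lemma utility_nonneg (hx : ∀ i, x i ∈ Icc (0 : ℝ) 1) (hy : y ∈ square) (s : Fin n → Fin 2)
    (i : Fin n) : 0 ≤ utility tie q x y s i := by
  unfold utility
  split_ifs
  · linarith [abs_sub_le_one (hx i) (hy (s i))]
  · exact le_rfl

lemma utility_le_one (i : Fin n) : utility tie q x y s i ≤ 1 := by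
  unfold utility
  split_ifs
  · linarith [abs_nonneg (x i - y (s i))]
  · exact zero_le_one

lemma accommodated_update_iff {i : Fin n} {j : Fin 2} :
    Accommodated tie q x y (Function.update s i j) i ↔
      {l | s l = j ∧ Precedes tie x y j l i}.ncard < cap q n j := by
  rw [accommodated_iff]
  simp only [Function.update_self]
  have : {l | Function.update s i j l = j ∧ Precedes tie x y j l i} =
      {l | s l = j ∧ Precedes tie x y j l i} := by
    ext l
    by_cases hl : l = i
    · subst hl; simp [Precedes.irrefl]
    · simp [Function.update_of_ne hl]
  rw [this]

/-- An agent that would be accommodated by facility `j` gets at least as much in equilibrium. -/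
lemma IsNash.le_utility (h : IsNash tie q x y s) {i : Fin n} {j : Fin 2}
    (hc : {l | s l = j ∧ Precedes tie x y j l i}.ncard < cap q n j) :
    1 - |x i - y j| ≤ utility tie q x y s i := by
  refine le_trans (le_of_eq ?_) (h i j)
  rw [utility_of_accommodated (accommodated_update_iff.2 hc), Function.update_self]

/-- An agent closer to `j` than an agent accommodated there would be accommodated by `j`. -/
lemma IsNash.le_utility_of_lt (h : IsNash tie q x y s) {i m : Fin n} {j : Fin 2}
    (hm : m ∈ servedBy tie q x y s j) (hd : |x i - y j| < |x m - y j|) :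
    1 - |x i - y j| ≤ utility tie q x y s i := by
  obtain ⟨rfl, ha⟩ := mem_servedBy.1 hm
  refine h.le_utility (lt_of_le_of_lt (Set.ncard_le_ncard ?_ (Set.toFinite _)) ha)
  exact fun l hl => ⟨hl.1, hl.2.trans (Precedes.of_lt hd)⟩

lemma accommodated_of_utility_pos {i : Fin n} (h : 0 < utility tie q x y s i) :
    Accommodated tie q x y s i := by
  by_contra h'
  rw [utility_of_not_accommodated h'] at h
  exact lt_irrefl _ h

/-- The radii of an equilibrium. -/
lemma IsNash.exists_radii (h : IsNash tie q x y s) (hx : ∀ i, x i ∈ Icc (0 : ℝ) 1)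
    (hy : y ∈ square) : ∃ R ∈ square, ∀ j,
      (∀ i ∈ servedBy tie q x y s j, |x i - y j| ≤ R j) ∧
      (∀ i, |x i - y j| < R j → 1 - |x i - y j| ≤ utility tie q x y s i) ∧
      (R j < 1 → (servedBy tie q x y s j).card = cap q n j) := by
  suffices H : ∀ j, ∃ r ∈ Icc (0 : ℝ) 1,
      (∀ i ∈ servedBy tie q x y s j, |x i - y j| ≤ r) ∧
      (∀ i, |x i - y j| < r → 1 - |x i - y j| ≤ utility tie q x y s i) ∧
      (r < 1 → (servedBy tie q x y s j).card = cap q n j) by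
    choose R hR using H
    exact ⟨R, fun j => (hR j).1, fun j => (hR j).2⟩
  intro j
  -- The radius is 1 if a seat is free, and otherwise the distance of the furthest agent served. A
  -- facility without any seats gets radius 0, for which the condition on closer agents is void.
  rcases (card_servedBy_le (tie := tie) (q := q) (x := x) (y := y) (s := s) j).lt_or_eq with hc | hc
  · exact ⟨1, by simp, fun i _ => abs_sub_le_one (hx i) (hy j),
      fun i _ => h.le_utility (ncard_lt_cap_of_card_servedBy_lt hc _), fun h => absurd h (lt_irrefl _)⟩
  · rcases (servedBy tie q x y s j).eq_empty_or_nonempty with he | hne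
    · refine ⟨0, by simp, by simp [he], fun i hi => ?_, fun _ => hc⟩
      exact absurd hi (not_lt.2 (abs_nonneg _))
    · obtain ⟨m, hm, hmax⟩ := Finset.exists_max_image _ (fun i => |x i - y j|) hne
      exact ⟨|x m - y j|, ⟨abs_nonneg _, abs_sub_le_one (hx m) (hy j)⟩, hmax,
        fun i hi => h.le_utility_of_lt hm hi, fun _ => hc⟩

lemma fin_two_eq_or {j k : Fin 2} (hjk : j ≠ k) (l : Fin 2) : l = j ∨ l = k := by omega

/-- Equilibria exist; agents that are indifferent between the facilities can be taken to choose the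
facility `j`, if it has enough seats. -/
lemma exists_isNash (tie : Fin 2 → Equiv.Perm (Fin n)) (q : Fin 2 → ℝ) (y : Fin 2 → ℝ)
    (hx : ∀ i, x i ∈ Icc (0 : ℝ) 1) (hy : y ∈ square)
    {j k : Fin 2} (hjk : j ≠ k) : ∃ s, IsNash tie q x y s ∧
      ∀ i, |x i - y j| ≤ |x i - y k| → {l | Precedes tie x y j l i}.ncard < cap q n j → s i = j := by
  classical
  -- Pairs (agent, facility) are ordered by distance. The middle coordinate lets an indifferent
  -- agent try `j` before `k`; within one facility the order is that of its queue.
  let key : Fin n × Fin 2 → ℝ ×ₗ ℕ ×ₗ Fin n := fun p =>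
    toLex (|x p.1 - y p.2|, toLex (if p.2 = j then 0 else 1, tie p.2 p.1))
  have key_lt : ∀ p p', key p < key p' ↔ |x p.1 - y p.2| < |x p'.1 - y p'.2| ∨
      (|x p.1 - y p.2| = |x p'.1 - y p'.2| ∧
        ((if p.2 = j then 0 else 1) < (if p'.2 = j then 0 else 1) ∨
          ((if p.2 = j then 0 else 1) = (if p'.2 = j then 0 else 1) ∧
            tie p.2 p.1 < tie p'.2 p'.1))) := by
    intro p p'
    simp only [key, Prod.Lex.toLex_lt_toLex]
  have key_prec : ∀ l i c, key (l, c) < key (i, c) ↔ Precedes tie x y c l i := by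
    intro l i c
    rw [key_lt]; simp [Precedes]
  let r : Fin n × Fin 2 → Fin n × Fin 2 → Prop := fun p p' => key p < key p'
  have hwf : WellFounded r := by
    have : IsTrans _ r := ⟨fun a b c h h' => lt_trans h h'⟩
    have : Std.Irrefl r := ⟨fun a h => lt_irrefl _ h⟩
    exact Finite.wellFounded_of_trans_of_irrefl r
  -- Greedy matching along this order: a pair is accepted iff the agent has not been accepted
  -- earlier and the facility still has a seat.
  let M : Fin n × Fin 2 → Prop := hwf.fix fun p ih =>
    (∀ p' (h : r p' p), p'.1 = p.1 → ¬ ih p' h) ∧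
      {l | ∃ h : r (l, p.2) p, ih (l, p.2) h}.ncard < cap q n p.2
  have hM : ∀ i c, M (i, c) ↔ (∀ c', key (i, c') < key (i, c) → ¬ M (i, c')) ∧
      {l | Precedes tie x y c l i ∧ M (l, c)}.ncard < cap q n c := by
    intro i c
    have : M (i, c) = _ := hwf.fix_eq _ _
    rw [this]
    have e : {l | ∃ _ : r (l, c) (i, c), M (l, c)} = {l | Precedes tie x y c l i ∧ M (l, c)} := by
      ext l
      simp [r, key_prec]
    constructor
    · rintro ⟨h1, h2⟩
      refine ⟨fun c' h => h1 (i, c') h rfl, ?_⟩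
      rw [← e]; exact h2
    · rintro ⟨h1, h2⟩
      refine ⟨?_, ?_⟩
      · rintro ⟨i', c'⟩ h rfl
        exact h1 c' h
      · rw [← e] at h2; exact h2
  have huniq : ∀ i, M (i, j) → ¬ M (i, k) := by
    intro i h1 h2
    have hne : key (i, j) ≠ key (i, k) := by
      simp [key, hjk.symm]
    rcases lt_or_gt_of_ne hne with h | h
    · exact ((hM i k).1 h2).1 j h h1
    · exact ((hM i j).1 h1).1 k h h2
  let s : Fin n → Fin 2 := fun i => if M (i, j) then j else k
  have hs : ∀ i c, M (i, c) → s i = c := by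
    intro i c h
    rcases fin_two_eq_or hjk c with rfl | rfl
    · simp [s, h]
    · have : ¬ M (i, j) := fun h' => huniq i h' h
      simp [s, this]
  have hacc : ∀ i c, M (i, c) → Accommodated tie q x y s i := by
    intro i c h
    have hsi := hs i c h
    rw [accommodated_iff, hsi]
    refine lt_of_le_of_lt (Set.ncard_le_ncard ?_ (Set.toFinite _)) ((hM i c).1 h).2
    rintro l ⟨hl, hp⟩
    refine ⟨hp, ?_⟩
    rcases fin_two_eq_or hjk c with rfl | rfl
    · by_contra hn
      simp only [s, hn, if_false] at hl
      exact hjk hl.symm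
    -- Unmatched agents also select `k` by default, so it must be shown that none of them is ahead
    -- of `i`: it would have found a seat, since `i`, which comes later, found one.
    · have hlj : ¬ M (l, j) := by
        intro hn
        simp only [s, hn, if_true] at hl
        exact hjk hl
      by_contra hn
      rw [hM] at hn
      apply hn
      refine ⟨fun c' h' => ?_, ?_⟩
      · rcases fin_two_eq_or hjk c' with rfl | rfl
        · exact hlj
        · exact absurd h' (lt_irrefl _)
      · refine lt_of_le_of_lt (Set.ncard_le_ncard ?_ (Set.toFinite _)) ((hM i c).1 h).2
        exact fun m hm => ⟨hm.1.trans hp, hm.2⟩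
  refine ⟨s, ?_, ?_⟩
  · intro i c
    by_cases ha : Accommodated tie q x y (Function.update s i c) i
    · rw [utility_of_accommodated ha, Function.update_self]
      rw [accommodated_update_iff] at ha
      have hcount : {l | Precedes tie x y c l i ∧ M (l, c)}.ncard < cap q n c := by
        refine lt_of_le_of_lt (Set.ncard_le_ncard ?_ (Set.toFinite _)) ha
        exact fun l hl => ⟨hs l c hl.2, hl.1⟩
      -- Either the greedy procedure accepts `(i, c)`, or it has accepted `i` earlier at a facility
      -- no further away than `c`.
      by_cases hb : ∀ c', key (i, c') < key (i, c) → ¬ M (i, c')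
      · have hMi : M (i, c) := (hM i c).2 ⟨hb, hcount⟩
        rw [utility_of_accommodated (hacc i c hMi), hs i c hMi]
      · push Not at hb
        obtain ⟨c', hk, hMi⟩ := hb
        rw [utility_of_accommodated (hacc i c' hMi), hs i c' hMi]
        rw [key_lt] at hk
        have : |x i - y c'| ≤ |x i - y c| := hk.elim le_of_lt fun h => h.1.le
        linarith
    · rw [utility_of_not_accommodated ha]
      exact utility_nonneg hx hy s i
  · intro i hd hc
    apply hs
    rw [hM]
    refine ⟨fun c' h' => ?_, lt_of_le_of_lt (Set.ncard_le_ncard (fun l hl => hl.1) (Set.toFinite _)) hc⟩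
    exfalso
    rcases fin_two_eq_or hjk c' with rfl | rfl
    · exact lt_irrefl _ h'
    · rw [key_lt] at h'
      simp only [hjk.symm, if_true, if_false] at h'
      rcases h' with h' | ⟨_, h' | ⟨h', _⟩⟩
      · exact absurd hd (not_le.2 h')
      · omega
      · omega

lemma welfare_eq_sum_servedBy {j k : Fin 2} (hjk : j ≠ k) : welfare tie q x y s =
    ∑ i ∈ servedBy tie q x y s j, (1 - |x i - y j|) +
      ∑ i ∈ servedBy tie q x y s k, (1 - |x i - y k|) := by
  classical
  unfold welfare
  have h1 : ∀ c, ∑ i ∈ servedBy tie q x y s c, (1 - |x i - y c|) =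
      ∑ i, if s i = c then utility tie q x y s i else 0 := by
    intro c
    rw [servedBy, Finset.sum_filter]
    refine Finset.sum_congr rfl fun i _ => ?_
    by_cases h : s i = c
    · by_cases ha : Accommodated tie q x y s i
      · simp [h, ha, utility_of_accommodated ha]
      · simp [ha, utility_of_not_accommodated ha]
    · simp [h]
  rw [h1, h1, ← Finset.sum_add_distrib]
  refine Finset.sum_congr rfl fun i _ => ?_
  rcases fin_two_eq_or hjk (s i) with h | h
  · simp [h, hjk]
  · simp [h, hjk.symm]

end Game

/-! ### Order statistics -/

section OrderStatistics

variable {n : ℕ} {x : Fin n → ℝ} {k : ℕ}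

lemma leftmost_of_lt (x : Fin n → ℝ) (hk : k < n) : leftmost x k = x (Tuple.sort x ⟨k, hk⟩) := by
  simp [leftmost, hk]

lemma leftmost_mem {S : Set ℝ} (hx : ∀ i, x i ∈ S) (hk : k < n) : leftmost x k ∈ S := by
  rw [leftmost_of_lt x hk]; exact hx _

lemma ncard_lt_le_of_le_leftmost (hk : k < n) {P : Fin n → Prop}
    (h : ∀ i, P i → x i < leftmost x k) : {i | P i}.ncard ≤ k := by
  have hsub : {i | P i} ⊆ Tuple.sort x '' (Iio ⟨k, hk⟩) := by
    intro i hi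
    refine ⟨(Tuple.sort x).symm i, ?_, by simp⟩
    by_contra hn
    have h1 : (⟨k, hk⟩ : Fin n) ≤ (Tuple.sort x).symm i := not_lt.1 hn
    have h2 := Tuple.monotone_sort x h1
    simp only [Function.comp, Equiv.apply_symm_apply] at h2
    have h3 := h i hi
    rw [leftmost_of_lt x hk] at h3
    exact absurd h2 (not_le.2 h3)
  refine (Set.ncard_le_ncard hsub (Set.toFinite _)).trans ?_
  rw [Set.ncard_image_of_injective _ (Tuple.sort x).injective, ← Finset.coe_Iio,
    Set.ncard_coe_finset, Fin.card_Iio]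

lemma lt_ncard_of_leftmost_le (hk : k < n) {t : ℝ} (h : leftmost x k ≤ t) :
    k < {i | x i ≤ t}.ncard := by
  have hsub : Tuple.sort x '' (Iic ⟨k, hk⟩) ⊆ {i | x i ≤ t} := by
    rintro _ ⟨m, hm, rfl⟩
    refine le_trans ?_ h
    rw [leftmost_of_lt x hk]
    exact Tuple.monotone_sort x hm
  have := Set.ncard_le_ncard hsub (Set.toFinite _)
  rw [Set.ncard_image_of_injective _ (Tuple.sort x).injective, ← Finset.coe_Iic,
    Set.ncard_coe_finset, Fin.card_Iic] at this
  exact this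

lemma le_ncard_between_leftmost {a b : ℕ} (hb : b < n) :
    b + 1 - a ≤ {i | leftmost x a ≤ x i ∧ x i ≤ leftmost x b}.ncard := by
  by_cases hab : a ≤ b
  · have ha := hab.trans_lt hb
    -- Between the two order statistics lie all agents with ranks from `a` to `b`, both included.
    have hsub : Tuple.sort x '' (Icc ⟨a, ha⟩ ⟨b, hb⟩) ⊆
        {i | leftmost x a ≤ x i ∧ x i ≤ leftmost x b} := by
      rintro _ ⟨m, hm, rfl⟩
      rw [mem_ofPred_eq, leftmost_of_lt x ha, leftmost_of_lt x hb]
      exact ⟨Tuple.monotone_sort x hm.1, Tuple.monotone_sort x hm.2⟩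
    have := Set.ncard_le_ncard hsub (Set.toFinite _)
    rwa [Set.ncard_image_of_injective _ (Tuple.sort x).injective, ← Finset.coe_Icc,
      Set.ncard_coe_finset, Fin.card_Icc] at this
  · omega

end OrderStatistics

/-! ### Sufficiency for equilibrium stability -/

section Between

variable {n : ℕ} {tie : Fin 2 → Equiv.Perm (Fin n)} {q : Fin 2 → ℝ} {x : Fin n → ℝ}
  {y : Fin 2 → ℝ} {s : Fin n → Fin 2}

/-- The agents that lie between the facilities `j` and `k`. -/
def between (x : Fin n → ℝ) (y : Fin 2 → ℝ) (j k : Fin 2) : Finset (Fin n) :=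
  Finset.univ.filter fun i => |x i - y j| + |x i - y k| = |y j - y k|

lemma mem_between {j k : Fin 2} {i : Fin n} :
    i ∈ between x y j k ↔ |x i - y j| + |x i - y k| = |y j - y k| := by simp [between]

lemma between_comm (j k : Fin 2) : between x y j k = between x y k j := by
  ext i; rw [mem_between, mem_between, add_comm, abs_sub_comm (y j)]

lemma abs_sub_le_of_ne_of_le {a u v : ℝ} (h : |a - u| + |a - v| ≠ |u - v|)
    (h' : |a - v| ≤ |a - u|) : |u - v| ≤ |a - u| := by
  rcases abs_cases (a - u) with ⟨h1, _⟩ | ⟨h1, _⟩ <;>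
  rcases abs_cases (a - v) with ⟨h2, _⟩ | ⟨h2, _⟩ <;>
  rcases abs_cases (u - v) with ⟨h3, _⟩ | ⟨h3, _⟩ <;>
  rw [h1, h2] at h h' <;> rw [h3] at h ⊢ <;> rw [h1] <;>
  first
  | linarith
  | exact absurd (by linarith) h

/-- Positive utility means that the agent has a seat; if not at `j` then at `k`, and `k` can match
the offer of `j` only by being at least as close. -/
lemma mem_servedBy_other {j k : Fin 2} (hjk : j ≠ k) {i : Fin n} (hlt : |x i - y j| < 1)
    (hu : 1 - |x i - y j| ≤ utility tie q x y s i) (hi : i ∉ servedBy tie q x y s j) :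
    i ∈ servedBy tie q x y s k ∧ |x i - y k| ≤ |x i - y j| := by
  have ha : Accommodated tie q x y s i := accommodated_of_utility_pos (by linarith)
  have hk : s i = k := (fin_two_eq_or hjk (s i)).resolve_left fun h => hi (mem_servedBy.2 ⟨h, ha⟩)
  refine ⟨mem_servedBy.2 ⟨hk, ha⟩, ?_⟩
  rw [utility_of_accommodated ha, hk] at hu
  linarith

/-- If an agent between the facilities that is closer to `k` is accommodated by `k`, so are the
agents between it and `k`. -/
lemma IsNash.mem_servedBy_of_between (h : IsNash tie q x y s) (hx : ∀ i, x i ∈ Icc (0 : ℝ) 1)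
    (hy : y ∈ square) {j k : Fin 2} (hjk : j ≠ k) {i l : Fin n} (hi : i ∈ between x y j k)
    (hl : l ∈ between x y j k) (his : i ∈ servedBy tie q x y s k)
    (hd : |x i - y k| ≤ |x i - y j|) (hlt : |x l - y k| < |x i - y k|) :
    l ∈ servedBy tie q x y s k := by
  by_contra hn
  have h1 := abs_sub_le_one (hx i) (hy k)
  have := (mem_servedBy_other hjk.symm (by linarith) (h.le_utility_of_lt his hlt) hn).2
  rw [mem_between] at hi hl
  linarith

lemma IsNash.mem_servedBy_of_lt (h : IsNash tie q x y s) (hx : ∀ i, x i ∈ Icc (0 : ℝ) 1)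
    (hy : y ∈ square) {j k : Fin 2} (hjk : j ≠ k)
    (hN : cap q n j + cap q n k ≤ (between x y j k).card) {r : ℝ} (hr : r ≤ 1)
    (hr1 : {i | |x i - y j| < r}.ncard < cap q n j) {i : Fin n} (hi : |x i - y j| < r) :
    i ∈ servedBy tie q x y s j := by
  classical
  by_contra hn
  have hgo : 1 - |x i - y j| ≤ utility tie q x y s i := by
    refine h.le_utility (lt_of_le_of_lt (Set.ncard_le_ncard ?_ (Set.toFinite _)) hr1)
    exact fun l hl => lt_of_le_of_lt hl.2.le hi
  obtain ⟨hik, hd⟩ := mem_servedBy_other hjk (by linarith) hgo hn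
  have hcount : ∀ S : Finset (Fin n), (∀ l ∈ S, |x l - y j| < r) → S.card < cap q n j := by
    intro S hS
    refine lt_of_le_of_lt ?_ hr1
    rw [← Set.ncard_coe_finset]
    exact Set.ncard_le_ncard (fun l hl => hS l hl) (Set.toFinite _)
  by_cases hb : i ∈ between x y j k
  · set B := between x y j k
    have h1 : (B.filter fun l => |x l - y k| < |x i - y k|).card < (servedBy tie q x y s k).card := by
      refine Finset.card_lt_card ⟨fun l hl => ?_, fun hsub => ?_⟩
      · obtain ⟨hl, hlt⟩ := Finset.mem_filter.1 hl
        exact h.mem_servedBy_of_between hx hy hjk hb hl hik hd hlt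
      · exact lt_irrefl _ (Finset.mem_filter.1 (hsub hik)).2
    have h2 : (B.filter fun l => ¬ |x l - y k| < |x i - y k|).card < cap q n j := by
      refine hcount _ fun l hl => ?_
      obtain ⟨hl, hlt⟩ := Finset.mem_filter.1 hl
      rw [mem_between] at hl hb
      push Not at hlt
      linarith
    have h3 := Finset.card_filter_add_card_filter_not (s := B) fun l => |x l - y k| < |x i - y k|
    have h4 := card_servedBy_le (tie := tie) (q := q) (x := x) (y := y) (s := s) k
    omega
  · have hD := abs_sub_le_of_ne_of_le (mt mem_between.2 hb) hd
    have := hcount (between x y j k) fun l hl => by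
      rw [mem_between] at hl
      linarith [abs_nonneg (x l - y k)]
    omega

/-- If the facility `j` could serve everybody at distance at most `r`, but does not, then all agents
between the facilities are accommodated, the ones at distance more than `r` from `j` by `k`. -/
lemma IsNash.between_served (h : IsNash tie q x y s) (hx : ∀ i, x i ∈ Icc (0 : ℝ) 1)
    (hy : y ∈ square) {j k : Fin 2} (hjk : j ≠ k) {r : ℝ} (hr : r < 1)
    (hgo : ∀ i, |x i - y j| ≤ r → 1 - |x i - y j| ≤ utility tie q x y s i)
    {i : Fin n} (hi : |x i - y j| ≤ r) (hn : i ∉ servedBy tie q x y s j) :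
    ∀ l ∈ between x y j k, l ∈ servedBy tie q x y s k ∨
      (|x l - y j| ≤ r ∧ l ∈ servedBy tie q x y s j) := by
  obtain ⟨hik, hd⟩ := mem_servedBy_other hjk (by linarith) (hgo i hi) hn
  intro l hl
  by_cases hlr : |x l - y j| ≤ r
  · by_cases hlj : l ∈ servedBy tie q x y s j
    · exact Or.inr ⟨hlr, hlj⟩
    · exact Or.inl (mem_servedBy_other hjk (by linarith) (hgo l hlr) hlj).1
  · left
    push Not at hlr
    by_cases hb : i ∈ between x y j k
    · refine h.mem_servedBy_of_between hx hy hjk hb hl hik hd ?_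
      rw [mem_between] at hl hb
      linarith
    · exfalso
      have hD := abs_sub_le_of_ne_of_le (mt mem_between.2 hb) hd
      rw [mem_between] at hl
      linarith [abs_nonneg (x l - y k)]

/-- The welfare produced by facility `j` if it serves the closest agents. -/
def topValue (q : Fin 2 → ℝ) (x : Fin n → ℝ) (y : Fin 2 → ℝ) (j : Fin 2) : ℝ :=
  let r := leftmost (fun i => |x i - y j|) (cap q n j - 1)
  ∑ i with |x i - y j| < r, (r - |x i - y j|) + cap q n j * (1 - r)

lemma cap_le (hq : ∀ j, 0 < q j) (hQ : q 0 + q 1 < 1) (n : ℕ) (j : Fin 2) : cap q n j ≤ n := by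
  have : q j ≤ 1 := by
    rcases fin_two_eq_or (zero_ne_one) j with rfl | rfl
    · linarith [hq 1]
    · linarith [hq 0]
  refine Nat.floor_le_of_le ?_
  nlinarith [Nat.cast_nonneg (α := ℝ) n]

/-- With `r` the distance of rank `cap j`, the facility serves everybody closer than `r`, nobody
further, and fills up with ties at `r`. Writing each utility as `(r - d) + (1 - r)` makes the ties
invisible in the first part and leaves only the number of served agents in the second. -/
lemma IsNash.sum_servedBy_eq_topValue (h : IsNash tie q x y s) (hx : ∀ i, x i ∈ Icc (0 : ℝ) 1)
    (hy : y ∈ square) (hq : ∀ j, 0 < q j) (hQ : q 0 + q 1 < 1) {j k : Fin 2} (hjk : j ≠ k)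
    (hN : cap q n j + cap q n k ≤ (between x y j k).card) :
    ∑ i ∈ servedBy tie q x y s j, (1 - |x i - y j|) = topValue q x y j := by
  classical
  have hcn := cap_le hq hQ n j
  have hcj := card_servedBy_le (tie := tie) (q := q) (x := x) (y := y) (s := s) j
  have hck := card_servedBy_le (tie := tie) (q := q) (x := x) (y := y) (s := s) k
  unfold topValue
  set r := leftmost (fun i => |x i - y j|) (cap q n j - 1) with hrdef
  -- Without seats the index `cap - 1` truncates to 0, so that `r` is the smallest distance and the
  -- sum over smaller distances is empty.
  rcases Nat.eq_zero_or_pos (cap q n j) with h0 | hpos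
  · have he : servedBy tie q x y s j = ∅ := Finset.card_eq_zero.1 (by omega)
    have hf : (Finset.univ.filter fun i => |x i - y j| < r) = ∅ := by
      rcases Nat.eq_zero_or_pos n with hn | hn
      · subst hn; exact Finset.eq_empty_of_isEmpty _
      · have h1 := ncard_lt_le_of_le_leftmost (x := fun i => |x i - y j|) (k := cap q n j - 1)
          (by omega) (P := fun i => |x i - y j| < r) (fun i hi => hi)
        rw [h0] at h1
        have h2 := (Set.ncard_eq_zero (Set.toFinite _)).1 (Nat.le_zero.1 h1)
        refine Finset.filter_false_of_mem fun i _ hi => ?_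
        exact (h2 ▸ (show i ∈ {i | |x i - y j| < r} from hi) : i ∈ (∅ : Set (Fin n)))
    simp [he, hf, h0]
  have hkn : cap q n j - 1 < n := by omega
  have hr1 : {i | |x i - y j| < r}.ncard < cap q n j := by
    have := ncard_lt_le_of_le_leftmost (x := fun i => |x i - y j|) hkn
      (P := fun i => |x i - y j| < r) (fun i hi => hi)
    omega
  have hr2 : cap q n j ≤ (Finset.univ.filter fun i => |x i - y j| ≤ r).card := by
    have := lt_ncard_of_leftmost_le (x := fun i => |x i - y j|) hkn (t := r) le_rfl
    rw [← Set.ncard_coe_finset]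
    simp only [Finset.coe_filter, Finset.mem_univ, true_and]
    omega
  have hr : r ≤ 1 := by
    have : r ∈ Iic (1 : ℝ) := leftmost_mem (fun i => abs_sub_le_one (hx i) (hy j)) hkn
    exact this
  have hin : ∀ i, |x i - y j| < r → i ∈ servedBy tie q x y s j := fun i hi =>
    h.mem_servedBy_of_lt hx hy hjk hN hr hr1 hi
  -- a facility that could serve everybody at distance at most `r` does not leave one out
  have hkey : ∀ S : Finset (Fin n), S.card < cap q n j →
      (S.filter fun i => |x i - y j| ≤ r) = (servedBy tie q x y s j).filter (fun i => |x i - y j| ≤ r)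
      → r < 1 → (∀ i, |x i - y j| ≤ r → 1 - |x i - y j| ≤ utility tie q x y s i) → False := by
    intro S hSc hSe hr' hgo
    have : ∃ i, |x i - y j| ≤ r ∧ i ∉ servedBy tie q x y s j := by
      by_contra hall
      push Not at hall
      have : (Finset.univ.filter fun i => |x i - y j| ≤ r) ⊆ S := by
        intro i hi
        have hi' := (Finset.mem_filter.1 hi).2
        have : i ∈ (servedBy tie q x y s j).filter (fun i => |x i - y j| ≤ r) :=
          Finset.mem_filter.2 ⟨hall i hi', hi'⟩
        rw [← hSe] at this
        exact (Finset.mem_filter.1 this).1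
      have := Finset.card_le_card this
      omega
    obtain ⟨i, hi, hin⟩ := this
    have hb := h.between_served hx hy hjk hr' hgo hi hin
    have : (between x y j k) ⊆ S ∪ servedBy tie q x y s k := by
      intro l hl
      rcases hb l hl with hl | ⟨hl1, hl2⟩
      · exact Finset.mem_union_right _ hl
      · refine Finset.mem_union_left _ ?_
        have : l ∈ (servedBy tie q x y s j).filter (fun i => |x i - y j| ≤ r) :=
          Finset.mem_filter.2 ⟨hl2, hl1⟩
        rw [← hSe] at this
        exact (Finset.mem_filter.1 this).1
    have := (Finset.card_le_card this).trans (Finset.card_union_le _ _)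
    omega
  have hout : ∀ i ∈ servedBy tie q x y s j, |x i - y j| ≤ r := by
    intro m hm
    by_contra hlt
    push Not at hlt
    -- An agent beyond `r` holds a seat that anyone within `r` could claim. Removing it leaves fewer
    -- than `cap j` agents and the same agents within `r`.
    refine hkey ((servedBy tie q x y s j).erase m) ?_ ?_
      (hlt.trans_le (abs_sub_le_one (hx m) (hy j))) fun i hi => h.le_utility_of_lt hm (by linarith)
    · rw [Finset.card_erase_of_mem hm]
      have := Finset.card_pos.2 ⟨m, hm⟩
      omega
    · ext i
      simp only [Finset.mem_filter, Finset.mem_erase]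
      constructor
      · rintro ⟨⟨_, h1⟩, h2⟩; exact ⟨h1, h2⟩
      · rintro ⟨h1, h2⟩
        refine ⟨⟨?_, h1⟩, h2⟩
        rintro rfl
        linarith
  -- The facility is full unless `r = 1`; then empty seats do not matter because the factor `1 - r`
  -- vanishes.
  have hcard : ((servedBy tie q x y s j).card : ℝ) * (1 - r) = cap q n j * (1 - r) := by
    rcases hr.lt_or_eq with hr' | hr'
    · congr 2
      refine le_antisymm hcj ?_
      by_contra hlt
      push Not at hlt
      exact hkey _ hlt rfl hr' fun i _ =>
        h.le_utility (ncard_lt_cap_of_card_servedBy_lt hlt _)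
    · simp [hr']
  have hsum : ∑ i ∈ servedBy tie q x y s j, (r - |x i - y j|) =
      ∑ i with |x i - y j| < r, (r - |x i - y j|) := by
    symm
    refine Finset.sum_subset (fun i hi => hin i (Finset.mem_filter.1 hi).2) fun i hi hi' => ?_
    have h1 := hout i hi
    have h2 : ¬ |x i - y j| < r := fun hh => hi' (Finset.mem_filter.2 ⟨Finset.mem_univ _, hh⟩)
    linarith [not_lt.1 h2]
  change _ = ∑ i with |x i - y j| < r, (r - |x i - y j|) + cap q n j * (1 - r)
  rw [← hcard, ← hsum, ← nsmul_eq_mul, ← Finset.sum_const, ← Finset.sum_add_distrib]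
  exact Finset.sum_congr rfl fun i _ => by ring

lemma percentile_index_lt {p : ℝ} (hp : p ∈ Icc (0 : ℝ) 1) {n : ℕ} (hn : 0 < n) :
    ⌊p * ((n : ℝ) - 1)⌋₊ < n := by
  have hn' : (1 : ℝ) ≤ n := by exact_mod_cast hn
  rw [Nat.floor_lt (by nlinarith [hp.1])]
  nlinarith [hp.1, hp.2]

lemma percentile_mem_square {p : Fin 2 → ℝ} (hp : p ∈ square) (hn : 0 < n)
    (hx : ∀ i, x i ∈ Icc (0 : ℝ) 1) : percentile p x ∈ square :=
  fun j => leftmost_mem hx (percentile_index_lt (hp j) hn)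

/-- Percentile mechanisms whose facilities are far apart are equilibrium stable. -/
lemma equilibriumStable_of_le (tie : ∀ n : ℕ, Fin 2 → Equiv.Perm (Fin n)) {q p : Fin 2 → ℝ}
    (hq : ∀ j, 0 < q j) (hQ : q 0 + q 1 < 1) (hp : p ∈ square) {j k : Fin 2} (hjk : j ≠ k)
    (hpp : q j + q k ≤ p k - p j) : EquilibriumStable tie q p := by
  intro n x hx s s' hs hs'
  rcases Nat.eq_zero_or_pos n with rfl | hn
  · simp [welfare]
  have hn1 : (1 : ℝ) ≤ n := by exact_mod_cast hn
  have hy := percentile_mem_square hp hn hx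
  have hQ' : q j + q k < 1 := by
    rcases fin_two_eq_or zero_ne_one j with rfl | rfl <;>
    rcases fin_two_eq_or zero_ne_one k with rfl | rfl
    · exact absurd rfl hjk
    · exact hQ
    · linarith
    · exact absurd rfl hjk
  have hN : cap q n j + cap q n k ≤ (between x (percentile p x) j k).card := by
    have h1 := le_ncard_between_leftmost (x := x) (a := ⌊p j * ((n : ℝ) - 1)⌋₊)
      (percentile_index_lt (hp k) hn)
    have h2 : cap q n j + cap q n k ≤
        ⌊p k * ((n : ℝ) - 1)⌋₊ + 1 - ⌊p j * ((n : ℝ) - 1)⌋₊ := by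
      have e1 : (cap q n j : ℝ) ≤ q j * n := Nat.floor_le (by have := hq j; positivity)
      have e2 : (cap q n k : ℝ) ≤ q k * n := Nat.floor_le (by have := hq k; positivity)
      have e3 := Nat.lt_floor_add_one (p k * ((n : ℝ) - 1))
      have e4 : (⌊p j * ((n : ℝ) - 1)⌋₊ : ℝ) ≤ p j * ((n : ℝ) - 1) :=
        Nat.floor_le (mul_nonneg (hp j).1 (by linarith))
      have e5 : (q j + q k) * ((n : ℝ) - 1) ≤ (p k - p j) * ((n : ℝ) - 1) :=
        mul_le_mul_of_nonneg_right hpp (by linarith)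
      -- Replacing `n - 1` by `n` costs `q j + q k < 1` and rounding `p k (n - 1)` down costs less
      -- than 1. The strict inequality with 2 is therefore just enough for `b + 1 - a` agents.
      have : ((cap q n j + cap q n k + ⌊p j * ((n : ℝ) - 1)⌋₊ : ℕ) : ℝ) <
          ((⌊p k * ((n : ℝ) - 1)⌋₊ + 2 : ℕ) : ℝ) := by
        push_cast
        nlinarith
      have := Nat.cast_lt.1 this
      omega
    refine (h2.trans h1).trans ?_
    rw [← Set.ncard_coe_finset]
    refine Set.ncard_le_ncard ?_ (Set.toFinite _)
    rintro i ⟨ha, hb⟩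
    simp only [Finset.mem_coe, mem_between]
    change percentile p x j ≤ x i at ha
    change x i ≤ percentile p x k at hb
    rw [abs_of_nonneg (by linarith), abs_of_nonpos (by linarith), abs_of_nonpos (by linarith)]
    ring
  have hN' : cap q n k + cap q n j ≤ (between x (percentile p x) k j).card := by
    rw [between_comm, add_comm]; exact hN
  rw [welfare_eq_sum_servedBy hjk, welfare_eq_sum_servedBy hjk,
    hs.sum_servedBy_eq_topValue hx hy hq hQ hjk hN, hs'.sum_servedBy_eq_topValue hx hy hq hQ hjk hN,
    hs.sum_servedBy_eq_topValue hx hy hq hQ hjk.symm hN',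
    hs'.sum_servedBy_eq_topValue hx hy hq hQ hjk.symm hN']

end Between

/-! ### Necessity for equilibrium stability -/

section Clusters

variable {n : ℕ} {tie : Fin 2 → Equiv.Perm (Fin n)} {q : Fin 2 → ℝ} {x : Fin n → ℝ}
  {y : Fin 2 → ℝ} {s : Fin n → Fin 2}

/-- Five clusters of agents: at the facility `j`, at the facility `k`, one agent `m` at the
midpoint, and two outer clusters at distances `α` from `j` and `β` from `k`. -/
def IsClustered (x : Fin n → ℝ) (y : Fin 2 → ℝ) (j k : Fin 2) (m : Fin n) (α β : ℝ) : Prop :=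
  (|x m - y j| = 1 / 10 ∧ |x m - y k| = 1 / 10) ∧ ∀ i,
    (|x i - y j| = 0 ∧ |x i - y k| = 1 / 5) ∨ i = m ∨
    (|x i - y j| = α ∧ |x i - y k| = α + 1 / 5) ∨ (|x i - y j| = 1 / 5 ∧ |x i - y k| = 0) ∨
    (|x i - y j| = β + 1 / 5 ∧ |x i - y k| = β)

lemma IsClustered.symm {j k : Fin 2} {m : Fin n} {α β : ℝ} (h : IsClustered x y j k m α β) :
    IsClustered x y k j m β α := by
  refine ⟨⟨h.1.2, h.1.1⟩, fun i => ?_⟩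
  rcases h.2 i with h | h | h | h | h
  · exact Or.inr (Or.inr (Or.inr (Or.inl ⟨h.2, h.1⟩)))
  · exact Or.inr (Or.inl h)
  · exact Or.inr (Or.inr (Or.inr (Or.inr ⟨h.2, h.1⟩)))
  · exact Or.inl ⟨h.2, h.1⟩
  · exact Or.inr (Or.inr (Or.inl ⟨h.2, h.1⟩))

open Classical in
/-- The agents at distance `d` from facility `j`. -/
def atDist (x : Fin n → ℝ) (y : Fin 2 → ℝ) (j : Fin 2) (d : ℝ) : Finset (Fin n) :=
  Finset.univ.filter fun i => |x i - y j| = d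

lemma mem_atDist {j : Fin 2} {d : ℝ} {i : Fin n} : i ∈ atDist x y j d ↔ |x i - y j| = d := by
  simp [atDist]

/-- Agents at the location of `j` are first in its queue and there are seats for all of them; no
other facility offers them utility 1. -/
lemma IsClustered.atDist_zero_subset {j k : Fin 2} (hjk : j ≠ k) {m : Fin n} {α β : ℝ}
    (hcl : IsClustered x y j k m α β) (hα : 1 / 5 < α) (hβ : 1 / 5 < β) (h : IsNash tie q x y s)
    (hU : (atDist x y j 0).card < cap q n j) :
    atDist x y j 0 ⊆ servedBy tie q x y s j := by
  intro i hi
  have hi0 := mem_atDist.1 hi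
  by_contra hn
  have hgo : 1 - |x i - y j| ≤ utility tie q x y s i := by
    refine h.le_utility (lt_of_le_of_lt ?_ hU)
    rw [← Set.ncard_coe_finset]
    refine Set.ncard_le_ncard (fun l hl => ?_) (Set.toFinite _)
    have := hl.2.le
    rw [hi0] at this
    exact mem_atDist.2 (le_antisymm this (abs_nonneg _))
  have h1 := (mem_servedBy_other hjk (by rw [hi0]; norm_num) hgo hn).2
  rw [hi0] at h1
  rcases hcl.2 i with h | h | h | h | h
  · linarith
  · subst h; linarith [hcl.1.1]
  · linarith
  · linarith
  · linarith

lemma IsClustered.ncard_precedes_lt {j k : Fin 2} {m : Fin n} {α β : ℝ}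
    (hcl : IsClustered x y j k m α β) (hα : 1 / 5 < α) (hβ : 1 / 5 < β)
    (hU : (atDist x y j 0).card < cap q n j) :
    {l | Precedes tie x y j l m}.ncard < cap q n j := by
  refine lt_of_le_of_lt ?_ hU
  rw [← Set.ncard_coe_finset]
  refine Set.ncard_le_ncard (fun l hl => ?_) (Set.toFinite _)
  have hl : Precedes tie x y j l m := hl
  have hle := hl.le
  rw [hcl.1.1] at hle
  refine mem_atDist.2 ?_
  rcases hcl.2 l with h | h | h | h | h
  · exact h.1
  · subst h; exact absurd hl Precedes.irrefl
  · linarith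
  · linarith
  · linarith

-- Seats of `j` go to its own cluster, to `m` if it selects `j`, and only then to the outer cluster
-- at distance `α`; so a seat taken by `m` may be lost to the outer cluster. Agents of the opposite
-- outer cluster come later, by `hαβ`, and do not affect the sum: by `hO` either no seats remain for
-- them or their utility at distance `β + 1/5 = 1` is zero.
open Classical in
lemma IsClustered.sum_servedBy {j k : Fin 2} (hjk : j ≠ k) {m : Fin n} {α β : ℝ}
    (hcl : IsClustered x y j k m α β) (hα : 1 / 5 < α) (hα1 : α < 1) (hβ : 1 / 5 < β)
    (hαβ : α < β + 1 / 5) (h : IsNash tie q x y s)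
    (hU : (atDist x y j 0).card < cap q n j) (hV : (atDist x y k 0).card < cap q n k)
    (hO : cap q n j ≤ (atDist x y j 0).card + (atDist x y j α).card ∨ β + 1 / 5 = 1) :
    ∑ i ∈ servedBy tie q x y s j, (1 - |x i - y j|) =
      (atDist x y j 0).card + (if s m = j then 9 / 10 else 0) +
      (1 - α) * (min (atDist x y j α).card
        (cap q n j - (atDist x y j 0).card - if s m = j then 1 else 0) : ℕ) := by
  set S := servedBy tie q x y s j with hS
  set U := atDist x y j 0 with hUdef
  set O := atDist x y j α with hOdef
  have hUS : U ⊆ S := hcl.atDist_zero_subset hjk hα hβ h hU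
  have hVS : ∀ i, |x i - y k| = 0 → i ∉ S := by
    intro i hi hiS
    have := hcl.symm.atDist_zero_subset hjk.symm hβ hα h hV (mem_atDist.2 hi)
    exact hjk ((mem_servedBy.1 hiS).1.symm.trans (mem_servedBy.1 this).1)
  have hmS : m ∈ S ↔ s m = j := by
    rw [hS, mem_servedBy, and_iff_left_iff_imp]
    intro _
    apply accommodated_of_utility_pos
    refine lt_of_lt_of_le ?_ (h.le_utility (j := j) (lt_of_le_of_lt (Set.ncard_le_ncard
      (fun l hl => hl.2) (Set.toFinite _)) (hcl.ncard_precedes_lt (tie := tie) hα hβ hU)))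
    rw [hcl.1.1]; norm_num
  have hmU : m ∉ U := by rw [mem_atDist, hcl.1.1]; norm_num
  have hmO : m ∉ O := by rw [mem_atDist, hcl.1.1]; linarith
  have hUO : Disjoint U O := by
    rw [Finset.disjoint_left]
    intro i h1 h2
    rw [mem_atDist] at h1 h2
    linarith
  -- the part of the queue that is not further away than the outer cluster
  set e : ℕ := if s m = j then 1 else 0 with he
  set N := U ∪ (S ∩ O) ∪ (if s m = j then {m} else ∅) with hN
  have hNcard : N.card = U.card + (S ∩ O).card + e := by
    rw [hN, Finset.card_union_of_disjoint, Finset.card_union_of_disjoint]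
    · congr 1
      by_cases hm : s m = j <;> simp [hm, he]
    · exact hUO.mono_right Finset.inter_subset_right
    · by_cases hm : s m = j
      · simp [hm, hmU, hmO]
      · simp [hm]
  have hNS : N ⊆ S := by
    intro i hi
    simp only [hN, Finset.mem_union, Finset.mem_inter] at hi
    rcases hi with (hi | hi) | hi
    · exact hUS hi
    · exact hi.1
    · by_cases hm : s m = j
      · simp only [hm, if_true, Finset.mem_singleton] at hi
        subst hi; exact hmS.2 hm
      · simp [hm] at hi
  have hScap : S.card ≤ cap q n j := card_servedBy_le j
  have hgoO : ∀ i ∈ O, 1 - |x i - y j| ≤ utility tie q x y s i → i ∈ S := by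
    intro i hi hgo
    have hiα := mem_atDist.1 hi
    by_contra hn
    have h1 := (mem_servedBy_other hjk (by linarith) hgo hn).2
    rcases hcl.2 i with h | h | h | h | h
    · linarith
    · subst h; exact hmO hi
    · linarith
    · linarith
    · linarith
  have hSN : ∀ i ∈ S, i ∉ N → |x i - y j| = β + 1 / 5 := by
    intro i hi hiN
    simp only [hN, Finset.mem_union, Finset.mem_inter, not_or] at hiN
    rcases hcl.2 i with h | h | h | h | h
    · exact absurd (mem_atDist.2 h.1) hiN.1.1
    · subst h
      have := hmS.1 hi
      simp [this] at hiN
    · exact absurd ⟨hi, mem_atDist.2 h.1⟩ hiN.1.2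
    · exact absurd hi (hVS i h.2)
    · exact h.1
  have hfarO : ∀ p ∈ S, p ∉ N → O ⊆ S := by
    intro p hp hpN i hi
    refine hgoO i hi (h.le_utility_of_lt hp ?_)
    rw [hSN p hp hpN, mem_atDist.1 hi]
    exact hαβ
  have hTcard : (S ∩ O).card = min O.card (cap q n j - U.card - e) := by
    have h1 : (S ∩ O).card ≤ O.card := Finset.card_le_card Finset.inter_subset_right
    have h2 := Finset.card_le_card hNS
    by_cases hOS : O ⊆ S
    · rw [Finset.inter_eq_right.2 hOS] at hNcard ⊢
      omega
    · obtain ⟨i, hiO, hiS⟩ := Finset.not_subset.1 hOS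
      have h3 : S ⊆ N := by
        intro p hp
        by_contra hpN
        exact hOS (hfarO p hp hpN)
      have h4 : S.card = cap q n j := by
        refine le_antisymm hScap ?_
        by_contra hlt
        push Not at hlt
        exact hiS (hgoO i hiO (h.le_utility (ncard_lt_cap_of_card_servedBy_lt hlt _)))
      have h5 := Finset.card_le_card h3
      omega
  have hsumN : ∑ i ∈ N, (1 - |x i - y j|) = ∑ i ∈ S, (1 - |x i - y j|) := by
    refine Finset.sum_subset hNS fun p hp hpN => ?_
    rw [hSN p hp hpN]
    rcases hO with hO | hO
    · exfalso
      have h1 := hfarO p hp hpN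
      have h2 := Finset.card_lt_card (Finset.ssubset_iff_subset_ne.2 ⟨hNS, fun hh => hpN (hh ▸ hp)⟩)
      rw [Finset.inter_eq_right.2 h1] at hNcard
      omega
    · rw [hO]; ring
  rw [← hsumN, ← hTcard, hN, Finset.sum_union, Finset.sum_union]
  · have e1 : ∑ i ∈ U, (1 - |x i - y j|) = U.card := by
      rw [Finset.sum_congr rfl (g := fun _ => (1 : ℝ))]
      · simp
      · intro i hi; rw [mem_atDist.1 hi]; ring
    have e2 : ∑ i ∈ S ∩ O, (1 - |x i - y j|) = (1 - α) * (S ∩ O).card := by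
      rw [Finset.sum_congr rfl (g := fun _ => (1 - α : ℝ))]
      · rw [Finset.sum_const, nsmul_eq_mul, mul_comm]
      · intro i hi; rw [mem_atDist.1 (Finset.mem_inter.1 hi).2]
    have e3 : ∑ i ∈ (if s m = j then {m} else ∅ : Finset (Fin n)), (1 - |x i - y j|) =
        if s m = j then 9 / 10 else 0 := by
      by_cases hm : s m = j
      · simp only [hm, if_true, Finset.sum_singleton, hcl.1.1]; norm_num
      · simp [hm]
    rw [e1, e2, e3]; ring
  · exact hUO.mono_right Finset.inter_subset_right
  · by_cases hm : s m = j
    · simp [hm, hmU, hmO]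
    · simp [hm]

/-- In a clustered population the agent at the midpoint decides upon the welfare. -/
lemma IsClustered.exists_nash_ne (tie : Fin 2 → Equiv.Perm (Fin n)) {j k : Fin 2} (hjk : j ≠ k)
    {m : Fin n} {α β : ℝ} (hx : ∀ i, x i ∈ Icc (0 : ℝ) 1) (hy : y ∈ square)
    (hcl : IsClustered x y j k m α β) (hα : 1 / 5 < α) (hα1 : α < 1) (hβ : 1 / 5 < β) (hβ1 : β < 1)
    (hαβ : α < β + 1 / 5) (hβα : β < α + 1 / 5)
    (hU : (atDist x y j 0).card < cap q n j) (hV : (atDist x y k 0).card < cap q n k)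
    (hO : cap q n j ≤ (atDist x y j 0).card + (atDist x y j α).card ∨ β + 1 / 5 = 1)
    (hP : cap q n k ≤ (atDist x y k 0).card + (atDist x y k β).card ∨ α + 1 / 5 = 1)
    (hne : (1 - α) * (min (atDist x y j α).card (cap q n j - (atDist x y j 0).card - 1) : ℕ) +
        (1 - β) * (min (atDist x y k β).card (cap q n k - (atDist x y k 0).card) : ℕ) ≠
      (1 - α) * (min (atDist x y j α).card (cap q n j - (atDist x y j 0).card) : ℕ) +
        (1 - β) * (min (atDist x y k β).card (cap q n k - (atDist x y k 0).card - 1) : ℕ)) :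
    ∃ s s', IsNash tie q x y s ∧ IsNash tie q x y s' ∧
      welfare tie q x y s ≠ welfare tie q x y s' := by
  -- The two preferences of `exists_isNash` for indifferent agents send the midpoint agent to `j`
  -- and to `k` respectively.
  obtain ⟨s, hs, hsj⟩ := exists_isNash tie q y hx hy hjk
  obtain ⟨s', hs', hsk⟩ := exists_isNash tie q y hx hy hjk.symm
  have h1 : s m = j := hsj m (by rw [hcl.1.1, hcl.1.2]) (hcl.ncard_precedes_lt hα hβ hU)
  have h2 : s' m = k := hsk m (by rw [hcl.1.1, hcl.1.2]) (hcl.symm.ncard_precedes_lt hβ hα hV)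
  refine ⟨s, s', hs, hs', fun hw => hne ?_⟩
  rw [welfare_eq_sum_servedBy hjk, welfare_eq_sum_servedBy hjk,
    hcl.sum_servedBy hjk hα hα1 hβ hαβ hs hU hV hO,
    hcl.symm.sum_servedBy hjk.symm hβ hβ1 hα hβα hs hV hU hP,
    hcl.sum_servedBy hjk hα hα1 hβ hαβ hs' hU hV hO,
    hcl.symm.sum_servedBy hjk.symm hβ hβ1 hα hβα hs' hV hU hP] at hw
  simp only [h1, h2, hjk, hjk.symm, if_true, if_false, Nat.sub_zero] at hw
  linarith

end Clusters

/-- A clustered population, with the clusters delimited by the indices `a ≤ b ≤ c`. -/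
def clusters {n : ℕ} (a b c : ℕ) (u α β : ℝ) (i : Fin n) : ℝ :=
  if i.1 < a then u - α else if i.1 < b then u else if i.1 = b then u + 1 / 10
    else if i.1 ≤ c then u + 1 / 5 else u + 1 / 5 + β

lemma clusters_monotone {n a b c : ℕ} {u α β : ℝ} (hα : 0 ≤ α) (hβ : 0 ≤ β) :
    Monotone (clusters (n := n) a b c u α β) := by
  intro i l hil
  have : i.1 ≤ l.1 := hil
  unfold clusters
  split_ifs <;> first | linarith | omega

lemma leftmost_of_monotone {n : ℕ} {x : Fin n → ℝ} (hx : Monotone x) {k : ℕ} (hk : k < n) :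
    leftmost x k = x ⟨k, hk⟩ := by
  rw [leftmost_of_lt x hk]
  have := Tuple.sort_eq_refl_iff_monotone.2 hx
  rw [this]; rfl

lemma card_filter_fin {n : ℕ} (P : Fin n → Prop) [DecidablePred P] (a b : ℕ) (hb : b ≤ n)
    (hP : ∀ i, P i ↔ a ≤ i.1 ∧ i.1 < b) : (Finset.univ.filter P).card = b - a := by
  have : (Finset.univ.filter P).map Fin.valEmbedding = Finset.Ico a b := by
    ext m
    simp only [Finset.mem_map, Finset.mem_filter, Finset.mem_univ, true_and, Fin.valEmbedding_apply,
      Finset.mem_Ico]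
    constructor
    · rintro ⟨i, hi, rfl⟩; exact (hP i).1 hi
    · intro hm
      exact ⟨⟨m, by omega⟩, (hP _).2 hm, rfl⟩
  rw [← Finset.card_map Fin.valEmbedding, this, Nat.card_Ico]

/-- Two equilibria with different welfare, for facilities at the agents with indices `a' < b'`. -/
lemma exists_nash_ne_of_index {n : ℕ} (tie : Fin 2 → Equiv.Perm (Fin n)) {q : Fin 2 → ℝ}
    {j k : Fin 2} (hjk : j ≠ k) {a' b' a b c : ℕ} {u α β : ℝ}
    (h1 : a ≤ a') (h2 : a' < b) (h3 : b < b') (h4 : b' ≤ c) (h5 : c < n)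
    (hu0 : 0 ≤ u) (hu1 : u ≤ 4 / 5) (ha : a = 0 ∨ α ≤ u) (hc : c = n - 1 ∨ u + 1 / 5 + β ≤ 1)
    (hα : 1 / 5 < α) (hα1 : α < 1) (hβ : 1 / 5 < β) (hβ1 : β < 1)
    (hαβ : α < β + 1 / 5) (hβα : β < α + 1 / 5)
    (hU : b - a < cap q n j) (hV : c - b < cap q n k)
    (hO : cap q n j ≤ b ∨ β + 1 / 5 = 1) (hP : cap q n k ≤ n - 1 - b ∨ α + 1 / 5 = 1)
    (hne : (1 - α) * (min a (cap q n j - (b - a) - 1) : ℕ) +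
        (1 - β) * (min (n - 1 - c) (cap q n k - (c - b)) : ℕ) ≠
      (1 - α) * (min a (cap q n j - (b - a)) : ℕ) +
        (1 - β) * (min (n - 1 - c) (cap q n k - (c - b) - 1) : ℕ)) :
    ∃ x : Fin n → ℝ, (∀ i, x i ∈ Icc (0 : ℝ) 1) ∧ ∀ y : Fin 2 → ℝ, y j = leftmost x a' →
      y k = leftmost x b' → ∃ s s', IsNash tie q x y s ∧ IsNash tie q x y s' ∧
        welfare tie q x y s ≠ welfare tie q x y s' := by
  classical
  have hx : ∀ i : Fin n, clusters a b c u α β i ∈ Icc (0 : ℝ) 1 := by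
    intro i
    have hi := i.2
    unfold clusters
    split_ifs with i1 i2 i3 i4
    · exact ha.elim (fun h => by omega) fun h => ⟨by linarith, by linarith⟩
    · exact ⟨by linarith, by linarith⟩
    · exact ⟨by linarith, by linarith⟩
    · exact ⟨by linarith, by linarith⟩
    · exact hc.elim (fun h => by omega) fun h => ⟨by linarith, by linarith⟩
  have hmono := clusters_monotone (n := n) (a := a) (b := b) (c := c) (u := u)
    (show 0 ≤ α by linarith) (show 0 ≤ β by linarith)
  refine ⟨clusters a b c u α β, hx, ?_⟩
  intro y hj hk
  rw [leftmost_of_monotone hmono (by omega)] at hj hk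
  have hj' : y j = u := by
    rw [hj]; unfold clusters; simp only; split_ifs <;> first | omega | rfl
  have hk' : y k = u + 1 / 5 := by
    rw [hk]; unfold clusters; simp only; split_ifs <;> first | omega | rfl
  have hy : y ∈ square := by
    intro l
    rcases fin_two_eq_or hjk l with rfl | rfl
    · rw [hj']; constructor <;> linarith
    · rw [hk']; constructor <;> linarith
  set x : Fin n → ℝ := clusters a b c u α β with hxdef
  have v1 : ∀ i : Fin n, i.1 < a → x i = u - α := fun i hi => by
    simp only [hxdef, clusters]; split_ifs; rfl
  have v2 : ∀ i : Fin n, a ≤ i.1 → i.1 < b → x i = u := fun i hi hi' => by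
    simp only [hxdef, clusters]; split_ifs <;> first | omega | rfl
  have v3 : ∀ i : Fin n, i.1 = b → x i = u + 1 / 10 := fun i hi => by
    simp only [hxdef, clusters]; split_ifs <;> first | omega | rfl
  have v4 : ∀ i : Fin n, b < i.1 → i.1 ≤ c → x i = u + 1 / 5 := fun i hi hi' => by
    simp only [hxdef, clusters]; split_ifs <;> first | omega | rfl
  have v5 : ∀ i : Fin n, c < i.1 → x i = u + 1 / 5 + β := fun i hi => by
    simp only [hxdef, clusters]; split_ifs <;> first | omega | rfl
  have vals : ∀ i : Fin n,
      (i.1 < a ∧ |x i - y j| = α ∧ |x i - y k| = α + 1 / 5) ∨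
      ((a ≤ i.1 ∧ i.1 < b) ∧ |x i - y j| = 0 ∧ |x i - y k| = 1 / 5) ∨
      (i.1 = b ∧ |x i - y j| = 1 / 10 ∧ |x i - y k| = 1 / 10) ∨
      ((b < i.1 ∧ i.1 ≤ c) ∧ |x i - y j| = 1 / 5 ∧ |x i - y k| = 0) ∨
      (c < i.1 ∧ |x i - y j| = β + 1 / 5 ∧ |x i - y k| = β) := by
    intro i
    rw [hj', hk']
    by_cases i1 : i.1 < a
    · refine Or.inl ⟨i1, ?_⟩
      rw [v1 i i1, abs_of_nonpos (by linarith), abs_of_nonpos (by linarith)]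
      constructor <;> ring
    by_cases i2 : i.1 < b
    · refine Or.inr (Or.inl ⟨⟨by omega, i2⟩, ?_⟩)
      rw [v2 i (by omega) i2, abs_of_nonpos (by linarith), abs_of_nonpos (by linarith)]
      constructor <;> ring
    by_cases i3 : i.1 = b
    · refine Or.inr (Or.inr (Or.inl ⟨i3, ?_⟩))
      rw [v3 i i3, abs_of_nonneg (by linarith), abs_of_nonpos (by linarith)]
      constructor <;> ring
    by_cases i4 : i.1 ≤ c
    · refine Or.inr (Or.inr (Or.inr (Or.inl ⟨⟨by omega, i4⟩, ?_⟩)))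
      rw [v4 i (by omega) i4, abs_of_nonneg (by linarith), abs_of_nonneg (by linarith)]
      constructor <;> ring
    · refine Or.inr (Or.inr (Or.inr (Or.inr ⟨by omega, ?_⟩)))
      rw [v5 i (by omega), abs_of_nonneg (by linarith), abs_of_nonneg (by linarith)]
      constructor <;> ring
  have hbn : b < n := by omega
  have hcl : IsClustered x y j k ⟨b, hbn⟩ α β := by
    refine ⟨?_, fun i => ?_⟩
    · rcases vals ⟨b, hbn⟩ with h | h | h | h | h
      · exact absurd h.1 (by simp; omega)
      · exact absurd h.1.2 (by simp)
      · exact h.2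
      · exact absurd h.1.1 (by simp)
      · exact absurd h.1 (by simp; omega)
    · rcases vals i with h | h | h | h | h
      · exact Or.inr (Or.inr (Or.inl h.2))
      · exact Or.inl h.2
      · exact Or.inr (Or.inl (Fin.ext h.1))
      · exact Or.inr (Or.inr (Or.inr (Or.inl h.2)))
      · exact Or.inr (Or.inr (Or.inr (Or.inr h.2)))
  have cU : (atDist x y j 0).card = b - a := by
    refine card_filter_fin _ a b (by omega) fun i => ?_
    rcases vals i with h | h | h | h | h <;> rw [h.2.1]
    · exact ⟨fun h' => by linarith, fun h' => by omega⟩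
    · exact ⟨fun _ => h.1, fun _ => rfl⟩
    · exact ⟨fun h' => by linarith, fun h' => by omega⟩
    · exact ⟨fun h' => by linarith, fun h' => by omega⟩
    · exact ⟨fun h' => by linarith, fun h' => by omega⟩
  have cO : (atDist x y j α).card = a := by
    have : (atDist x y j α).card = a - 0 := by
      refine card_filter_fin _ 0 a (by omega) fun i => ?_
      rcases vals i with h | h | h | h | h <;> rw [h.2.1]
      · exact ⟨fun _ => ⟨Nat.zero_le _, h.1⟩, fun _ => rfl⟩
      · exact ⟨fun h' => by linarith, fun h' => by omega⟩
      · exact ⟨fun h' => by linarith, fun h' => by omega⟩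
      · exact ⟨fun h' => by linarith, fun h' => by omega⟩
      · exact ⟨fun h' => by linarith, fun h' => by omega⟩
    omega
  have cV : (atDist x y k 0).card = c - b := by
    have : (atDist x y k 0).card = c + 1 - (b + 1) := by
      refine card_filter_fin _ (b + 1) (c + 1) (by omega) fun i => ?_
      rcases vals i with h | h | h | h | h <;> rw [h.2.2]
      · exact ⟨fun h' => by linarith, fun h' => by omega⟩
      · exact ⟨fun h' => by linarith, fun h' => by omega⟩
      · exact ⟨fun h' => by linarith, fun h' => by omega⟩
      · exact ⟨fun _ => by omega, fun _ => rfl⟩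
      · exact ⟨fun h' => by linarith, fun h' => by omega⟩
    omega
  have cP : (atDist x y k β).card = n - 1 - c := by
    have : (atDist x y k β).card = n - (c + 1) := by
      refine card_filter_fin _ (c + 1) n le_rfl fun i => ?_
      have hi := i.2
      rcases vals i with h | h | h | h | h <;> rw [h.2.2]
      · exact ⟨fun h' => by linarith, fun h' => by omega⟩
      · exact ⟨fun h' => by linarith, fun h' => by omega⟩
      · exact ⟨fun h' => by linarith, fun h' => by omega⟩
      · exact ⟨fun h' => by linarith, fun h' => by omega⟩
      · exact ⟨fun _ => by omega, fun _ => rfl⟩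
    omega
  refine hcl.exists_nash_ne tie hjk hx hy hα hα1 hβ hβ1 hαβ hβα ?_ ?_ ?_ ?_ ?_
  · rwa [cU]
  · rwa [cV]
  · rw [cU, cO]
    exact hO.imp (fun h => by omega) id
  · rw [cV, cP]
    exact hP.imp (fun h => by omega) id
  · rwa [cU, cV, cO, cP]

/-- Percentile mechanisms whose facilities are different but not far apart are not equilibrium
stable. -/
lemma not_equilibriumStable (tie : ∀ n : ℕ, Fin 2 → Equiv.Perm (Fin n)) {q p : Fin 2 → ℝ}
    (hq : ∀ j, 0 < q j) (hQ : q 0 + q 1 < 1) (hp : p ∈ square) {j k : Fin 2} (hjk : j ≠ k)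
    (hlt : p j < p k) (hpp : p k - p j < q j + q k) : ¬ EquilibriumStable tie q p := by
  intro hES
  have hQ' : q j + q k < 1 := by
    rcases fin_two_eq_or zero_ne_one j with rfl | rfl <;>
    rcases fin_two_eq_or zero_ne_one k with rfl | rfl
    · exact absurd rfl hjk
    · exact hQ
    · linarith
    · exact absurd rfl hjk
  have hev : ∀ c : ℝ, 0 < c → ∀ B : ℝ, ∀ᶠ n : ℕ in atTop, B ≤ c * n := fun c hc B =>
    (tendsto_natCast_atTop_atTop.const_mul_atTop hc).eventually_ge_atTop B
  -- The numerical margins absorb the rounding in the two percentile indices and the two capacities.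
  obtain ⟨n, e1, e2, e3, e4, e5⟩ := ((hev _ (sub_pos.2 hlt) 5).and ((hev _ (sub_pos.2 hpp) 10).and
    ((hev _ (hq j) 3).and ((hev _ (hq k) 3).and (eventually_ge_atTop 1))))).exists
  have hn1 : (1 : ℝ) ≤ n := by exact_mod_cast e5
  set a' := ⌊p j * ((n : ℝ) - 1)⌋₊ with ha'
  set b' := ⌊p k * ((n : ℝ) - 1)⌋₊ with hb'
  have hbn : b' < n := percentile_index_lt (hp k) e5
  have f1 : (a' : ℝ) ≤ p j * ((n : ℝ) - 1) := Nat.floor_le (mul_nonneg (hp j).1 (by linarith))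
  have f2 : (b' : ℝ) ≤ p k * ((n : ℝ) - 1) := Nat.floor_le (mul_nonneg (hp k).1 (by linarith))
  have f3 := Nat.lt_floor_add_one (p j * ((n : ℝ) - 1))
  have f4 := Nat.lt_floor_add_one (p k * ((n : ℝ) - 1))
  have f5 := Nat.lt_floor_add_one (q j * (n : ℝ))
  have f6 := Nat.lt_floor_add_one (q k * (n : ℝ))
  have f7 : (cap q n j : ℝ) ≤ q j * n := Nat.floor_le (by have := hq j; positivity)
  have f8 : (cap q n k : ℝ) ≤ q k * n := Nat.floor_le (by have := hq k; positivity)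
  rw [← ha'] at f3
  rw [← hb'] at f4
  have f5 : q j * n < (cap q n j : ℝ) + 1 := f5
  have f6 : q k * n < (cap q n k : ℝ) + 1 := f6
  have hpj := hp j
  have hpk := hp k
  have g1 : a' + 2 ≤ b' := by
    have : ((a' + 2 : ℕ) : ℝ) < ((b' + 1 : ℕ) : ℝ) := by
      push_cast
      linarith [hpj.1, hpj.2, hpk.1, hpk.2]
    have := Nat.cast_lt.1 this
    omega
  have g2 : b' + 2 ≤ a' + cap q n j + cap q n k := by
    have : ((b' + 2 : ℕ) : ℝ) < ((a' + cap q n j + cap q n k + 1 : ℕ) : ℝ) := by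
      push_cast
      linarith [hpj.1, hpj.2, hpk.1, hpk.2]
    have := Nat.cast_lt.1 this
    omega
  have g3 : 2 ≤ cap q n j := by
    have : ((2 : ℕ) : ℝ) < ((cap q n j + 1 : ℕ) : ℝ) := by push_cast; linarith
    have := Nat.cast_lt.1 this
    omega
  have g4 : 2 ≤ cap q n k := by
    have : ((2 : ℕ) : ℝ) < ((cap q n k + 1 : ℕ) : ℝ) := by push_cast; linarith
    have := Nat.cast_lt.1 this
    omega
  have g5 : cap q n j + cap q n k ≤ n := by
    have : (q j + q k) * n < 1 * n := mul_lt_mul_of_pos_right hQ' (by linarith)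
    have : ((cap q n j + cap q n k : ℕ) : ℝ) < (n : ℝ) := by push_cast; linarith
    exact (Nat.cast_lt.1 this).le
  suffices H : ∃ x : Fin n → ℝ, (∀ i, x i ∈ Icc (0 : ℝ) 1) ∧ ∀ y : Fin 2 → ℝ, y j = leftmost x a' →
      y k = leftmost x b' → ∃ s s', IsNash (tie n) q x y s ∧ IsNash (tie n) q x y s' ∧
        welfare (tie n) q x y s ≠ welfare (tie n) q x y s' by
    obtain ⟨x, hx, hH⟩ := H
    obtain ⟨s, s', hs, hs', hw⟩ := hH (percentile p x) rfl rfl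
    exact hw (hES n x hx s s' hs hs')
  -- The midpoint agent has rank `b`, strictly between the ranks of the facilities; both facilities
  -- must keep a free seat after serving the agents located at them.
  obtain ⟨b, b1, b2, b3, b4⟩ : ∃ b, a' < b ∧ b < b' ∧ b + 1 ≤ a' + cap q n j ∧
      b' + 1 ≤ b + cap q n k := ⟨min (b' - 1) (a' + cap q n j - 1), by omega, by omega, by omega, by omega⟩
  -- Here all agents to the left of the midpoint fit at `j`, and the left outer cluster is taken
  -- empty. The choice `β + 1/5 = 1` makes the right outer cluster worthless to `j`. The midpoint
  -- agent displaces somebody of utility `1/5` if it goes to `k`, and nobody if it goes to `j`.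
  rcases lt_or_ge b (cap q n j) with hA | hA
  · refine exists_nash_ne_of_index (tie n) hjk (a := 0) (b := b) (c := b') (u := 0) (α := 13 / 20)
      (β := 4 / 5) (Nat.zero_le _) b1 b2 le_rfl hbn le_rfl (by norm_num) (Or.inl rfl)
      (Or.inr (by norm_num)) (by norm_num) (by norm_num) (by norm_num) (by norm_num) (by norm_num)
      (by norm_num) (by omega) (by omega) (Or.inr (by norm_num)) (Or.inl (by omega)) ?_
    rw [min_eq_right (a := n - 1 - b') (by omega), min_eq_right (a := n - 1 - b') (by omega),
      Nat.zero_min, Nat.zero_min]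
    obtain ⟨d, hd⟩ : ∃ d, cap q n k - (b' - b) = d + 1 := ⟨cap q n k - (b' - b) - 1, by omega⟩
    rw [hd, Nat.add_sub_cancel]
    intro h
    push_cast at h
    linarith
  -- The mirror image: the right outer cluster is empty.
  rcases lt_or_ge (n - 1 - b) (cap q n k) with hB | hB
  · refine exists_nash_ne_of_index (tie n) hjk (a := a') (b := b) (c := n - 1) (u := 4 / 5)
      (α := 4 / 5) (β := 13 / 20) le_rfl b1 b2 (by omega) (by omega) (by norm_num) (by norm_num)
      (Or.inr le_rfl) (Or.inl rfl) (by norm_num) (by norm_num) (by norm_num) (by norm_num)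
      (by norm_num) (by norm_num) (by omega) (by omega) (Or.inl (by omega)) (Or.inr (by norm_num)) ?_
    rw [min_eq_right (a := a') (by omega), min_eq_right (a := a') (by omega), Nat.sub_self,
      Nat.zero_min, Nat.zero_min]
    obtain ⟨d, hd⟩ : ∃ d, cap q n j - (b - a') = d + 1 := ⟨cap q n j - (b - a') - 1, by omega⟩
    rw [hd, Nat.add_sub_cancel]
    intro h
    push_cast at h
    linarith
  -- Both outer clusters are larger than the seats left to them, so the midpoint agent displaces an
  -- agent of utility `7/10` at `j` or one of utility `3/5` at `k`.
  · refine exists_nash_ne_of_index (tie n) hjk (a := a') (b := b) (c := b') (u := 2 / 5)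
      (α := 3 / 10) (β := 2 / 5) le_rfl b1 b2 le_rfl hbn (by norm_num) (by norm_num)
      (Or.inr (by norm_num)) (Or.inr (by norm_num)) (by norm_num) (by norm_num) (by norm_num)
      (by norm_num) (by norm_num) (by norm_num) (by omega) (by omega) (Or.inl hA) (Or.inl hB) ?_
    rw [min_eq_right (a := a') (by omega), min_eq_right (a := a') (by omega),
      min_eq_right (a := n - 1 - b') (by omega), min_eq_right (a := n - 1 - b') (by omega)]
    obtain ⟨d, hd⟩ : ∃ d, cap q n k - (b' - b) = d + 1 := ⟨cap q n k - (b' - b) - 1, by omega⟩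
    obtain ⟨d', hd'⟩ : ∃ d, cap q n j - (b - a') = d + 1 := ⟨cap q n j - (b - a') - 1, by omega⟩
    rw [hd, hd', Nat.add_sub_cancel, Nat.add_sub_cancel]
    intro h
    push_cast at h
    linarith

/-! ### Laws without atoms on the unit interval -/

/-- A law on `[0,1]` without atoms and with full support. -/
structure IsRegular (μ : Measure ℝ) : Prop where
  measure_singleton : ∀ t, μ {t} = 0
  ae_mem : ∀ᵐ t ∂μ, t ∈ Icc (0 : ℝ) 1
  strictMonoOn : StrictMonoOn (cdf μ) (Icc 0 1)

section Law

set_option linter.unusedSectionVars false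

variable {μ : Measure ℝ} [IsProbabilityMeasure μ]

lemma IsRegular.continuous_cdf (hμ : IsRegular μ) : Continuous (cdf μ) := by
  rw [continuous_iff_continuousAt]
  intro t
  rw [(monotone_cdf μ).continuousAt_iff_leftLim_eq_rightLim]
  have h := StieltjesFunction.measure_singleton (cdf μ) t
  rw [measure_cdf, hμ.measure_singleton t, eq_comm, ENNReal.ofReal_eq_zero] at h
  have h1 := (monotone_cdf μ).leftLim_le (le_refl t)
  rw [StieltjesFunction.rightLim_eq]
  linarith

lemma IsRegular.ae_ne (hμ : IsRegular μ) (c : ℝ) : ∀ᵐ t ∂μ, t ≠ c := by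
  rw [ae_iff]
  simpa using hμ.measure_singleton c

lemma measureReal_congr_ae {A B : Set ℝ} (h : ∀ᵐ t ∂μ, t ∈ A ↔ t ∈ B) : μ.real A = μ.real B :=
  measureReal_congr (eventuallyEq_set.2 h)

lemma IsRegular.cdf_zero (hμ : IsRegular μ) : cdf μ 0 = 0 := by
  rw [cdf_eq_real]
  refine (measureReal_congr_ae ?_).trans (measureReal_empty (μ := μ))
  filter_upwards [hμ.ae_mem, hμ.ae_ne 0] with t ht h0
  simp only [mem_Iic, mem_empty_iff_false, iff_false, not_le]
  exact lt_of_le_of_ne ht.1 h0.symm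

lemma IsRegular.cdf_one (hμ : IsRegular μ) : cdf μ 1 = 1 := by
  rw [cdf_eq_real, ← probReal_univ (μ := μ)]
  apply measureReal_congr_ae
  filter_upwards [hμ.ae_mem] with t ht
  simp [ht.2]

lemma IsRegular.measureReal_Icc (hμ : IsRegular μ) {a b : ℝ} (hab : a ≤ b) :
    μ.real (Icc a b) = cdf μ b - cdf μ a := by
  have h : μ.real (Icc a b) = μ.real (Iic b \ Iic a) := by
    apply measureReal_congr_ae
    filter_upwards [hμ.ae_ne a] with t ht
    simp only [mem_Icc, Set.mem_sdiff, mem_Iic, not_le]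
    exact ⟨fun h => ⟨h.2, lt_of_le_of_ne h.1 ht.symm⟩, fun h => ⟨h.2.le, h.1⟩⟩
  rw [h, measureReal_sdiff (Iic_subset_Iic.2 hab) measurableSet_Iic, cdf_eq_real, cdf_eq_real]

lemma IsRegular.exists_cdf_eq (hμ : IsRegular μ) {c : ℝ} (hc : c ∈ Icc (0 : ℝ) 1) :
    ∃ z ∈ Icc (0 : ℝ) 1, cdf μ z = c := by
  have := intermediate_value_Icc zero_le_one hμ.continuous_cdf.continuousOn
  rw [hμ.cdf_zero, hμ.cdf_one] at this
  exact this hc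

lemma IsRegular.measureReal_cdf_lt (hμ : IsRegular μ) {c : ℝ} (hc : c ∈ Icc (0 : ℝ) 1) :
    μ.real {t | cdf μ t < c} = c := by
  obtain ⟨z, hz, rfl⟩ := hμ.exists_cdf_eq hc
  rw [cdf_eq_real μ z]
  apply measureReal_congr_ae
  filter_upwards [hμ.ae_mem, hμ.ae_ne z] with t ht htz
  rw [← cdf_eq_real]
  exact ⟨fun h => ((hμ.strictMonoOn.lt_iff_lt ht hz).1 h).le,
    fun h => (hμ.strictMonoOn.lt_iff_lt ht hz).2 (lt_of_le_of_ne h htz)⟩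

/-- Any nonempty open interval meeting `(0,1)` has positive mass. -/
lemma IsRegular.measure_pos (hμ : IsRegular μ) {a b : ℝ} (ha : 0 ≤ a) (hab : a < b) (hb : b ≤ 1) :
    0 < μ.real (Icc a b) := by
  rw [hμ.measureReal_Icc hab.le, sub_pos]
  exact hμ.strictMonoOn ⟨ha, by linarith⟩ ⟨by linarith, hb⟩ hab

/-! ### The quantile coupling of a population with the law -/

/-- A quantity attached to the agents, as a function on the line: the agent at `t` is the one with
rank `⌊n F(t)⌋`. -/
def spread (μ : Measure ℝ) {n : ℕ} (x : Fin n → ℝ) (g : Fin n → ℝ) (t : ℝ) : ℝ :=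
  if h : ⌊n * cdf μ t⌋₊ < n then g (Tuple.sort x ⟨_, h⟩) else 0

lemma spread_eq_sum {n : ℕ} (x g : Fin n → ℝ) (t : ℝ) : spread μ x g t =
    ∑ k : Fin n, {t | ⌊n * cdf μ t⌋₊ = k}.indicator (fun _ => g (Tuple.sort x k)) t := by
  unfold spread
  split_ifs with h
  · rw [Finset.sum_eq_single (⟨_, h⟩ : Fin n)]
    · rw [indicator_of_mem (by simp)]
    · intro k _ hk
      rw [indicator_of_notMem]
      intro hm
      exact hk (Fin.ext (by simpa using hm.symm))
    · simp
  · symm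
    refine Finset.sum_eq_zero fun k _ => indicator_of_notMem ?_ _
    intro hm
    have : ⌊n * cdf μ t⌋₊ = k := hm
    exact h (this ▸ k.2)

lemma measurableSet_rank (n k : ℕ) : MeasurableSet {t | ⌊n * cdf μ t⌋₊ = k} := by
  have : Measurable fun t => ⌊(n : ℝ) * cdf μ t⌋₊ :=
    Nat.measurable_floor.comp ((monotone_cdf μ).measurable.const_mul _)
  exact this (measurableSet_singleton k)

lemma measurable_spread {n : ℕ} (x g : Fin n → ℝ) : Measurable (spread μ x g) := by
  have : spread μ x g = fun t => ∑ k : Fin n,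
      {t | ⌊n * cdf μ t⌋₊ = k}.indicator (fun _ => g (Tuple.sort x k)) t :=
    funext (spread_eq_sum x g)
  rw [this]
  exact Finset.measurable_sum _ fun k _ => measurable_const.indicator (measurableSet_rank n k)

lemma IsRegular.measureReal_rank (hμ : IsRegular μ) {n k : ℕ} (hk : k < n) :
    μ.real {t | ⌊n * cdf μ t⌋₊ = k} = 1 / n := by
  have hn : (0 : ℝ) < n := by exact_mod_cast (Nat.zero_le k).trans_lt hk
  have hk' : (k : ℝ) + 1 ≤ n := by exact_mod_cast hk
  have h : {t | ⌊n * cdf μ t⌋₊ = k} =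
      {t | cdf μ t < (k + 1) / n} \ {t | cdf μ t < k / n} := by
    ext t
    simp only [mem_ofPred_eq, Set.mem_sdiff, not_lt]
    rw [Nat.floor_eq_iff (mul_nonneg hn.le (cdf_nonneg μ t)), lt_div_iff₀ hn, div_le_iff₀ hn,
      mul_comm, and_comm]
  have h0 : (0 : ℝ) ≤ k := Nat.cast_nonneg k
  rw [h, measureReal_sdiff, hμ.measureReal_cdf_lt, hμ.measureReal_cdf_lt]
  · field_simp; ring
  · exact ⟨by positivity, by rw [div_le_one hn]; linarith⟩
  · exact ⟨by positivity, by rw [div_le_one hn]; linarith⟩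
  · intro t ht
    have ht : cdf μ t < k / n := ht
    exact ht.trans_le (div_le_div_of_nonneg_right (by linarith) hn.le)
  · exact measurableSet_lt (monotone_cdf μ).measurable measurable_const

/-- The set of points `t` assigned to a given rank has mass `1/n`, so integrating against `μ` is
averaging over the agents. -/
lemma IsRegular.integral_spread (hμ : IsRegular μ) {n : ℕ} (x g : Fin n → ℝ) :
    ∫ t, spread μ x g t ∂μ = (∑ i, g i) / n := by
  simp_rw [spread_eq_sum]
  rw [integral_finsetSum]
  · have : ∀ k : Fin n, ∫ t, {t | ⌊n * cdf μ t⌋₊ = k}.indicator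
        (fun _ => g (Tuple.sort x k)) t ∂μ = g (Tuple.sort x k) / n := by
      intro k
      rw [integral_indicator_const _ (measurableSet_rank n k), hμ.measureReal_rank k.2, smul_eq_mul]
      ring
    rw [Finset.sum_congr rfl fun k _ => this k, ← Finset.sum_div,
      Equiv.sum_comp (Tuple.sort x) g]
  · exact fun k _ => (integrable_const _).indicator (measurableSet_rank n k)

/-- The empirical distribution function of the population `x` is `η`-close to that of `μ`. -/
def Close (μ : Measure ℝ) {n : ℕ} (x : Fin n → ℝ) (η : ℝ) : Prop :=
  ∀ t, |({i | x i ≤ t}.ncard : ℝ) - n * cdf μ t| ≤ η * n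

/-- A sequence of populations whose empirical distributions converge to `μ`. -/
structure Approximates (μ : Measure ℝ) (N : ℕ → ℕ) (x : ∀ m, Fin (N m) → ℝ) : Prop where
  pos : ∀ m, 0 < N m
  tendsto : Tendsto N atTop atTop
  mem : ∀ m i, x m i ∈ Icc (0 : ℝ) 1
  close : ∃ η : ℕ → ℝ, Tendsto η atTop (𝓝 0) ∧ ∀ m, Close μ (x m) (η m)

variable {N : ℕ → ℕ} {x : ∀ m, Fin (N m) → ℝ}

lemma Approximates.comp (hx : Approximates μ N x) {φ : ℕ → ℕ} (hφ : Tendsto φ atTop atTop) :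
    Approximates μ (N ∘ φ) (fun m => x (φ m)) := by
  obtain ⟨η, h1, h2⟩ := hx.close
  exact ⟨fun m => hx.pos _, hx.tendsto.comp hφ, fun m => hx.mem _, η ∘ φ, h1.comp hφ, fun m => h2 _⟩

/-- Order statistics converge to quantiles. -/
lemma Approximates.tendsto_leftmost (hμ : IsRegular μ) (hx : Approximates μ N x) {κ : ℕ → ℕ}
    (hκ : ∀ m, κ m < N m) {t : ℝ} (ht : t ∈ Icc (0 : ℝ) 1)
    (hlim : Tendsto (fun m => (κ m : ℝ) / N m) atTop (𝓝 (cdf μ t))) :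
    Tendsto (fun m => leftmost (x m) (κ m)) atTop (𝓝 t) := by
  obtain ⟨η, h1, h2⟩ := hx.close
  have hmem : ∀ m, leftmost (x m) (κ m) ∈ Icc (0 : ℝ) 1 := fun m => leftmost_mem (hx.mem m) (hκ m)
  have hpos : ∀ m, (0 : ℝ) < N m := fun m => by exact_mod_cast hx.pos m
  rw [tendsto_order]
  constructor
  · intro a ha
    rcases lt_or_ge a 0 with h0 | h0
    · exact Eventually.of_forall fun m => h0.trans_le (hmem m).1
    have hF : cdf μ a < cdf μ t := hμ.strictMonoOn ⟨h0, ha.le.trans ht.2⟩ ht ha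
    have hl : Tendsto (fun m => (κ m : ℝ) / N m - η m) atTop (𝓝 (cdf μ t - 0)) := hlim.sub h1
    rw [sub_zero] at hl
    filter_upwards [hl.eventually_const_lt hF] with m hm
    by_contra hle
    have h3 := lt_ncard_of_leftmost_le (hκ m) (not_lt.1 hle)
    have h4 := (abs_le.1 (h2 m a)).2
    have h5 : (κ m : ℝ) < ({i | x m i ≤ a}.ncard : ℝ) := by exact_mod_cast h3
    have h6 : cdf μ a + η m < κ m / N m := by linarith
    rw [lt_div_iff₀ (hpos m)] at h6
    linarith
  · intro b hb
    rcases lt_or_ge 1 b with h0 | h0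
    · exact Eventually.of_forall fun m => (hmem m).2.trans_lt h0
    -- Counting at `c < b` makes the counted agents strictly smaller than an order statistic that is
    -- at least `b`.
    obtain ⟨c, hc1, hc2⟩ := exists_between hb
    have hF : cdf μ t < cdf μ c := hμ.strictMonoOn ht ⟨ht.1.trans hc1.le, hc2.le.trans h0⟩ hc1
    have hl : Tendsto (fun m => (κ m : ℝ) / N m + η m) atTop (𝓝 (cdf μ t + 0)) := hlim.add h1
    rw [add_zero] at hl
    filter_upwards [hl.eventually_lt_const hF] with m hm
    by_contra hle
    have h3 := ncard_lt_le_of_le_leftmost (hκ m) (P := fun i => x m i ≤ c)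
      fun i hi => lt_of_le_of_lt hi (by linarith)
    have h4 := (abs_le.1 (h2 m c)).1
    have h5 : ({i | x m i ≤ c}.ncard : ℝ) ≤ κ m := by exact_mod_cast h3
    have h6 : (κ m : ℝ) / N m < cdf μ c - η m := by linarith
    rw [div_lt_iff₀ (hpos m)] at h6
    linarith

/-- If a bounded quantity of the agents near `t` converges to `G t` for almost all `t`, its average
over the population converges to the integral of `G`. -/
lemma Approximates.tendsto_average (hμ : IsRegular μ) (hx : Approximates μ N x)
    {g : ∀ m, Fin (N m) → ℝ} (hg : ∀ m i, |g m i| ≤ 1) {G : ℝ → ℝ}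
    (h : ∀ᵐ t ∂μ, ∀ i : ∀ m, Fin (N m), Tendsto (fun m => x m (i m)) atTop (𝓝 t) →
      Tendsto (fun m => g m (i m)) atTop (𝓝 (G t))) :
    Tendsto (fun m => (∑ i, g m i) / N m) atTop (𝓝 (∫ t, G t ∂μ)) := by
  simp_rw [← fun m => hμ.integral_spread (x m) (g m)]
  refine tendsto_integral_of_dominated_convergence (fun _ => (1 : ℝ))
    (fun m => (measurable_spread (x m) (g m)).aestronglyMeasurable) (integrable_const _)
    (fun m => Eventually.of_forall fun t => ?_) ?_
  · unfold spread
    split_ifs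
    · exact hg _ _
    · simp
  -- For `t ≠ 1` the rank `⌊N F(t)⌋` is below `N`, so the default value in `spread` is not used, and
  -- the agent of this rank converges to `t` as an order statistic.
  · filter_upwards [h, hμ.ae_mem, hμ.ae_ne 1] with t ht htm ht1
    have hF : cdf μ t < 1 := by
      rw [← hμ.cdf_one]
      exact hμ.strictMonoOn htm (right_mem_Icc.2 zero_le_one) (lt_of_le_of_ne htm.2 ht1)
    have hκ : ∀ m, ⌊N m * cdf μ t⌋₊ < N m := by
      intro m
      have : (0 : ℝ) < N m := by exact_mod_cast hx.pos m
      rw [Nat.floor_lt (mul_nonneg this.le (cdf_nonneg μ t))]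
      nlinarith
    have hN : Tendsto (fun m => (N m : ℝ)) atTop atTop :=
      tendsto_natCast_atTop_atTop.comp hx.tendsto
    have hlim : Tendsto (fun m => (⌊N m * cdf μ t⌋₊ : ℝ) / N m) atTop (𝓝 (cdf μ t)) := by
      have := (tendsto_nat_floor_mul_div_atTop (R := ℝ) (cdf_nonneg μ t)).comp hN
      refine this.congr fun m => ?_
      simp only [Function.comp, mul_comm]
    have hpos := hx.tendsto_leftmost hμ hκ htm hlim
    have := ht (fun m => Tuple.sort (x m) ⟨_, hκ m⟩)
      (hpos.congr fun m => leftmost_of_lt _ (hκ m))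
    refine this.congr fun m => ?_
    simp [spread, hκ m]

end Law

/-! ### Limits of equilibria -/

/-- What an agent at `t` gets from facility `j` of radius `R j`. -/
def offer (y R : Fin 2 → ℝ) (t : ℝ) (j : Fin 2) : ℝ := if |t - y j| ≤ R j then 1 - |t - y j| else 0

/-- What an agent at `t` gets, for facilities at `y` with radii `R`. -/
def payoff (y R : Fin 2 → ℝ) (t : ℝ) : ℝ := max (offer y R t 0) (offer y R t 1)

/-- The agents that are accommodated by facilities at `y` with radii `R`. -/
def covered (y R : Fin 2 → ℝ) : Set ℝ := {t | ∃ j, |t - y j| ≤ R j}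

lemma payoff_eq {j k : Fin 2} (hjk : j ≠ k) (y R : Fin 2 → ℝ) (t : ℝ) :
    payoff y R t = max (offer y R t j) (offer y R t k) := by
  rcases fin_two_eq_or zero_ne_one j with rfl | rfl <;>
  rcases fin_two_eq_or zero_ne_one k with rfl | rfl
  · exact absurd rfl hjk
  · rfl
  · exact max_comm _ _
  · exact absurd rfl hjk

lemma mem_covered_iff {j k : Fin 2} (hjk : j ≠ k) {y R : Fin 2 → ℝ} {t : ℝ} :
    t ∈ covered y R ↔ |t - y j| ≤ R j ∨ |t - y k| ≤ R k := by
  constructor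
  · rintro ⟨l, hl⟩
    rcases fin_two_eq_or hjk l with rfl | rfl
    · exact Or.inl hl
    · exact Or.inr hl
  · rintro (h | h)
    · exact ⟨_, h⟩
    · exact ⟨_, h⟩

lemma measurableSet_covered (y R : Fin 2 → ℝ) : MeasurableSet (covered y R) := by
  have : covered y R = ⋃ j, {t | |t - y j| ≤ R j} := by ext t; simp [covered]
  rw [this]
  exact MeasurableSet.iUnion fun j => measurableSet_le (by fun_prop) measurable_const

lemma measurableSet_servedLeft (a b r t : ℝ) : MeasurableSet (servedLeft a b r t) :=
  measurableSet_Icc.union measurableSet_Ioc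

lemma measurableSet_servedRight (a b r t : ℝ) : MeasurableSet (servedRight a b r t) :=
  measurableSet_Icc.union measurableSet_Ico

/-- Apart from the midpoint and the boundary of the other ball, the union of intervals is the rule
that equilibria obey: an agent in the ball of a facility goes there unless the other facility is
closer and also within reach. -/
lemma mem_servedLeft_iff {a b r t x : ℝ} (hab : a ≤ b) (ht : 0 ≤ t)
    (h1 : x ≠ (a + b) / 2) (h2 : |x - b| ≠ t) :
    x ∈ servedLeft a b r t ↔ |x - a| ≤ r ∧ (x < (a + b) / 2 ∨ t < |x - b|) := by
  have h2' : x ≠ b - t := by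
    rintro rfl
    apply h2
    rw [sub_sub_cancel_left, abs_neg, abs_of_nonneg ht]
  simp only [servedLeft, mem_union, mem_Icc, mem_Ioc, le_min_iff, le_max_iff, abs_le, lt_abs]
  constructor
  · rintro (⟨h, h' | h', h''⟩ | ⟨h, h'⟩)
    · exact ⟨⟨by linarith, by linarith⟩, Or.inl (lt_of_le_of_ne h' h1)⟩
    · have := lt_of_le_of_ne h' h2'
      exact ⟨⟨by linarith, by linarith⟩, Or.inr (Or.inr (by linarith))⟩
    · exact ⟨⟨by linarith, by linarith⟩, Or.inr (Or.inl (by linarith))⟩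
  · rintro ⟨⟨h, h'⟩, h'' | h'' | h''⟩
    · exact Or.inl ⟨by linarith, Or.inl h''.le, by linarith⟩
    · exact Or.inr ⟨by linarith, by linarith⟩
    · exact Or.inl ⟨by linarith, Or.inr (by linarith), by linarith⟩

lemma mem_servedRight_iff {a b r t x : ℝ} (hab : a ≤ b) (hr : 0 ≤ r)
    (h1 : x ≠ (a + b) / 2) (h2 : |x - a| ≠ r) :
    x ∈ servedRight a b r t ↔ |x - b| ≤ t ∧ ((a + b) / 2 < x ∨ r < |x - a|) := by
  have h2' : x ≠ a + r := by
    rintro rfl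
    apply h2
    rw [add_sub_cancel_left, abs_of_nonneg hr]
  simp only [servedRight, mem_union, mem_Icc, mem_Ico, max_le_iff, min_le_iff, abs_le, lt_abs]
  constructor
  · rintro (⟨⟨h' | h', h⟩, h''⟩ | ⟨h, h'⟩)
    · exact ⟨⟨by linarith, by linarith⟩, Or.inl (lt_of_le_of_ne h' h1.symm)⟩
    · have := lt_of_le_of_ne h' h2'.symm
      exact ⟨⟨by linarith, by linarith⟩, Or.inr (Or.inl (by linarith))⟩
    · exact ⟨⟨by linarith, by linarith⟩, Or.inr (Or.inr (by linarith))⟩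
  · rintro ⟨⟨h, h'⟩, h'' | h'' | h''⟩
    · exact Or.inl ⟨⟨Or.inl h''.le, by linarith⟩, by linarith⟩
    · exact Or.inl ⟨⟨Or.inr (by linarith), by linarith⟩, by linarith⟩
    · exact Or.inr ⟨by linarith, by linarith⟩

/-- A sequence of equilibria with their radii. -/
structure IsNashSeq (tie : ∀ n : ℕ, Fin 2 → Equiv.Perm (Fin n)) (q : Fin 2 → ℝ) (N : ℕ → ℕ)
    (x : ∀ m, Fin (N m) → ℝ) (y : ℕ → Fin 2 → ℝ) (s : ∀ m, Fin (N m) → Fin 2)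
    (R : ℕ → Fin 2 → ℝ) : Prop where
  y_mem : ∀ m, y m ∈ square
  R_mem : ∀ m, R m ∈ square
  dist_le : ∀ m j, ∀ i ∈ servedBy (tie (N m)) q (x m) (y m) (s m) j, |x m i - y m j| ≤ R m j
  le_utility : ∀ m j i, |x m i - y m j| < R m j →
    1 - |x m i - y m j| ≤ utility (tie (N m)) q (x m) (y m) (s m) i
  full : ∀ m j, R m j < 1 → (servedBy (tie (N m)) q (x m) (y m) (s m) j).card = cap q (N m) j

lemma isClosed_square : IsClosed square := by
  have : square = ⋂ j : Fin 2, {y : Fin 2 → ℝ | y j ∈ Icc (0 : ℝ) 1} := by ext; simp [square]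
  rw [this]
  exact isClosed_iInter fun j => isClosed_Icc.preimage (continuous_apply j)

lemma isCompact_square : IsCompact square := by
  have : square = Set.pi univ fun _ : Fin 2 => Icc (0 : ℝ) 1 := by
    ext y; simp only [square, Set.mem_pi, mem_univ, true_implies]; rfl
  rw [this]
  exact isCompact_univ_pi fun _ => isCompact_Icc

/-! ### Pointwise limits of utility and accommodation -/

section Limit

variable {tie : ∀ n : ℕ, Fin 2 → Equiv.Perm (Fin n)} {q : Fin 2 → ℝ} {N : ℕ → ℕ}
  {x : ∀ m, Fin (N m) → ℝ} {y : ℕ → Fin 2 → ℝ} {s : ∀ m, Fin (N m) → Fin 2}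
  {R : ℕ → Fin 2 → ℝ} {y' R' : Fin 2 → ℝ} {t : ℝ} {i : ∀ m, Fin (N m)}

lemma tendsto_dist (hy : Tendsto y atTop (𝓝 y')) (hi : Tendsto (fun m => x m (i m)) atTop (𝓝 t))
    (j : Fin 2) : Tendsto (fun m => |x m (i m) - y m j|) atTop (𝓝 |t - y' j|) :=
  (hi.sub ((continuous_apply j).continuousAt.tendsto.comp hy)).abs

lemma eventually_dist_lt (hy : Tendsto y atTop (𝓝 y')) (hR : Tendsto R atTop (𝓝 R'))
    (hi : Tendsto (fun m => x m (i m)) atTop (𝓝 t)) {j : Fin 2} (h : |t - y' j| < R' j) :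
    ∀ᶠ m in atTop, |x m (i m) - y m j| < R m j :=
  (tendsto_dist hy hi j).eventually_lt ((continuous_apply j).continuousAt.tendsto.comp hR) h

lemma eventually_lt_dist (hy : Tendsto y atTop (𝓝 y')) (hR : Tendsto R atTop (𝓝 R'))
    (hi : Tendsto (fun m => x m (i m)) atTop (𝓝 t)) {j : Fin 2} (h : R' j < |t - y' j|) :
    ∀ᶠ m in atTop, R m j < |x m (i m) - y m j| :=
  Tendsto.eventually_lt ((continuous_apply j).continuousAt.tendsto.comp hR) (tendsto_dist hy hi j) h

lemma IsNashSeq.le_one (h : IsNashSeq tie q N x y s R) (m : ℕ) (j : Fin 2) : R m j ≤ 1 :=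
  (h.R_mem m j).2

/-- Eventually the accommodated agents near `t` are at a facility whose ball contains `t`. -/
lemma IsNashSeq.eventually_le (h : IsNashSeq tie q N x y s R) (hy : Tendsto y atTop (𝓝 y'))
    (hR : Tendsto R atTop (𝓝 R')) (hi : Tendsto (fun m => x m (i m)) atTop (𝓝 t)) (j : Fin 2) :
    ∀ᶠ m in atTop, i m ∈ servedBy (tie (N m)) q (x m) (y m) (s m) j → |t - y' j| ≤ R' j := by
  rcases le_or_gt |t - y' j| (R' j) with hle | hgt
  · exact Eventually.of_forall fun m _ => hle
  · filter_upwards [eventually_lt_dist hy hR hi hgt] with m hm hs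
    exact absurd (h.dist_le m j _ hs) (not_le.2 hm)

lemma IsNashSeq.eventually_ge (h : IsNashSeq tie q N x y s R) (hy : Tendsto y atTop (𝓝 y'))
    (hR : Tendsto R atTop (𝓝 R')) (hi : Tendsto (fun m => x m (i m)) atTop (𝓝 t)) {j : Fin 2}
    (ht : |t - y' j| ≠ R' j) : ∀ᶠ m in atTop, |t - y' j| ≤ R' j →
      1 - |x m (i m) - y m j| ≤ utility (tie (N m)) q (x m) (y m) (s m) (i m) ∧
      Accommodated (tie (N m)) q (x m) (y m) (s m) (i m) := by
  rcases le_or_gt |t - y' j| (R' j) with hle | hgt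
  · filter_upwards [eventually_dist_lt hy hR hi (lt_of_le_of_ne hle ht)] with m hm _
    have h1 := h.le_utility m j _ hm
    refine ⟨h1, accommodated_of_utility_pos ?_⟩
    linarith [h.le_one m j]
  · exact Eventually.of_forall fun m hle => absurd hle (not_le.2 hgt)

/-- In equilibrium an agent gets at least every available offer, and exactly one of them if
accommodated. Away from the boundaries of the limit balls, the available offers are eventually those
of the limit. -/
lemma IsNashSeq.tendsto_utility (h : IsNashSeq tie q N x y s R) (hx : ∀ m i, x m i ∈ Icc (0 : ℝ) 1)
    (hy : Tendsto y atTop (𝓝 y'))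
    (hR : Tendsto R atTop (𝓝 R')) (hi : Tendsto (fun m => x m (i m)) atTop (𝓝 t))
    (ht : ∀ j, |t - y' j| ≠ R' j) :
    Tendsto (fun m => utility (tie (N m)) q (x m) (y m) (s m) (i m)) atTop (𝓝 (payoff y' R' t)) := by
  -- Distances are those of stage `m`, but reachability is judged by the limit radii; convergence is
  -- then plain continuity.
  let o : ℕ → Fin 2 → ℝ := fun m j => if |t - y' j| ≤ R' j then 1 - |x m (i m) - y m j| else 0
  have ho : ∀ j, Tendsto (fun m => o m j) atTop (𝓝 (offer y' R' t j)) := by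
    intro j
    by_cases hle : |t - y' j| ≤ R' j
    · simp only [o, offer, hle, if_true]
      exact tendsto_const_nhds.sub (tendsto_dist hy hi j)
    · simp only [o, offer, hle, if_false]
      exact tendsto_const_nhds
  refine ((ho 0).max (ho 1)).congr' ?_
  have e1 := fun j => h.eventually_le hy hR hi j
  have e2 := fun j => h.eventually_ge hy hR hi (ht j)
  filter_upwards [eventually_all.2 e1, eventually_all.2 e2] with m h1 h2
  have hlow : ∀ j, o m j ≤ utility (tie (N m)) q (x m) (y m) (s m) (i m) := by
    intro j
    by_cases hle : |t - y' j| ≤ R' j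
    · simp only [o, hle, if_true]; exact (h2 j hle).1
    · simp only [o, hle, if_false]; exact utility_nonneg (hx m) (h.y_mem m) _ _
  have ho0 : 0 ≤ o m 0 := by
    simp only [o]
    split_ifs
    · linarith [abs_sub_le_one (hx m (i m)) (h.y_mem m 0)]
    · exact le_rfl
  refine le_antisymm (max_le (hlow 0) (hlow 1)) ?_
  by_cases ha : Accommodated (tie (N m)) q (x m) (y m) (s m) (i m)
  · have hle := h1 (s m (i m)) (mem_servedBy.2 ⟨rfl, ha⟩)
    have : utility (tie (N m)) q (x m) (y m) (s m) (i m) = o m (s m (i m)) := by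
      rw [utility_of_accommodated ha]; simp only [o, hle, if_true]
    rw [this]
    rcases fin_two_eq_or zero_ne_one (s m (i m)) with h0 | h0 <;> rw [h0]
    · exact le_max_left _ _
    · exact le_max_right _ _
  · rw [utility_of_not_accommodated ha]
    exact ho0.trans (le_max_left _ _)

lemma IsNashSeq.eventually_accommodated_iff (h : IsNashSeq tie q N x y s R)
    (hy : Tendsto y atTop (𝓝 y')) (hR : Tendsto R atTop (𝓝 R'))
    (hi : Tendsto (fun m => x m (i m)) atTop (𝓝 t)) (ht : ∀ j, |t - y' j| ≠ R' j) :
    ∀ᶠ m in atTop, Accommodated (tie (N m)) q (x m) (y m) (s m) (i m) ↔ t ∈ covered y' R' := by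
  have e1 := fun j => h.eventually_le hy hR hi j
  have e2 := fun j => h.eventually_ge hy hR hi (ht j)
  filter_upwards [eventually_all.2 e1, eventually_all.2 e2] with m h1 h2
  exact ⟨fun ha => ⟨_, h1 _ (mem_servedBy.2 ⟨rfl, ha⟩)⟩, fun ⟨j, hj⟩ => (h2 j hj).2⟩

/-- Here `C` says that `t` lies on the side of `j`. Comparing the distances along the sequence, not
in the limit, keeps the statement meaningful when the limit locations coincide. -/
lemma IsNashSeq.eventually_mem_servedBy_iff (h : IsNashSeq tie q N x y s R)
    (hy : Tendsto y atTop (𝓝 y')) (hR : Tendsto R atTop (𝓝 R'))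
    (hi : Tendsto (fun m => x m (i m)) atTop (𝓝 t)) (ht : ∀ j, |t - y' j| ≠ R' j)
    {j k : Fin 2} (hjk : j ≠ k) {C : Prop}
    (hC : C → ∀ᶠ m in atTop, |x m (i m) - y m j| < |x m (i m) - y m k|)
    (hC' : ¬ C → ∀ᶠ m in atTop, |x m (i m) - y m k| < |x m (i m) - y m j|) :
    ∀ᶠ m in atTop, i m ∈ servedBy (tie (N m)) q (x m) (y m) (s m) j ↔
      |t - y' j| ≤ R' j ∧ (C ∨ R' k < |t - y' k|) := by
  have e1 := fun j => h.eventually_le hy hR hi j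
  have e2 := fun j => h.eventually_ge hy hR hi (ht j)
  have e3 : ∀ᶠ m in atTop, (C → |x m (i m) - y m j| < |x m (i m) - y m k|) ∧
      (¬ C → |x m (i m) - y m k| < |x m (i m) - y m j|) := by
    by_cases hc : C
    · filter_upwards [hC hc] with m hm
      exact ⟨fun _ => hm, fun h => absurd hc h⟩
    · filter_upwards [hC' hc] with m hm
      exact ⟨fun h => absurd h hc, fun _ => hm⟩
  filter_upwards [eventually_all.2 e1, eventually_all.2 e2, e3] with m h1 h2 h3
  constructor
  · intro hs
    refine ⟨h1 j hs, ?_⟩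
    by_contra hn
    push Not at hn
    obtain ⟨hs1, hs2⟩ := mem_servedBy.1 hs
    have h4 := (h2 k hn.2).1
    rw [utility_of_accommodated hs2, hs1] at h4
    linarith [h3.2 hn.1]
  · rintro ⟨hle, hor⟩
    obtain ⟨h4, h5⟩ := h2 j hle
    rcases fin_two_eq_or hjk (s m (i m)) with h0 | h0
    · exact mem_servedBy.2 ⟨h0, h5⟩
    · exfalso
      have h6 := h1 k (mem_servedBy.2 ⟨h0, h5⟩)
      rw [utility_of_accommodated h5, h0] at h4
      rcases hor with hc | hc
      · linarith [h3.1 hc]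
      · linarith

end Limit

/-! ### Limits of welfare and of served masses -/

section Limit

set_option linter.unusedSectionVars false

variable {μ : Measure ℝ} [IsProbabilityMeasure μ] {tie : ∀ n : ℕ, Fin 2 → Equiv.Perm (Fin n)}
  {q : Fin 2 → ℝ} {N : ℕ → ℕ}
  {x : ∀ m, Fin (N m) → ℝ} {y : ℕ → Fin 2 → ℝ} {s : ∀ m, Fin (N m) → Fin 2}
  {R : ℕ → Fin 2 → ℝ} {y' R' : Fin 2 → ℝ}

lemma IsRegular.ae_abs_sub_ne (hμ : IsRegular μ) (y' R' : Fin 2 → ℝ) :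
    ∀ᵐ t ∂μ, ∀ j, |t - y' j| ≠ R' j := by
  rw [ae_all_iff]
  intro j
  filter_upwards [hμ.ae_ne (y' j + R' j), hμ.ae_ne (y' j - R' j)] with t h1 h2 h3
  rcases abs_choice (t - y' j) with h | h
  · exact h1 (by linarith)
  · exact h2 (by linarith)

lemma IsNashSeq.tendsto_welfare (hμ : IsRegular μ) (hx : Approximates μ N x)
    (h : IsNashSeq tie q N x y s R) (hy : Tendsto y atTop (𝓝 y')) (hR : Tendsto R atTop (𝓝 R')) :
    Tendsto (fun m => welfare (tie (N m)) q (x m) (y m) (s m) / N m) atTop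
      (𝓝 (∫ t, payoff y' R' t ∂μ)) := by
  refine hx.tendsto_average hμ (fun m i => ?_) ?_
  · rw [abs_of_nonneg (utility_nonneg (hx.mem m) (h.y_mem m) _ _)]
    exact utility_le_one i
  · filter_upwards [hμ.ae_abs_sub_ne y' R'] with t ht i hi
    exact h.tendsto_utility hx.mem hy hR hi ht

lemma tendsto_ite_of_eventually_iff {P : ℕ → Prop} {A : Set ℝ} {t : ℝ} [∀ m, Decidable (P m)]
    (h : ∀ᶠ m in atTop, P m ↔ t ∈ A) :
    Tendsto (fun m => if P m then (1 : ℝ) else 0) atTop (𝓝 (A.indicator (fun _ => (1 : ℝ)) t)) := by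
  refine tendsto_const_nhds.congr' ?_
  filter_upwards [h] with m hm
  by_cases ht : t ∈ A
  · simp [ht, hm]
  · simp [ht, hm]

open Classical in
/-- Averages of indicators converge to probabilities. -/
lemma Approximates.tendsto_fraction (hμ : IsRegular μ) (hx : Approximates μ N x)
    {S : ∀ m, Finset (Fin (N m))} {A : Set ℝ} (hA : MeasurableSet A)
    (h : ∀ᵐ t ∂μ, ∀ i : ∀ m, Fin (N m), Tendsto (fun m => x m (i m)) atTop (𝓝 t) →
      ∀ᶠ m in atTop, i m ∈ S m ↔ t ∈ A) :
    Tendsto (fun m => ((S m).card : ℝ) / N m) atTop (𝓝 (μ.real A)) := by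
  have := hx.tendsto_average hμ (g := fun m i => if i ∈ S m then (1 : ℝ) else 0)
    (G := A.indicator fun _ => (1 : ℝ)) (fun m i => by split_ifs <;> simp) (by
      filter_upwards [h] with t ht i hi
      exact tendsto_ite_of_eventually_iff (ht i hi))
  rw [integral_indicator_const _ hA, smul_eq_mul, mul_one] at this
  refine this.congr fun m => ?_
  simp

open Classical in
lemma IsNashSeq.tendsto_covered (hμ : IsRegular μ) (hx : Approximates μ N x)
    (h : IsNashSeq tie q N x y s R) (hy : Tendsto y atTop (𝓝 y')) (hR : Tendsto R atTop (𝓝 R')) :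
    Tendsto (fun m => ((servedBy (tie (N m)) q (x m) (y m) (s m) 0).card : ℝ) / N m +
      ((servedBy (tie (N m)) q (x m) (y m) (s m) 1).card : ℝ) / N m) atTop
      (𝓝 (μ.real (covered y' R'))) := by
  have := hx.tendsto_fraction hμ (S := fun m => Finset.univ.filter fun i =>
    Accommodated (tie (N m)) q (x m) (y m) (s m) i) (measurableSet_covered y' R') (by
      filter_upwards [hμ.ae_abs_sub_ne y' R'] with t ht i hi
      simpa using h.eventually_accommodated_iff hy hR hi ht)
  refine this.congr fun m => ?_
  rw [← add_div, ← Nat.cast_add, ← Finset.card_union_of_disjoint]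
  · congr 3
    ext i
    simp only [Finset.mem_filter, Finset.mem_univ, true_and, Finset.mem_union, mem_servedBy]
    rcases fin_two_eq_or zero_ne_one (s m i) with h0 | h0 <;> simp [h0]
  · rw [Finset.disjoint_left]
    intro i h1 h2
    rw [mem_servedBy] at h1 h2
    exact zero_ne_one (h1.1.symm.trans h2.1)

lemma tendsto_cap (hq : ∀ j, 0 < q j) (hx : Approximates μ N x) (j : Fin 2) :
    Tendsto (fun m => (cap q (N m) j : ℝ) / N m) atTop (𝓝 (q j)) :=
  (tendsto_nat_floor_mul_div_atTop (R := ℝ) (hq j).le).comp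
    (tendsto_natCast_atTop_atTop.comp hx.tendsto)

/-- A ball of radius 1 would cover all of `[0,1]`, whereas the seats suffice for a fraction `q 0 + q
1 < 1` only. Hence all seats are eventually taken. -/
lemma IsNashSeq.radius_lt_one (hμ : IsRegular μ) (hq : ∀ j, 0 < q j) (hQ : q 0 + q 1 < 1)
    (hx : Approximates μ N x) (h : IsNashSeq tie q N x y s R) (hy : Tendsto y atTop (𝓝 y'))
    (hR : Tendsto R atTop (𝓝 R')) (j : Fin 2) : R' j < 1 := by
  have hR' : R' ∈ square := isClosed_square.mem_of_tendsto hR (Eventually.of_forall h.R_mem)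
  have hy' : y' ∈ square := isClosed_square.mem_of_tendsto hy (Eventually.of_forall h.y_mem)
  refine lt_of_le_of_ne (hR' j).2 fun h1 => ?_
  have hle : μ.real (covered y' R') ≤ q 0 + q 1 := by
    refine le_of_tendsto_of_tendsto (h.tendsto_covered hμ hx hy hR)
      ((tendsto_cap hq hx 0).add (tendsto_cap hq hx 1)) (Eventually.of_forall fun m => ?_)
    refine add_le_add ?_ ?_ <;>
    exact div_le_div_of_nonneg_right (by exact_mod_cast card_servedBy_le _) (Nat.cast_nonneg _)
  have : μ.real (covered y' R') = 1 := by
    rw [← probReal_univ (μ := μ)]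
    apply measureReal_congr_ae
    filter_upwards [hμ.ae_mem] with t ht
    simp only [mem_univ, iff_true]
    exact ⟨j, by rw [h1]; exact abs_sub_le_one ht (hy' j)⟩
  linarith

lemma IsNashSeq.eventually_full (hμ : IsRegular μ) (hq : ∀ j, 0 < q j) (hQ : q 0 + q 1 < 1)
    (hx : Approximates μ N x) (h : IsNashSeq tie q N x y s R) (hy : Tendsto y atTop (𝓝 y'))
    (hR : Tendsto R atTop (𝓝 R')) (j : Fin 2) :
    Tendsto (fun m => ((servedBy (tie (N m)) q (x m) (y m) (s m) j).card : ℝ) / N m) atTop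
      (𝓝 (q j)) := by
  refine (tendsto_cap hq hx j).congr' ?_
  have : Tendsto (fun m => R m j) atTop (𝓝 (R' j)) :=
    (continuous_apply j).continuousAt.tendsto.comp hR
  filter_upwards [this.eventually_lt_const (h.radius_lt_one hμ hq hQ hx hy hR j)] with m hm
  rw [h.full m j hm]

lemma IsNashSeq.measureReal_covered (hμ : IsRegular μ) (hq : ∀ j, 0 < q j) (hQ : q 0 + q 1 < 1)
    (hx : Approximates μ N x) (h : IsNashSeq tie q N x y s R) (hy : Tendsto y atTop (𝓝 y'))
    (hR : Tendsto R atTop (𝓝 R')) : μ.real (covered y' R') = q 0 + q 1 :=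
  tendsto_nhds_unique (h.tendsto_covered hμ hx hy hR)
    ((h.eventually_full hμ hq hQ hx hy hR 0).add (h.eventually_full hμ hq hQ hx hy hR 1))

lemma abs_sub_lt_abs_sub {a b t : ℝ} (hab : a < b) (h : t < (a + b) / 2) : |t - a| < |t - b| := by
  rw [abs_of_neg (show t - b < 0 by linarith), abs_lt]
  constructor <;> linarith

lemma abs_sub_lt_abs_sub' {a b t : ℝ} (hab : a < b) (h : (a + b) / 2 < t) : |t - b| < |t - a| := by
  rw [abs_of_pos (show 0 < t - a by linarith), abs_lt]
  constructor <;> linarith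

/-- The strict order of the facilities is needed only along the sequence. The limits may coincide,
and this is how radii are found on the diagonal. -/
lemma IsNashSeq.measureReal_served (hμ : IsRegular μ) (hq : ∀ j, 0 < q j) (hQ : q 0 + q 1 < 1)
    (hx : Approximates μ N x) (h : IsNashSeq tie q N x y s R) (hy : Tendsto y atTop (𝓝 y'))
    (hR : Tendsto R atTop (𝓝 R')) {j k : Fin 2} (hjk : j ≠ k) (hlt : ∀ᶠ m in atTop, y m j < y m k) :
    μ.real (servedLeft (y' j) (y' k) (R' j) (R' k)) = q j ∧
    μ.real (servedRight (y' j) (y' k) (R' j) (R' k)) = q k := by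
  have hR' : R' ∈ square := isClosed_square.mem_of_tendsto hR (Eventually.of_forall h.R_mem)
  have hyl : ∀ l, Tendsto (fun m => y m l) atTop (𝓝 (y' l)) := fun l =>
    (continuous_apply l).continuousAt.tendsto.comp hy
  have hle : y' j ≤ y' k := le_of_tendsto_of_tendsto (hyl j) (hyl k) (hlt.mono fun m hm => hm.le)
  have hmid : Tendsto (fun m => (y m j + y m k) / 2) atTop (𝓝 ((y' j + y' k) / 2)) :=
    ((hyl j).add (hyl k)).div_const 2
  have c1 : ∀ t, t < (y' j + y' k) / 2 → ∀ i : ∀ m, Fin (N m),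
      Tendsto (fun m => x m (i m)) atTop (𝓝 t) →
      ∀ᶠ m in atTop, |x m (i m) - y m j| < |x m (i m) - y m k| := by
    intro t ht i hi
    filter_upwards [hi.eventually_lt hmid ht, hlt] with m h1 h2
    exact abs_sub_lt_abs_sub h2 h1
  have c2 : ∀ t, (y' j + y' k) / 2 < t → ∀ i : ∀ m, Fin (N m),
      Tendsto (fun m => x m (i m)) atTop (𝓝 t) →
      ∀ᶠ m in atTop, |x m (i m) - y m k| < |x m (i m) - y m j| := by
    intro t ht i hi
    filter_upwards [hmid.eventually_lt hi ht, hlt] with m h1 h2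
    exact abs_sub_lt_abs_sub' h2 h1
  constructor
  · refine tendsto_nhds_unique (hx.tendsto_fraction hμ (measurableSet_servedLeft _ _ _ _) ?_)
      (h.eventually_full hμ hq hQ hx hy hR j)
    filter_upwards [hμ.ae_abs_sub_ne y' R', hμ.ae_ne ((y' j + y' k) / 2)] with t ht hne i hi
    rw [mem_servedLeft_iff hle (hR' k).1 hne (ht k)]
    exact h.eventually_mem_servedBy_iff hy hR hi ht hjk (fun hc => c1 t hc i hi)
      (fun hc => c2 t (lt_of_le_of_ne (not_lt.1 hc) hne.symm) i hi)
  · refine tendsto_nhds_unique (hx.tendsto_fraction hμ (measurableSet_servedRight _ _ _ _) ?_)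
      (h.eventually_full hμ hq hQ hx hy hR k)
    filter_upwards [hμ.ae_abs_sub_ne y' R', hμ.ae_ne ((y' j + y' k) / 2)] with t ht hne i hi
    rw [mem_servedRight_iff hle (hR' j).1 hne (ht j)]
    exact h.eventually_mem_servedBy_iff hy hR hi ht hjk.symm (fun hc => c2 t hc i hi)
      (fun hc => c1 t (lt_of_le_of_ne (not_lt.1 hc) hne) i hi)

end Limit

/-! ### Empirical distributions -/

section Empirical

set_option linter.unusedSectionVars false

variable {μ : Measure ℝ} [IsProbabilityMeasure μ]

lemma ncard_le_eq_sum {n : ℕ} (x : Fin n → ℝ) (t : ℝ) :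
    ({i | x i ≤ t}.ncard : ℝ) = ∑ i, (Iic t).indicator (fun _ => (1 : ℝ)) (x i) := by
  classical
  simp only [indicator_apply, mem_Iic, Finset.sum_boole]
  rw [← Set.ncard_coe_finset]
  simp

lemma measurable_ncard_le (n : ℕ) (t : ℝ) :
    Measurable fun x : Fin n → ℝ => ({i | x i ≤ t}.ncard : ℝ) := by
  simp_rw [ncard_le_eq_sum]
  exact Finset.measurable_sum _ fun i _ =>
    (measurable_const.indicator measurableSet_Iic).comp (measurable_pi_apply i)

/-- Chebyshev's inequality for a sum of `n` independent indicators, each of variance at most 1. -/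
lemma measure_empirical_le (n : ℕ) (hn : 0 < n) (t : ℝ) {ε : ℝ} (hε : 0 < ε) :
    (Measure.pi fun _ : Fin n => μ)
      {x | ε * n ≤ |({i | x i ≤ t}.ncard : ℝ) - n * cdf μ t|} ≤ ENNReal.ofReal (1 / (ε ^ 2 * n)) := by
  set g : ℝ → ℝ := (Iic t).indicator fun _ => (1 : ℝ) with hg
  have hgm : Measurable g := measurable_const.indicator measurableSet_Iic
  have hg01 : ∀ z, g z ∈ Icc (0 : ℝ) 1 := by
    intro z
    simp only [hg, indicator_apply]
    split_ifs <;> simp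
  have hmem : MemLp g 2 μ := MemLp.of_bound hgm.aestronglyMeasurable 1
    (Eventually.of_forall fun z => by
      rw [Real.norm_eq_abs, abs_of_nonneg (hg01 z).1]; exact (hg01 z).2)
  have hmemi : ∀ i : Fin n, MemLp (fun x : Fin n → ℝ => g (x i)) 2 (Measure.pi fun _ => μ) :=
    fun i => hmem.comp_measurePreserving (measurePreserving_eval _ i)
  have hsum : MemLp (∑ i, fun x : Fin n → ℝ => g (x i)) 2 (Measure.pi fun _ => μ) :=
    memLp_finsetSum' _ fun i _ => hmemi i
  have hn' : (0 : ℝ) < n := by exact_mod_cast hn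
  have hcheb := meas_ge_le_variance_div_sq hsum (c := ε * n) (by positivity)
  have hvar : Var[∑ i, fun x : Fin n → ℝ => g (x i); Measure.pi fun _ => μ] ≤ n := by
    rw [variance_sum_pi (μ := fun _ : Fin n => μ) (X := fun _ => g) fun _ => hmem]
    have : Var[g; μ] ≤ 1 := by
      have := variance_le_sq_of_bounded (μ := μ) (X := g) (a := 0) (b := 1)
        (Eventually.of_forall hg01) hgm.aemeasurable
      linarith
    simp only [Finset.sum_const, Finset.card_univ, Fintype.card_fin, nsmul_eq_mul]
    nlinarith
  have hmean : ∫ x : Fin n → ℝ, (∑ i, fun x : Fin n → ℝ => g (x i)) x ∂(Measure.pi fun _ => μ) =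
      n * cdf μ t := by
    simp only [Finset.sum_apply]
    rw [integral_finsetSum _ fun i _ => (hmemi i).integrable (by norm_num)]
    have : ∀ i : Fin n, ∫ x : Fin n → ℝ, g (x i) ∂(Measure.pi fun _ => μ) = cdf μ t := by
      intro i
      have h1 := (measurePreserving_eval (fun _ : Fin n => μ) i)
      have h2 := integral_map (μ := Measure.pi fun _ : Fin n => μ) (φ := Function.eval i)
        h1.measurable.aemeasurable (f := g) hgm.aestronglyMeasurable
      rw [h1.map_eq] at h2
      rw [cdf_eq_real]
      refine Eq.trans h2.symm ?_
      rw [hg, integral_indicator_const _ measurableSet_Iic, smul_eq_mul, mul_one]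
    rw [Finset.sum_congr rfl fun i _ => this i]
    simp
  rw [hmean] at hcheb
  refine le_trans (le_of_eq ?_) (hcheb.trans (ENNReal.ofReal_le_ofReal ?_))
  · congr 1
    ext x
    simp only [mem_ofPred_eq, Finset.sum_apply, ncard_le_eq_sum, hg]
  · rw [div_le_div_iff₀ (by positivity) (by positivity)]
    nlinarith [mul_le_mul_of_nonneg_right hvar (by positivity : (0 : ℝ) ≤ ε ^ 2 * n)]

lemma ncard_le_mono {n : ℕ} (x : Fin n → ℝ) {a b : ℝ} (hab : a ≤ b) :
    ({i | x i ≤ a}.ncard : ℝ) ≤ {i | x i ≤ b}.ncard := by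
  exact_mod_cast Set.ncard_le_ncard (fun i (hi : x i ≤ a) => hi.trans hab) (Set.toFinite _)

lemma ncard_le_card {n : ℕ} (x : Fin n → ℝ) (a : ℝ) : ({i | x i ≤ a}.ncard : ℝ) ≤ n := by
  have := Set.ncard_le_ncard (subset_univ {i | x i ≤ a}) (Set.toFinite _)
  rw [Set.ncard_univ, Nat.card_fin] at this
  exact_mod_cast this

/-- Closeness on a grid of quantiles implies closeness. -/
lemma close_of_grid {n K : ℕ} (hK : 0 < K) {z : ℕ → ℝ}
    (hz : ∀ l ≤ K, cdf μ (z l) = l / K) {x : Fin n → ℝ} {ε : ℝ} (hε : 0 ≤ ε)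
    (h : ∀ l ≤ K, |({i | x i ≤ z l}.ncard : ℝ) - n * cdf μ (z l)| ≤ ε * n) :
    Close μ x (ε + 2 / K) := by
  intro t
  have hK' : (0 : ℝ) < K := by exact_mod_cast hK
  have hn : (0 : ℝ) ≤ n := Nat.cast_nonneg n
  -- `F(t)` lies in the cell from `l / K` to `(l + 1) / K`. Only strict inequalities between values
  -- of `F` order the points, so the lower comparison uses the grid point `l - 1`; two cells are
  -- lost.
  set l := ⌊K * cdf μ t⌋₊ with hl
  have l1 : (l : ℝ) ≤ K * cdf μ t := Nat.floor_le (mul_nonneg hK'.le (cdf_nonneg μ t))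
  have l2 : K * cdf μ t < l + 1 := Nat.lt_floor_add_one _
  have hF1 := cdf_le_one μ t
  have hF0 := cdf_nonneg μ t
  have hlt : ∀ {a b : ℝ}, cdf μ a < cdf μ b → a ≤ b := fun {a b} hab => by
    by_contra hn
    exact absurd (monotone_cdf μ (not_le.1 hn).le) (not_le.2 hab)
  have c0 : (0 : ℝ) ≤ ({i | x i ≤ t}.ncard : ℝ) := Nat.cast_nonneg _
  have e2 : (ε + 2 / K) * n = ε * n + 2 * (n / K) := by ring
  have enK : 0 ≤ (n : ℝ) / K := by positivity
  have en : 0 ≤ ε * n := by positivity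
  rw [abs_le]
  constructor
  · rcases Nat.eq_zero_or_pos l with h0 | hpos
    · rw [h0, Nat.cast_zero, zero_add] at l2
      have : n * cdf μ t ≤ n / K := by
        rw [le_div_iff₀ hK']; nlinarith
      linarith
    · have hlK : l - 1 ≤ K := by
        have : (l : ℝ) ≤ K := l1.trans (by nlinarith)
        have : l ≤ K := by exact_mod_cast this
        omega
      have hzl := hz _ hlK
      rw [Nat.cast_sub hpos, Nat.cast_one] at hzl
      have h1 : z (l - 1) ≤ t := by
        apply hlt
        rw [hzl, div_lt_iff₀ hK']
        linarith
      have h2 := ncard_le_mono x h1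
      have h3 := (abs_le.1 (h _ hlK)).1
      rw [hzl] at h3
      have h4 : n * cdf μ t ≤ n * ((l - 1) / K) + 2 * (n / K) := by
        have : cdf μ t ≤ (l - 1) / K + 2 / K := by
          rw [← add_div, le_div_iff₀ hK']; linarith
        calc n * cdf μ t ≤ n * ((l - 1) / K + 2 / K) := mul_le_mul_of_nonneg_left this hn
          _ = _ := by ring
      linarith
  · rcases Nat.lt_or_ge l K with hlK | hlK
    · have hzl := hz (l + 1) hlK
      rw [Nat.cast_add, Nat.cast_one] at hzl
      have h1 : t ≤ z (l + 1) := by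
        apply hlt
        rw [hzl, lt_div_iff₀ hK']
        linarith
      have h2 := ncard_le_mono x h1
      have h3 := (abs_le.1 (h _ hlK)).2
      rw [hzl] at h3
      have h4 : n * ((l + 1 : ℝ) / K) ≤ n * cdf μ t + 2 * (n / K) := by
        have : (l + 1 : ℝ) / K ≤ cdf μ t + 2 / K := by
          rw [div_le_iff₀ hK', add_mul, div_mul_cancel₀ _ hK'.ne']; linarith
        calc n * ((l + 1 : ℝ) / K) ≤ n * (cdf μ t + 2 / K) := mul_le_mul_of_nonneg_left this hn
          _ = _ := by ring
      linarith
    · have : (K : ℝ) ≤ l := by exact_mod_cast hlK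
      have h1 : 1 ≤ cdf μ t := by nlinarith
      have h2 := ncard_le_card x t
      nlinarith

/-- With high probability the empirical distribution is close to the law. -/
lemma IsRegular.exists_bad_event (hμ : IsRegular μ) {η : ℝ} (hη : 0 < η) :
    ∃ B : ∀ n : ℕ, Set (Fin n → ℝ), (∀ n, MeasurableSet (B n)) ∧ (∀ n, ∀ x ∉ B n, Close μ x η) ∧
      Tendsto (fun n : ℕ => (Measure.pi fun _ : Fin n => μ) (B n)) atTop (𝓝 0) := by
  -- The grid contributes `2 / K < η / 2`, the deviations at its points another `η / 2`.
  obtain ⟨K, hK⟩ := exists_nat_gt (4 / η)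
  have hK' : (0 : ℝ) < K := lt_trans (by positivity) hK
  have hK0 : 0 < K := by exact_mod_cast hK'
  have hz : ∀ l : ℕ, ∃ z, l ≤ K → cdf μ z = l / K := by
    intro l
    by_cases hl : l ≤ K
    · have hl' : (l : ℝ) ≤ K := by exact_mod_cast hl
      obtain ⟨z, _, hz⟩ := hμ.exists_cdf_eq (c := l / K)
        ⟨by positivity, by rw [div_le_one hK']; exact hl'⟩
      exact ⟨z, fun _ => hz⟩
    · exact ⟨0, fun h => absurd h hl⟩
  choose z hz using hz
  have h2K : 2 / K < η / 2 := by
    rw [div_lt_iff₀ hη] at hK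
    rw [div_lt_div_iff₀ hK' two_pos]; linarith
  refine ⟨fun n => ⋃ l ∈ Finset.range (K + 1),
    {x | η / 2 * n ≤ |({i | x i ≤ z l}.ncard : ℝ) - n * cdf μ (z l)|}, fun n => ?_,
    fun n x hx => ?_, ?_⟩
  · refine Finset.measurableSet_biUnion _ fun l _ => ?_
    exact measurableSet_le measurable_const
      (_root_.continuous_abs.measurable.comp ((measurable_ncard_le n _).sub measurable_const))
  · have hc := close_of_grid hK0 hz (x := x) (ε := η / 2) (by positivity) fun l hl => by
      by_contra hn
      apply hx
      simp only [mem_iUnion, Finset.mem_range]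
      exact ⟨l, by omega, (not_le.1 hn).le⟩
    intro t
    refine (hc t).trans (mul_le_mul_of_nonneg_right (by linarith) (Nat.cast_nonneg _))
  · have hub : Tendsto (fun n : ℕ => ∑ _l ∈ Finset.range (K + 1),
        ENNReal.ofReal (1 / ((η / 2) ^ 2 * n))) atTop (𝓝 0) := by
      rw [show (0 : ENNReal) = ∑ _l ∈ Finset.range (K + 1), 0 by simp]
      refine tendsto_finsetSum _ fun l _ => ?_
      rw [← ENNReal.ofReal_zero]
      refine ENNReal.tendsto_ofReal ?_
      have : Tendsto (fun n : ℕ => (η / 2) ^ 2 * (n : ℝ)) atTop atTop :=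
        tendsto_natCast_atTop_atTop.const_mul_atTop (by positivity)
      exact this.inv_tendsto_atTop.congr fun n => (one_div _).symm
    refine tendsto_of_tendsto_of_tendsto_of_le_of_le' tendsto_const_nhds hub
      (Eventually.of_forall fun n => zero_le) ?_
    filter_upwards [eventually_gt_atTop 0] with n hn
    refine (measure_biUnion_finset_le _ _).trans (Finset.sum_le_sum fun l _ => ?_)
    exact measure_empirical_le n hn (z l) (by positivity)

lemma IsRegular.ae_pi_mem (hμ : IsRegular μ) (n : ℕ) :
    ∀ᵐ x : Fin n → ℝ ∂(Measure.pi fun _ => μ), ∀ i, x i ∈ Icc (0 : ℝ) 1 := by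
  rw [ae_all_iff]
  intro i
  exact (measurePreserving_eval (fun _ : Fin n => μ) i).quasiMeasurePreserving.ae hμ.ae_mem

/-- Bad samples have probability less than 1 for large `n`, so good ones exist. They let statements
about `μ` alone be derived from finite games. -/
lemma IsRegular.exists_approximates (hμ : IsRegular μ) :
    ∃ (N : ℕ → ℕ) (x : ∀ m, Fin (N m) → ℝ), Approximates μ N x := by
  have : ∀ m : ℕ, ∃ n : ℕ, m < n ∧ ∃ x : Fin n → ℝ,
      (∀ i, x i ∈ Icc (0 : ℝ) 1) ∧ Close μ x (1 / ((m : ℝ) + 1)) := by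
    intro m
    obtain ⟨B, _, hB, hlim⟩ := hμ.exists_bad_event (η := 1 / ((m : ℝ) + 1)) (by positivity)
    obtain ⟨n, hn1, hn2⟩ := ((hlim.eventually_lt_const (u := 1) one_pos).and
      (eventually_gt_atTop m)).exists
    refine ⟨n, hn2, ?_⟩
    by_contra hcon
    push Not at hcon
    have : ∀ᵐ x : Fin n → ℝ ∂(Measure.pi fun _ => μ), x ∈ B n := by
      filter_upwards [hμ.ae_pi_mem n] with x hx
      by_contra hxB
      exact hcon x hx (hB n x hxB)
    have h1 : (Measure.pi fun _ : Fin n => μ) (B n) = 1 := by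
      rw [← measure_univ (μ := Measure.pi fun _ : Fin n => μ)]
      apply measure_congr
      filter_upwards [this] with x hx
      exact propext ⟨fun _ => trivial, fun _ => hx⟩
    exact absurd h1 hn1.ne
  choose N hN x hx hc using this
  refine ⟨N, x, fun m => by have := hN m; omega, ?_, hx, fun m => 1 / ((m : ℝ) + 1),
    tendsto_one_div_add_atTop_nhds_zero_nat, hc⟩
  exact tendsto_atTop_mono (fun m => (hN m).le) tendsto_id

end Empirical

/-! ### The two-facility functional -/

lemma served_of_lt {y : Fin 2 → ℝ} {j k : Fin 2} (hjk : j ≠ k) (h : y j < y k) (R : Fin 2 → ℝ) :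
    served y R j = servedLeft (y j) (y k) (R j) (R k) ∧
    served y R k = servedRight (y j) (y k) (R j) (R k) := by
  unfold served
  rcases fin_two_eq_or zero_ne_one j with rfl | rfl <;>
  rcases fin_two_eq_or zero_ne_one k with rfl | rfl
  · exact absurd rfl hjk
  · rw [if_pos h.le]; exact ⟨rfl, rfl⟩
  · rw [if_neg (not_le.2 h)]; exact ⟨rfl, rfl⟩
  · exact absurd rfl hjk

lemma exists_order (y : Fin 2 → ℝ) : ∃ j k, j ≠ k ∧ y j ≤ y k ∧ ∀ R : Fin 2 → ℝ,
    served y R j = servedLeft (y j) (y k) (R j) (R k) ∧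
    served y R k = servedRight (y j) (y k) (R j) (R k) := by
  rcases le_or_gt (y 0) (y 1) with h | h
  · exact ⟨0, 1, zero_ne_one, h, fun R => by unfold served; rw [if_pos h]; exact ⟨rfl, rfl⟩⟩
  · exact ⟨1, 0, one_ne_zero, h.le, fun R => served_of_lt one_ne_zero h R⟩

lemma sum_fin_two {j k : Fin 2} (hjk : j ≠ k) (g : Fin 2 → ℝ) : ∑ l, g l = g j + g k := by
  rw [Fin.sum_univ_two]
  rcases fin_two_eq_or zero_ne_one j with rfl | rfl <;>
  rcases fin_two_eq_or zero_ne_one k with rfl | rfl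
  · exact absurd rfl hjk
  · rfl
  · exact add_comm _ _
  · exact absurd rfl hjk

lemma servedLeft_subset {a b r r' t t' : ℝ} (hr : r ≤ r') (ht : t' ≤ t) :
    servedLeft a b r t ⊆ servedLeft a b r' t' := by
  refine union_subset_union (Icc_subset_Icc (by linarith) ?_)
    (Ioc_subset_Ioc (by linarith) (by linarith))
  exact min_le_min (max_le_max le_rfl (by linarith)) (by linarith)

lemma servedRight_subset {a b r r' t t' : ℝ} (hr : r' ≤ r) (ht : t ≤ t') :
    servedRight a b r t ⊆ servedRight a b r' t' := by
  refine union_subset_union (Icc_subset_Icc ?_ (by linarith))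
    (Ico_subset_Ico (by linarith) (by linarith))
  exact max_le_max (min_le_min le_rfl (by linarith)) (by linarith)

lemma served_subset {y R R' : Fin 2 → ℝ} {j k : Fin 2} (hjk : j ≠ k) (hj : R j ≤ R' j)
    (hk : R' k ≤ R k) : served y R j ⊆ served y R' j := by
  unfold served
  rcases fin_two_eq_or zero_ne_one j with rfl | rfl <;>
  rcases fin_two_eq_or zero_ne_one k with rfl | rfl
  · exact absurd rfl hjk
  · split_ifs
    · exact servedLeft_subset hj hk
    · exact servedRight_subset hk hj
  · split_ifs
    · exact servedRight_subset hk hj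
    · exact servedLeft_subset hj hk
  · exact absurd rfl hjk

lemma measurableSet_served (y R : Fin 2 → ℝ) (j : Fin 2) : MeasurableSet (served y R j) := by
  obtain ⟨a, b, hab, _, h⟩ := exists_order y
  rcases fin_two_eq_or hab j with rfl | rfl
  · rw [(h R).1]; exact measurableSet_servedLeft _ _ _ _
  · rw [(h R).2]; exact measurableSet_servedRight _ _ _ _

section Functional

set_option linter.unusedSectionVars false

variable {μ : Measure ℝ} [IsProbabilityMeasure μ] {q y R R' : Fin 2 → ℝ}

/-- Almost every agent in the union of the balls is served by exactly one facility. -/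
lemma IsRegular.ae_mem_served_iff (hμ : IsRegular μ) {j k : Fin 2} (hle : y j ≤ y k)
    (hR : R ∈ square) (h : served y R j = servedLeft (y j) (y k) (R j) (R k) ∧
      served y R k = servedRight (y j) (y k) (R j) (R k)) :
    ∀ᵐ t ∂μ, t ≠ (y j + y k) / 2 ∧
      (t ∈ served y R j ↔ |t - y j| ≤ R j ∧ (t < (y j + y k) / 2 ∨ R k < |t - y k|)) ∧
      (t ∈ served y R k ↔ |t - y k| ≤ R k ∧ ((y j + y k) / 2 < t ∨ R j < |t - y j|)) := by
  filter_upwards [hμ.ae_abs_sub_ne y R, hμ.ae_ne ((y j + y k) / 2)] with t ht hne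
  rw [h.1, h.2]
  exact ⟨hne, mem_servedLeft_iff hle (hR k).1 hne (ht k),
    mem_servedRight_iff hle (hR j).1 hne (ht j)⟩

lemma abs_sub_le_abs_sub {a b t : ℝ} (hab : a ≤ b) (h : t < (a + b) / 2) : |t - a| ≤ |t - b| := by
  rcases hab.lt_or_eq with hab | rfl
  · exact (abs_sub_lt_abs_sub hab h).le
  · exact le_rfl

lemma abs_sub_le_abs_sub' {a b t : ℝ} (hab : a ≤ b) (h : (a + b) / 2 < t) :
    |t - b| ≤ |t - a| := by
  rcases hab.lt_or_eq with hab | rfl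
  · exact (abs_sub_lt_abs_sub' hab h).le
  · exact le_rfl

/-- Up to null sets the served sets partition the union of the balls, and in the overlap the closer
facility gives the maximum. -/
lemma IsRegular.ae_payoff_eq (hμ : IsRegular μ) (hR : R ∈ square) {j k : Fin 2} (hjk : j ≠ k)
    (hle : y j ≤ y k) (h : served y R j = servedLeft (y j) (y k) (R j) (R k) ∧
      served y R k = servedRight (y j) (y k) (R j) (R k)) :
    ∀ᵐ t ∂μ, payoff y R t = (served y R j).indicator (fun t => 1 - |t - y j|) t +
      (served y R k).indicator (fun t => 1 - |t - y k|) t ∧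
      (covered y R).indicator (fun _ => (1 : ℝ)) t =
        (served y R j).indicator (fun _ => (1 : ℝ)) t +
        (served y R k).indicator (fun _ => (1 : ℝ)) t := by
  classical
  filter_upwards [hμ.ae_mem_served_iff hle hR h] with t ⟨hne, h1, h2⟩
  rw [payoff_eq hjk]
  unfold offer
  simp only [indicator_apply, h1, h2, mem_covered_iff hjk]
  have hj1 := (hR j).2
  have hk1 := (hR k).2
  by_cases hj : |t - y j| ≤ R j <;> by_cases hk : |t - y k| ≤ R k
  · rcases lt_or_gt_of_ne hne with hlt | hlt
    · have := abs_sub_le_abs_sub hle hlt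
      simp only [hj, hk, hlt, not_lt.2 hj, hlt.not_gt, if_true, if_false, true_and, or_false, true_or]
      rw [max_eq_left (by linarith)]; simp
    · have := abs_sub_le_abs_sub' hle hlt
      simp only [hj, hk, hlt, not_lt.2 hk, hlt.not_gt, if_true, if_false, true_and, or_false, true_or]
      rw [max_eq_right (by linarith)]; simp
  · simp only [hj, hk, not_le.1 hk, if_true, if_false, true_and, false_and, or_true, true_or]
    rw [max_eq_left (by linarith)]; simp
  · simp only [hj, hk, not_le.1 hj, if_true, if_false, true_and, false_and, or_true]
    rw [max_eq_right (by linarith)]; simp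
  · simp [hj, hk]

lemma IsRegular.integrable_abs_sub (hμ : IsRegular μ) {c : ℝ} (hc : c ∈ Icc (0 : ℝ) 1) :
    Integrable (fun t => |t - c|) μ := by
  refine Integrable.of_bound (by fun_prop) 1 ?_
  filter_upwards [hμ.ae_mem] with t ht
  rw [Real.norm_eq_abs, abs_abs]
  exact abs_sub_le_one ht hc

lemma IsRegular.integral_indicator_served (hμ : IsRegular μ) {c : ℝ} (hc : c ∈ Icc (0 : ℝ) 1)
    {A : Set ℝ} (hA : MeasurableSet A) :
    Integrable (A.indicator fun t => 1 - |t - c|) μ ∧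
    ∫ t, A.indicator (fun t => 1 - |t - c|) t ∂μ = μ.real A - ∫ t in A, |t - c| ∂μ := by
  have hi := hμ.integrable_abs_sub hc
  refine ⟨((integrable_const _).sub hi).indicator hA, ?_⟩
  rw [integral_indicator hA, integral_sub (integrable_const _).integrableOn hi.integrableOn]
  simp

lemma IsRadii.integral_payoff (hμ : IsRegular μ) (hy : y ∈ square) (h : IsRadii μ q y R) :
    ∫ t, payoff y R t ∂μ = q 0 + q 1 - cost μ y R := by
  obtain ⟨j, k, hjk, hle, hs⟩ := exists_order y
  obtain ⟨i1, e1⟩ := hμ.integral_indicator_served (hy j) (measurableSet_served y R j)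
  obtain ⟨i2, e2⟩ := hμ.integral_indicator_served (hy k) (measurableSet_served y R k)
  rw [integral_congr_ae ((hμ.ae_payoff_eq h.1 hjk hle (hs R)).mono fun t ht => ht.1),
    integral_add i1 i2, e1, e2, h.2, h.2, cost, sum_fin_two hjk, ← Fin.sum_univ_two (f := q),
    sum_fin_two hjk]
  ring

lemma IsRadii.measureReal_covered (hμ : IsRegular μ) (h : IsRadii μ q y R) :
    μ.real (covered y R) = q 0 + q 1 := by
  obtain ⟨j, k, hjk, hle, hs⟩ := exists_order y
  have h1 := integral_congr_ae ((hμ.ae_payoff_eq h.1 hjk hle (hs R)).mono fun t ht => ht.2)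
  rw [integral_add ((integrable_const _).indicator (measurableSet_served y R j))
    ((integrable_const _).indicator (measurableSet_served y R k)),
    integral_indicator_const _ (measurableSet_covered y R),
    integral_indicator_const _ (measurableSet_served y R j),
    integral_indicator_const _ (measurableSet_served y R k), h.2, h.2] at h1
  simp only [smul_eq_mul, mul_one] at h1
  rw [h1, ← Fin.sum_univ_two (f := q), sum_fin_two hjk]

lemma isCompact_covered_inter (y R : Fin 2 → ℝ) : IsCompact (covered y R ∩ Icc 0 1) := by
  have : covered y R = ⋃ j, {t | |t - y j| ≤ R j} := by ext t; simp [covered]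
  rw [this]
  exact isCompact_Icc.inter_left
    (isClosed_iUnion_of_finite fun j => isClosed_le (by fun_prop) continuous_const)

/-- Enlarging both radii strictly enlarges the mass that is covered. -/
lemma IsRegular.measureReal_covered_lt (hμ : IsRegular μ) (hy : y ∈ square) (hR : R ∈ square)
    (hlt : ∀ j, R j < R' j) (h1 : μ.real (covered y R) < 1) :
    μ.real (covered y R) < μ.real (covered y R') := by
  have hz : ∃ z ∈ Icc (0 : ℝ) 1, z ∉ covered y R := by
    by_contra hn
    push Not at hn
    apply h1.ne
    rw [← probReal_univ (μ := μ)]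
    apply measureReal_congr_ae
    filter_upwards [hμ.ae_mem] with t ht
    simp [hn t ht]
  obtain ⟨z, hz, hzc⟩ := hz
  have hne : (covered y R ∩ Icc 0 1).Nonempty :=
    ⟨y 0, ⟨0, by simpa using (hR 0).1⟩, hy 0⟩
  -- `w` is the covered point closest to the uncovered point `z`. Nothing strictly between them is
  -- covered, but the larger ball reaches beyond `w`.
  obtain ⟨w, ⟨hwc, hw⟩, hmin⟩ := (isCompact_covered_inter y R).exists_isMinOn hne
    (f := fun t => |t - z|) (by fun_prop)
  have hmin : ∀ t ∈ Icc (0 : ℝ) 1, |t - z| < |w - z| → t ∉ covered y R := fun t ht hlt' hc =>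
    absurd (hmin ⟨hc, ht⟩) (not_le.2 hlt')
  obtain ⟨j, hj⟩ := hwc
  have hwz : w ≠ z := fun h => hzc (h ▸ ⟨j, hj⟩)
  have hsub : covered y R ⊆ covered y R' := fun t ⟨l, hl⟩ => ⟨l, hl.trans (hlt l).le⟩
  -- an interval next to `w`, towards `z`, that is covered by the larger balls only
  have key : ∃ a b, 0 ≤ a ∧ a < b ∧ b ≤ 1 ∧ ∀ t, a < t → t < b → t ∈ covered y R' \ covered y R := by
    have hδ := sub_pos.2 (hlt j)
    rcases lt_or_gt_of_ne hwz with h | h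
    · refine ⟨w, min z (w + (R' j - R j)), hw.1, lt_min h (by linarith),
        (min_le_left _ _).trans hz.2, fun t ht1 ht2 => ?_⟩
      have h3 := lt_min_iff.1 ht2
      refine ⟨⟨j, ?_⟩, hmin t ⟨hw.1.trans ht1.le, h3.1.le.trans hz.2⟩ ?_⟩
      · have := abs_le.1 hj
        rw [abs_le]; constructor <;> linarith
      · rw [abs_of_neg (by linarith), abs_of_neg (by linarith)]; linarith
    · refine ⟨max z (w - (R' j - R j)), w, hz.1.trans (le_max_left _ _), max_lt h (by linarith),
        hw.2, fun t ht1 ht2 => ?_⟩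
      have h3 := max_lt_iff.1 ht1
      refine ⟨⟨j, ?_⟩, hmin t ⟨hz.1.trans h3.1.le, ht2.le.trans hw.2⟩ ?_⟩
      · have := abs_le.1 hj
        rw [abs_le]; constructor <;> linarith
      · rw [abs_of_pos (by linarith), abs_of_pos (by linarith)]; linarith
  obtain ⟨a, b, ha, hab, hb, hI⟩ := key
  have hpos := hμ.measure_pos ha hab hb
  have h2 : μ.real (Icc a b) ≤ μ.real (covered y R' \ covered y R) := by
    have : μ.real (Icc a b) = μ.real (Ioo a b) := by
      apply measureReal_congr_ae
      filter_upwards [hμ.ae_ne a, hμ.ae_ne b] with t h1 h2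
      exact ⟨fun h => ⟨lt_of_le_of_ne h.1 h1.symm, lt_of_le_of_ne h.2 h2⟩,
        fun h => ⟨h.1.le, h.2.le⟩⟩
    rw [this]
    exact measureReal_mono fun t ht => hI t ht.1 ht.2
  rw [measureReal_sdiff hsub (measurableSet_covered y R)] at h2
  linarith

lemma ae_eq_of_subset_of_measureReal_eq {A B : Set ℝ} (hAB : A ⊆ B) (hA : MeasurableSet A)
    (h : μ.real A = μ.real B) : A =ᵐ[μ] B := by
  refine ae_eq_of_subset_of_measure_ge hAB ?_ hA.nullMeasurableSet (measure_ne_top _ _)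
  rw [measureReal_def, measureReal_def, ENNReal.toReal_eq_toReal_iff' (measure_ne_top _ _)
    (measure_ne_top _ _)] at h
  exact h.ge

/-- The cost does not depend on the choice of the radii. -/
lemma IsRadii.cost_eq (hμ : IsRegular μ) (hQ : q 0 + q 1 < 1) (hy : y ∈ square)
    (h : IsRadii μ q y R) (h' : IsRadii μ q y R') : cost μ y R = cost μ y R' := by
  have c1 := h.measureReal_covered hμ
  have c2 := h'.measureReal_covered hμ
  -- If one radius grows and the other shrinks, each served set is nested with its counterpart; the
  -- masses being equal, they agree almost everywhere.
  have key : ∀ {R R' : Fin 2 → ℝ} {j k : Fin 2}, IsRadii μ q y R → IsRadii μ q y R' → j ≠ k →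
      R j ≤ R' j → R' k ≤ R k → cost μ y R = cost μ y R' := by
    intro R R' j k h h' hjk hj hk
    have e1 : served y R j =ᵐ[μ] served y R' j :=
      ae_eq_of_subset_of_measureReal_eq (served_subset hjk hj hk) (measurableSet_served _ _ _)
        ((h.2 j).trans (h'.2 j).symm)
    have e2 : served y R' k =ᵐ[μ] served y R k :=
      ae_eq_of_subset_of_measureReal_eq (served_subset hjk.symm hk hj) (measurableSet_served _ _ _)
        ((h'.2 k).trans (h.2 k).symm)
    unfold cost
    rw [sum_fin_two hjk, sum_fin_two hjk, setIntegral_congr_set e1, setIntegral_congr_set e2]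
  -- Radii that are strictly ordered in both coordinates would cover different masses; otherwise
  -- `key` applies.
  rcases lt_or_ge (R 0) (R' 0) with h0 | h0 <;> rcases lt_or_ge (R 1) (R' 1) with h1 | h1
  · have := hμ.measureReal_covered_lt hy h.1 (R' := R') (fun j => by
      rcases fin_two_eq_or zero_ne_one j with rfl | rfl
      · exact h0
      · exact h1) (by linarith)
    linarith
  · exact key h h' zero_ne_one h0.le h1
  · exact (key h' h zero_ne_one h0 h1.le).symm
  · rcases h0.lt_or_eq with h0 | h0
    · rcases h1.lt_or_eq with h1 | h1
      · have := hμ.measureReal_covered_lt hy h'.1 (R' := R) (fun j => by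
          rcases fin_two_eq_or zero_ne_one j with rfl | rfl
          · exact h0
          · exact h1) (by linarith)
        linarith
      · exact key h h' one_ne_zero h1.ge h0.le
    · exact key h h' zero_ne_one h0.ge h1

/-- If the facilities are at the same place, the welfare depends on the covered mass only. -/
lemma IsRegular.integral_payoff_diagonal (hμ : IsRegular μ) (hy : y ∈ square) (hyy : y 0 = y 1)
    (h : μ.real (covered y R) = μ.real (covered y R')) :
    ∫ t, payoff y R t ∂μ = ∫ t, payoff y R' t ∂μ := by
  have hc : ∀ R : Fin 2 → ℝ, covered y R = {t | |t - y 0| ≤ max (R 0) (R 1)} := by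
    intro R
    ext t
    rw [mem_covered_iff zero_ne_one, ← hyy]
    exact le_max_iff.symm
  have hp : ∀ R : Fin 2 → ℝ, payoff y R =ᵐ[μ] (covered y R).indicator fun t => 1 - |t - y 0| := by
    intro R
    classical
    filter_upwards [hμ.ae_mem] with t ht
    have := abs_sub_le_one ht (hy 0)
    unfold payoff offer
    simp only [indicator_apply, mem_covered_iff zero_ne_one, ← hyy]
    by_cases h1 : |t - y 0| ≤ R 0 <;> by_cases h2 : |t - y 0| ≤ R 1
    · simp [h1, h2]
    · simp only [h1, h2, if_true, if_false, true_or]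
      exact max_eq_left (by linarith)
    · simp only [h1, h2, if_true, if_false, or_true]
      exact max_eq_right (by linarith)
    · simp [h1, h2]
  have hset : covered y R =ᵐ[μ] covered y R' := by
    rcases le_total (max (R 0) (R 1)) (max (R' 0) (R' 1)) with hle | hle
    · refine ae_eq_of_subset_of_measureReal_eq ?_ (measurableSet_covered _ _) h
      rw [hc, hc]
      exact fun t ht => le_trans (show |t - y 0| ≤ _ from ht) hle
    · refine (ae_eq_of_subset_of_measureReal_eq ?_ (measurableSet_covered _ _) h.symm).symm
      rw [hc, hc]
      exact fun t ht => le_trans (show |t - y 0| ≤ _ from ht) hle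
  rw [integral_congr_ae (hp R), integral_congr_ae (hp R')]
  rw [integral_indicator (measurableSet_covered _ _), integral_indicator (measurableSet_covered _ _),
    setIntegral_congr_set hset]

/-! ### Convergence of the welfare of equilibria -/

variable {tie : ∀ n : ℕ, Fin 2 → Equiv.Perm (Fin n)} {N : ℕ → ℕ} {x : ∀ m, Fin (N m) → ℝ}

lemma IsNashSeq.comp {y : ℕ → Fin 2 → ℝ} {s : ∀ m, Fin (N m) → Fin 2} {R : ℕ → Fin 2 → ℝ}
    (h : IsNashSeq tie q N x y s R) (φ : ℕ → ℕ) :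
    IsNashSeq tie q (N ∘ φ) (fun m => x (φ m)) (y ∘ φ) (fun m => s (φ m)) (R ∘ φ) :=
  ⟨fun _ => h.y_mem _, fun _ => h.R_mem _, fun _ => h.dist_le _, fun _ => h.le_utility _,
    fun _ => h.full _⟩

lemma exists_isNashSeq {y : ℕ → Fin 2 → ℝ} {s : ∀ m, Fin (N m) → Fin 2}
    (hx : ∀ m i, x m i ∈ Icc (0 : ℝ) 1) (hy : ∀ m, y m ∈ square)
    (hs : ∀ m, IsNash (tie (N m)) q (x m) (y m) (s m)) : ∃ R, IsNashSeq tie q N x y s R := by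
  choose R hR h using fun m => (hs m).exists_radii (hx m) (hy m)
  exact ⟨R, hy, hR, fun m j => (h m j).1, fun m j => (h m j).2.1, fun m j => (h m j).2.2⟩

/-- Radii of finite equilibria for approximating populations have a limit point, which inherits the
mass equations. -/
lemma IsRegular.exists_isRadii (hμ : IsRegular μ) (hq : ∀ j, 0 < q j) (hQ : q 0 + q 1 < 1)
    (hy : y ∈ square) : ∃ R, IsRadii μ q y R := by
  let tie : ∀ n : ℕ, Fin 2 → Equiv.Perm (Fin n) := fun n _ => Equiv.refl _
  obtain ⟨N, x, hx⟩ := hμ.exists_approximates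
  obtain ⟨j, k, hjk, hle, hserved⟩ := exists_order y
  let δ : ℕ → ℝ := fun m => 1 / ((m : ℝ) + 1)
  have hδ0 : ∀ m, 0 < δ m := fun m => by positivity
  have hδ1 : ∀ m, δ m ≤ 1 := fun m => by
    simp only [δ]
    rw [div_le_one (by positivity)]
    linarith [Nat.cast_nonneg (α := ℝ) m]
  have hδ : Tendsto δ atTop (𝓝 0) := tendsto_one_div_add_atTop_nhds_zero_nat
  -- The facilities are pushed apart, `j` towards 0 and `k` towards 1, so that they are strictly
  -- ordered even if `y j = y k`.
  let yy : ℕ → Fin 2 → ℝ := fun m l => if l = j then y l * (1 - δ m) else y l + (1 - y l) * δ m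
  have hyy : ∀ m, yy m ∈ square := by
    intro m l
    have h1 := hδ0 m
    have h2 := hδ1 m
    have h3 := hy l
    simp only [yy]
    split_ifs
    · exact ⟨mul_nonneg h3.1 (by linarith), by nlinarith [h3.1, h3.2]⟩
    · exact ⟨by nlinarith [h3.1, h3.2], by nlinarith [h3.1, h3.2]⟩
  have hlim : Tendsto yy atTop (𝓝 y) := by
    rw [tendsto_pi_nhds]
    intro l
    by_cases hl : l = j
    · simp only [yy, hl, if_true]
      simpa using (tendsto_const_nhds (x := y j)).mul ((tendsto_const_nhds (x := (1 : ℝ))).sub hδ)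
    · simp only [yy, hl, if_false]
      simpa using (tendsto_const_nhds (x := y l)).add ((tendsto_const_nhds (x := 1 - y l)).mul hδ)
  have hlt : ∀ m, yy m j < yy m k := by
    intro m
    have h1 := hδ0 m
    have h2 := hδ1 m
    simp only [yy, hjk.symm, if_true, if_false]
    nlinarith [mul_nonneg (sub_nonneg.2 hle) (sub_nonneg.2 h2)]
  choose s hs _ using fun m => exists_isNash (tie (N m)) q (yy m) (hx.mem m) (hyy m) hjk
  obtain ⟨R, hR⟩ := exists_isNashSeq hx.mem hyy hs
  obtain ⟨R', hR', φ, hφ, hlimR⟩ := isCompact_square.tendsto_subseq hR.R_mem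
  have := (hR.comp φ).measureReal_served hμ hq hQ (hx.comp hφ.tendsto_atTop)
    (hlim.comp hφ.tendsto_atTop) hlimR hjk (Eventually.of_forall fun m => hlt _)
  refine ⟨R', hR', fun l => ?_⟩
  rcases fin_two_eq_or hjk l with rfl | rfl
  · rw [(hserved R').1]; exact this.1
  · rw [(hserved R').2]; exact this.2

lemma IsRadii.functionalW_eq (hμ : IsRegular μ) (hQ : q 0 + q 1 < 1) (hy : y ∈ square)
    (h : IsRadii μ q y R) : functionalW μ q y = cost μ y R :=
  IsRadii.cost_eq hμ hQ hy (Classical.epsilon_spec (p := IsRadii μ q y) ⟨R, h⟩) h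

lemma IsRadii.integral_payoff_eq (hμ : IsRegular μ) (hQ : q 0 + q 1 < 1) (hy : y ∈ square)
    (h : IsRadii μ q y R) : ∫ t, payoff y R t ∂μ = q 0 + q 1 - functionalW μ q y := by
  rw [h.integral_payoff hμ hy, h.functionalW_eq hμ hQ hy]

/-- The welfare per agent of equilibria converges to the one given by the functional. -/
lemma IsRegular.tendsto_welfare (hμ : IsRegular μ) (hq : ∀ j, 0 < q j) (hQ : q 0 + q 1 < 1)
    (hx : Approximates μ N x) {yy : ℕ → Fin 2 → ℝ} (hyy : ∀ m, yy m ∈ square)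
    (hlim : Tendsto yy atTop (𝓝 y)) {s : ∀ m, Fin (N m) → Fin 2}
    (hs : ∀ m, IsNash (tie (N m)) q (x m) (yy m) (s m)) :
    Tendsto (fun m => welfare (tie (N m)) q (x m) (yy m) (s m) / N m) atTop
      (𝓝 (q 0 + q 1 - functionalW μ q y)) := by
  have hy : y ∈ square := isClosed_square.mem_of_tendsto hlim (Eventually.of_forall hyy)
  obtain ⟨R, hR⟩ := exists_isNashSeq hx.mem hyy hs
  refine tendsto_of_subseq_tendsto fun ψ hψ => ?_
  obtain ⟨R', hR', φ, hφ, hlimR⟩ := isCompact_square.tendsto_subseq (fun m => hR.R_mem (ψ m))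
  refine ⟨φ, ?_⟩
  have hψφ : Tendsto (ψ ∘ φ) atTop atTop := hψ.comp hφ.tendsto_atTop
  have hseq := hR.comp (ψ ∘ φ)
  have hx' := hx.comp hψφ
  have hlim' := hlim.comp hψφ
  have hw := hseq.tendsto_welfare hμ hx' hlim' hlimR
  suffices hp : ∫ t, payoff y R' t ∂μ = q 0 + q 1 - functionalW μ q y by
    rw [← hp]; exact hw
  -- On the diagonal the order of the locations may vary along the sequence, and the limit radii
  -- need not solve the separate mass equations. The total covered mass is still right and
  -- determines the welfare.
  by_cases hdiag : y 0 = y 1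
  · obtain ⟨R₀, hR₀⟩ := hμ.exists_isRadii hq hQ hy
    rw [← hR₀.integral_payoff_eq hμ hQ hy]
    refine hμ.integral_payoff_diagonal hy hdiag ?_
    rw [hR₀.measureReal_covered hμ, hseq.measureReal_covered hμ hq hQ hx' hlim' hlimR]
  · have hlt : ∃ j k, j ≠ k ∧ y j < y k := by
      rcases lt_or_gt_of_ne hdiag with h | h
      · exact ⟨0, 1, zero_ne_one, h⟩
      · exact ⟨1, 0, one_ne_zero, h⟩
    obtain ⟨j, k, hjk, hlt⟩ := hlt
    have hev : ∀ᶠ m in atTop, (yy ∘ (ψ ∘ φ)) m j < (yy ∘ (ψ ∘ φ)) m k :=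
      Tendsto.eventually_lt ((continuous_apply j).continuousAt.tendsto.comp hlim')
        ((continuous_apply k).continuousAt.tendsto.comp hlim') hlt
    have hm := hseq.measureReal_served hμ hq hQ hx' hlim' hlimR hjk hev
    have hrad : IsRadii μ q y R' := by
      refine ⟨hR', fun l => ?_⟩
      obtain ⟨e1, e2⟩ := served_of_lt hjk hlt R'
      rcases fin_two_eq_or hjk l with rfl | rfl
      · rw [e1]; exact hm.1
      · rw [e2]; exact hm.2
    exact hrad.integral_payoff_eq hμ hQ hy

/-- A diagonal argument: the value at the `m`-th location is replaced by the welfare per agent of a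
finite equilibrium there, with error below `1 / (m + 1)`. `IsRegular.tendsto_welfare` for moving
locations gives the limit. -/
lemma IsRegular.continuousOn_functionalW (hμ : IsRegular μ) (hq : ∀ j, 0 < q j)
    (hQ : q 0 + q 1 < 1) : ContinuousOn (functionalW μ q) square := by
  let tie : ∀ n : ℕ, Fin 2 → Equiv.Perm (Fin n) := fun n _ => Equiv.refl _
  obtain ⟨N, x, hx⟩ := hμ.exists_approximates
  classical
  intro y hy
  rw [ContinuousWithinAt, tendsto_iff_seq_tendsto]
  intro yy hyy
  obtain ⟨hlim, hmem⟩ := tendsto_nhdsWithin_iff.1 hyy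
  -- modify finitely many terms to stay in the square
  let y₁ : ℕ → Fin 2 → ℝ := fun m => if yy m ∈ square then yy m else y
  have hy₁ : ∀ m, y₁ m ∈ square := fun m => by
    simp only [y₁]; split_ifs with h
    · exact h
    · exact hy
  have heq : ∀ᶠ m in atTop, y₁ m = yy m := by
    filter_upwards [hmem] with m hm
    simp [y₁, hm]
  have hlim₁ : Tendsto y₁ atTop (𝓝 y) := hlim.congr' (heq.mono fun m hm => hm.symm)
  choose s hs _ using fun m l => exists_isNash (tie (N l)) q (y₁ m) (hx.mem l) (hy₁ m) zero_ne_one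
  have hex : ∀ m : ℕ, ∃ l, m ≤ l ∧
      |welfare (tie (N l)) q (x l) (y₁ m) (s m l) / N l - (q 0 + q 1 - functionalW μ q (y₁ m))| <
        1 / ((m : ℝ) + 1) := by
    intro m
    have := hμ.tendsto_welfare (tie := tie) hq hQ hx (yy := fun _ => y₁ m) (fun _ => hy₁ m)
      tendsto_const_nhds (s := fun l => s m l) (fun l => hs m l)
    obtain ⟨l, h1, h2⟩ := ((Metric.tendsto_nhds.1 this (1 / ((m : ℝ) + 1)) (by positivity)).and
      (eventually_ge_atTop m)).exists
    exact ⟨l, h2, h1⟩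
  choose l hl hclose using hex
  have hl' : Tendsto l atTop atTop := tendsto_atTop_mono hl tendsto_id
  have h1 := hμ.tendsto_welfare (tie := tie) hq hQ (hx.comp hl') hy₁ hlim₁
    (s := fun m => s m (l m)) (fun m => hs m (l m))
  have h2 : Tendsto (fun m => welfare (tie (N (l m))) q (x (l m)) (y₁ m) (s m (l m)) / N (l m) -
      (q 0 + q 1 - functionalW μ q (y₁ m))) atTop (𝓝 0) :=
    squeeze_zero_norm (fun m => (hclose m).le) tendsto_one_div_add_atTop_nhds_zero_nat
  have h3 := (tendsto_const_nhds (x := q 0 + q 1)).sub (h1.sub h2)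
  simp only [sub_zero, sub_sub_cancel] at h3
  refine h3.congr' ?_
  filter_upwards [heq] with m hm
  simp only [Function.comp, hm]
  ring

lemma IsRegular.minimisers_nonempty (hμ : IsRegular μ) (hq : ∀ j, 0 < q j) (hQ : q 0 + q 1 < 1) :
    (minimisers μ q).Nonempty := by
  obtain ⟨y, hy, hmin⟩ := isCompact_square.exists_isMinOn ⟨fun _ => 0, fun _ => by simp⟩
    (hμ.continuousOn_functionalW hq hQ)
  exact ⟨y, hy, fun y' hy' => hmin hy'⟩

end Functional

/-! ### Two facilities at the same place are never optimal -/

section Diagonal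

set_option linter.unusedSectionVars false

variable {μ : Measure ℝ} [IsProbabilityMeasure μ] {q y R : Fin 2 → ℝ}

lemma IsRegular.ae_mem_served_iff_of_ne (hμ : IsRegular μ) {j k : Fin 2} (hjk : j ≠ k)
    (hne : y j ≠ y k) (hR : R ∈ square) : ∀ᵐ t ∂μ,
      (t ∈ served y R j ↔ |t - y j| ≤ R j ∧ (|t - y j| < |t - y k| ∨ R k < |t - y k|)) := by
  rcases lt_or_gt_of_ne hne with hlt | hlt
  · filter_upwards [hμ.ae_mem_served_iff hlt.le hR (served_of_lt hjk hlt R)] with t ⟨h1, h2, _⟩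
    rw [h2]
    refine and_congr_right fun _ => or_congr_left ⟨abs_sub_lt_abs_sub hlt, fun h => ?_⟩
    by_contra hn
    exact absurd (abs_sub_lt_abs_sub' hlt (lt_of_le_of_ne (not_lt.1 hn) h1.symm)) (not_lt.2 h.le)
  · filter_upwards [hμ.ae_mem_served_iff hlt.le hR (served_of_lt hjk.symm hlt R)] with t ⟨h1, _, h2⟩
    rw [h2]
    refine and_congr_right fun _ => or_congr_left ⟨abs_sub_lt_abs_sub' hlt, fun h => ?_⟩
    by_contra hn
    exact absurd (abs_sub_lt_abs_sub hlt (lt_of_le_of_ne (not_lt.1 hn) h1)) (not_lt.2 h.le)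

lemma payoff_diagonal (hyy : y 0 = y 1) (hR : R ∈ square) (t : ℝ) :
    payoff y R t = if |t - y 0| ≤ max (R 0) (R 1) then 1 - |t - y 0| else 0 := by
  unfold payoff offer
  rw [← hyy]
  have h0 := (hR 0).2
  have h1 := (hR 1).2
  simp only [le_max_iff]
  by_cases a0 : |t - y 0| ≤ R 0 <;> by_cases a1 : |t - y 0| ≤ R 1
  · simp [a0, a1]
  · simp only [a0, a1, if_true, if_false, true_or]; exact max_eq_left (by linarith)
  · simp only [a0, a1, if_true, if_false, or_true]; exact max_eq_right (by linarith)
  · simp [a0, a1]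

lemma integrable_payoff (hR : R ∈ square) : Integrable (payoff y R) μ := by
  have hm : Measurable (payoff y R) := by
    have : ∀ j, Measurable fun t => offer y R t j := fun j =>
      Measurable.ite (measurableSet_le (by fun_prop) measurable_const) (by fun_prop) measurable_const
    exact (this 0).max (this 1)
  have hb : ∀ t j, offer y R t j ∈ Icc (0 : ℝ) 1 := by
    intro t j
    have := (hR j).2
    unfold offer
    split_ifs
    · exact ⟨by linarith, by linarith [abs_nonneg (t - y j)]⟩
    · simp
  refine Integrable.of_bound hm.aestronglyMeasurable 1 (Eventually.of_forall fun t => ?_)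
  unfold payoff
  rw [Real.norm_eq_abs, abs_of_nonneg ((hb t 0).1.trans (le_max_left _ _))]
  exact max_le (hb t 0).2 (hb t 1).2

open Classical in
/-- The gain of an agent at signed distance `z` from a facility, if the other facility is moved away
from it by `ε`, to the negative side. -/
lemma gain_of_shift {r τ ρ ε z : ℝ} (hε : 0 < ε)
    (h1 : |z + ε| ≤ r ∨ |z| ≤ τ → |z| ≤ ρ + 2 * ε)
    (h2 : |z| < ρ - 2 * ε → |z + ε| ≤ r ∨ |z| ≤ τ) :
    (if |z| ≤ ρ then 1 - |z| else 0) +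
      (ε * (if |z + ε| ≤ r ∧ (|z + ε| < |z| ∨ τ < |z|) then 1 else 0) -
        4 * ε * (if |z| ≤ 2 * ε ∨ |(|z| - ρ)| ≤ 2 * ε then 1 else 0) -
        2 * ε * (if (|z + ε| ≤ r ∧ (|z + ε| < |z| ∨ τ < |z|)) ∧ 2 * ε < z then 1 else 0)) +
      ((1 - ρ) * (if |z + ε| ≤ r ∨ |z| ≤ τ then 1 else 0) - (1 - ρ) * (if |z| ≤ ρ then 1 else 0)) ≤
    max (if |z + ε| ≤ r then 1 - |z + ε| else 0) (if |z| ≤ τ then 1 - |z| else 0) := by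
  -- An agent served by the moved facility gains `ε` on its own side and loses at most `ε = 2ε - ε`
  -- on the far side `z > 2ε`. The term `4ε` pays for agents within `2ε` of the centre or of the
  -- boundary. The terms with `1 - ρ` account for agents gaining or losing a seat near the boundary;
  -- they will cancel on integration because the covered masses agree.
  have ha : |z + ε| ≤ |z| + ε := (abs_add_le z ε).trans (by rw [abs_of_pos hε])
  by_cases hP : |z + ε| ≤ r ∨ |z| ≤ τ
  · have hz := h1 hP
    by_cases hA : |z + ε| ≤ r ∧ (|z + ε| < |z| ∨ τ < |z|)
    · refine le_trans ?_ (le_max_left _ _)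
      rw [if_pos hA.1, if_pos hA, if_pos hP]
      by_cases hE : |z| ≤ 2 * ε ∨ |(|z| - ρ)| ≤ 2 * ε
      · rw [if_pos hE]
        have : (0 : ℝ) ≤ 2 * ε * (if (|z + ε| ≤ r ∧ (|z + ε| < |z| ∨ τ < |z|)) ∧ 2 * ε < z
            then 1 else 0) := by split_ifs <;> linarith
        split_ifs at this ⊢ <;> linarith
      · rw [if_neg hE]
        push Not at hE
        have hlt : |z| < ρ - 2 * ε := by
          rcases lt_abs.1 hE.2 with h | h
          · linarith
          · linarith
        have hb : |z| ≤ ρ := by linarith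
        simp only [if_pos hb, hA, true_and]
        by_cases hz2 : 2 * ε < z
        · rw [if_pos hz2]
          linarith
        · rw [if_neg hz2]
          have hzneg : z < -(2 * ε) := by
            rcases lt_abs.1 hE.1 with h | h
            · exact absurd h hz2
            · linarith
          have e1 : |z + ε| = -(z + ε) := abs_of_neg (by linarith)
          have e2 : |z| = -z := abs_of_neg (by linarith)
          rw [e1, e2]
          linarith
    · have hk : |z| ≤ τ := by
        rcases hP with h | h
        · by_contra hn
          exact hA ⟨h, Or.inr (not_le.1 hn)⟩
        · exact h
      refine le_trans ?_ (le_max_right _ _)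
      simp only [if_pos hk, hA, if_pos hP, if_false, false_and]
      by_cases hb : |z| ≤ ρ
      · simp only [if_pos hb]
        split_ifs <;> linarith
      · simp only [if_neg hb]
        push Not at hb
        rw [if_pos (Or.inr (by rw [abs_le]; constructor <;> linarith))]
        linarith
  · have hA : ¬ (|z + ε| ≤ r ∧ (|z + ε| < |z| ∨ τ < |z|)) := fun h => hP (Or.inl h.1)
    have hP1 : ¬ |z + ε| ≤ r := fun h => hP (Or.inl h)
    have hP2 : ¬ |z| ≤ τ := fun h => hP (Or.inr h)
    rw [if_neg hP, if_neg hP1, if_neg hP2, max_self]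
    simp only [hA, if_false, false_and]
    by_cases hb : |z| ≤ ρ
    · have h3 : ρ - 2 * ε ≤ |z| := by
        by_contra hn
        exact hP (h2 (not_le.1 hn))
      have hE : |z| ≤ 2 * ε ∨ |(|z| - ρ)| ≤ 2 * ε :=
        Or.inr (by rw [abs_le]; constructor <;> linarith)
      simp only [if_pos hb, if_pos hE]
      linarith
    · simp only [if_neg hb]
      split_ifs <;> linarith

open Classical in
/-- If the shifted facility serves agents on the far side, it serves all agents on its own side. -/
lemma own_side_of_shift {r τ ρ ε z : ℝ} (hε : 0 < ε) (hrτ : τ + ε < r)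
    (h2 : |z| < ρ - 2 * ε → |z + ε| ≤ r ∨ |z| ≤ τ) :
    (if |z| ≤ ρ ∧ z ≤ 0 then (1 : ℝ) else 0) ≤
      (if |z + ε| ≤ r ∧ (|z + ε| < |z| ∨ τ < |z|) then 1 else 0) -
      (if (|z + ε| ≤ r ∧ (|z + ε| < |z| ∨ τ < |z|)) ∧ 2 * ε < z then 1 else 0) +
      (if |z| ≤ 2 * ε ∨ |(|z| - ρ)| ≤ 2 * ε then 1 else 0) := by
  by_cases hL : |z| ≤ ρ ∧ z ≤ 0
  · rw [if_pos hL, if_neg (c := _ ∧ 2 * ε < z) (fun h => by linarith [h.2, hL.2])]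
    by_cases hE : |z| ≤ 2 * ε ∨ |(|z| - ρ)| ≤ 2 * ε
    · rw [if_pos hE]; split_ifs <;> norm_num
    · rw [if_neg hE]
      push Not at hE
      have hlt : |z| < ρ - 2 * ε := by
        rcases lt_abs.1 hE.2 with h | h
        · linarith [hL.1]
        · linarith
      have e2 : |z| = -z := abs_of_nonpos hL.2
      have e1 : |z + ε| = -(z + ε) := abs_of_neg (by linarith [hE.1])
      have hin : |z + ε| ≤ r := by
        rcases h2 hlt with h | h
        · exact h
        · linarith
      rw [if_pos ⟨hin, Or.inl (by linarith)⟩]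
      norm_num
  · rw [if_neg hL]
    by_cases hA : |z + ε| ≤ r ∧ (|z + ε| < |z| ∨ τ < |z|)
    · simp only [hA, true_and]
      split_ifs <;> norm_num
    · simp only [hA, false_and]
      split_ifs <;> norm_num

lemma IsRegular.eventually_measureReal_Icc_lt (hμ : IsRegular μ) (w : ℝ) {κ : ℝ} (hκ : 0 < κ) :
    ∀ᶠ ε in 𝓝[>] (0 : ℝ), μ.real (Icc (w - 2 * ε) (w + 2 * ε)) < κ := by
  have h : Tendsto (fun ε : ℝ => cdf μ (w + 2 * ε) - cdf μ (w - 2 * ε)) (𝓝[>] 0) (𝓝 0) := by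
    have hc : Continuous fun ε : ℝ => cdf μ (w + 2 * ε) - cdf μ (w - 2 * ε) :=
      (hμ.continuous_cdf.comp (by fun_prop)).sub (hμ.continuous_cdf.comp (by fun_prop))
    have := hc.tendsto 0
    simp only [mul_zero, add_zero, sub_zero, sub_self] at this
    exact this.mono_left nhdsWithin_le_nhds
  filter_upwards [h.eventually_lt_const hκ, self_mem_nhdsWithin] with ε h1 h2
  rw [hμ.measureReal_Icc (by linarith [mem_Ioi.1 h2])]
  exact h1

lemma integral_ite_mul (c : ℝ) {P : ℝ → Prop} [DecidablePred P] (hP : MeasurableSet {t | P t}) :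
    Integrable (fun t => c * (if P t then (1 : ℝ) else 0)) μ ∧
      ∫ t, c * (if P t then (1 : ℝ) else 0) ∂μ = c * μ.real {t | P t} := by
  have : (fun t => if P t then (1 : ℝ) else 0) = {t | P t}.indicator fun _ => (1 : ℝ) := by
    funext t
    by_cases h : P t
    · simp [h]
    · simp [h]
  constructor
  · refine Integrable.const_mul ?_ c
    rw [this]
    exact (integrable_const _).indicator hP
  · rw [integral_const_mul, this, integral_indicator_const _ hP, smul_eq_mul, mul_one]

set_option maxHeartbeats 1000000 in
/-- Moving a facility slightly to the side where there are enough agents reduces the cost. -/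
lemma IsRegular.exists_functionalW_lt (hμ : IsRegular μ) (hq : ∀ j, 0 < q j) (hQ : q 0 + q 1 < 1)
    (hy : y ∈ square) (hyy : y 0 = y 1) {j k : Fin 2} (hjk : j ≠ k) {σ ρ : ℝ} (hσ : σ = 1 ∨ σ = -1)
    (hR : IsRadii μ q y R) (hρ : ρ = max (R 0) (R 1))
    (hside : q j ≤ μ.real {t | |σ * (t - y 0)| ≤ ρ ∧ σ * (t - y 0) ≤ 0}) :
    ∃ y' ∈ square, functionalW μ q y' < functionalW μ q y := by
  classical
  set c := y 0 with hc
  have habs : ∀ w, |σ * w| = |w| := fun w => by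
    rcases hσ with rfl | rfl
    · rw [one_mul]
    · rw [neg_one_mul, abs_neg]
  have hσσ : σ * σ = 1 := by rcases hσ with rfl | rfl <;> norm_num
  -- there is room to move the facility
  have hroom : ∀ᶠ ε in 𝓝[>] (0 : ℝ), c - σ * ε ∈ Icc (0 : ℝ) 1 := by
    have hc01 := hy 0
    have hcc : Tendsto (fun ε : ℝ => c - σ * ε) (𝓝[>] 0) (𝓝 c) := by
      have : Continuous fun ε : ℝ => c - σ * ε := by fun_prop
      have h := this.tendsto 0
      rw [mul_zero, sub_zero] at h
      exact h.mono_left nhdsWithin_le_nhds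
    have hnull : ∀ A : Set ℝ, (∀ᵐ t ∂μ, t ∉ A) → μ.real A = 0 := fun A hA => by
      rw [← measureReal_empty (μ := μ)]
      exact measureReal_congr_ae (hA.mono fun t ht => by simp [ht])
    rcases hσ with rfl | rfl
    · have hpos : 0 < c := by
        refine lt_of_le_of_ne hc01.1 fun h0 => ?_
        have : μ.real {t | |1 * (t - c)| ≤ ρ ∧ 1 * (t - c) ≤ 0} = 0 := by
          apply hnull
          filter_upwards [hμ.ae_mem, hμ.ae_ne 0] with t ht hne h
          have := h.2
          rw [← h0, one_mul, sub_zero] at this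
          exact hne (le_antisymm this ht.1)
        linarith [hq j]
      filter_upwards [hcc.eventually_const_lt hpos, self_mem_nhdsWithin] with ε h1 h2
      have := mem_Ioi.1 h2
      exact ⟨h1.le, by linarith [hc01.2]⟩
    · have hpos : c < 1 := by
        refine lt_of_le_of_ne hc01.2 fun h0 => ?_
        have : μ.real {t | |-1 * (t - c)| ≤ ρ ∧ -1 * (t - c) ≤ 0} = 0 := by
          apply hnull
          filter_upwards [hμ.ae_mem, hμ.ae_ne 1] with t ht hne h
          have := h.2
          rw [h0] at this
          exact hne (le_antisymm ht.2 (by linarith))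
        linarith [hq j]
      filter_upwards [hcc.eventually_lt_const hpos, self_mem_nhdsWithin] with ε h1 h2
      have := mem_Ioi.1 h2
      exact ⟨by linarith [hc01.1], h1.le⟩
  -- The exceptional set lies in three short intervals, so its mass is below `q j / 6`. The far-side
  -- mass will be at most as large, and the net gain is at least `ε` times `q j` minus six times
  -- this mass.
  have hκ : 0 < q j / 18 := by linarith [hq j]
  have hpos : ∀ᶠ ε in 𝓝[>] (0 : ℝ), 0 < ε := self_mem_nhdsWithin
  obtain ⟨ε, hε, hεr, s1, s2, s3⟩ := (hpos.and (hroom.and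
    ((hμ.eventually_measureReal_Icc_lt c hκ).and ((hμ.eventually_measureReal_Icc_lt (c + ρ) hκ).and
      (hμ.eventually_measureReal_Icc_lt (c - ρ) hκ))))).exists
  set y' : Fin 2 → ℝ := fun l => if l = j then c - σ * ε else c with hy'
  have hyj : y' j = c - σ * ε := by simp [hy']
  have hyk : y' k = c := by simp [hy', hjk.symm]
  have hy's : y' ∈ square := by
    intro l
    rcases fin_two_eq_or hjk l with rfl | rfl
    · rw [hyj]; exact hεr
    · rw [hyk]; exact hy 0
  have hne : y' j ≠ y' k := by
    rw [hyj, hyk]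
    intro h
    have : σ * ε = 0 := by linarith
    rcases hσ with rfl | rfl <;> linarith
  obtain ⟨R', hR'⟩ := hμ.exists_isRadii hq hQ hy's
  refine ⟨y', hy's, ?_⟩
  -- In this signed coordinate the facility `j` moves from 0 to `-ε`, whichever side is chosen.
  set z : ℝ → ℝ := fun t => σ * (t - c) with hz
  have dj : ∀ t, |t - y' j| = |z t + ε| := fun t => by
    rw [hyj]
    have : z t + ε = σ * (t - (c - σ * ε)) := by
      simp only [hz]
      linear_combination (-ε) * hσσ
    rw [this, habs]
  have dc : ∀ t, |t - c| = |z t| := fun t => (habs _).symm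
  have dk : ∀ t, |t - y' k| = |z t| := fun t => by rw [hyk, dc]
  have hzm : Measurable z := by fun_prop
  set r := R' j with hr
  set τ := R' k with hτ
  have hPset : covered y R = {t | |z t| ≤ ρ} := by
    ext t
    rw [mem_covered_iff zero_ne_one, ← hyy, dc, hρ]
    exact le_max_iff.symm
  have hP'set : covered y' R' = {t | |z t + ε| ≤ r ∨ |z t| ≤ τ} := by
    ext t
    rw [mem_covered_iff hjk, dj, dk]; rfl
  have mP : μ.real {t | |z t| ≤ ρ} = q 0 + q 1 := by rw [← hPset]; exact hR.measureReal_covered hμ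
  have mP' : μ.real {t | |z t + ε| ≤ r ∨ |z t| ≤ τ} = q 0 + q 1 := by
    rw [← hP'set]; exact hR'.measureReal_covered hμ
  have msP : MeasurableSet {t | |z t| ≤ ρ} := hPset ▸ measurableSet_covered y R
  have msP' : MeasurableSet {t | |z t + ε| ≤ r ∨ |z t| ≤ τ} := hP'set ▸ measurableSet_covered y' R'
  have tri1 : ∀ t, |z t + ε| ≤ |z t| + ε := fun t =>
    (abs_add_le _ _).trans (by rw [abs_of_pos hε])
  have tri2 : ∀ t, |z t| ≤ |z t + ε| + ε := fun t => by
    have := abs_add_le (z t + ε) (-ε)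
    rw [abs_neg, abs_of_pos hε] at this
    simpa using this
  -- If a new radius is too large, the new covered set contains the old one; the equal masses make
  -- them agree almost everywhere. `F2` is the reverse situation.
  have F1 : ∀ᵐ t ∂μ, |z t + ε| ≤ r ∨ |z t| ≤ τ → |z t| ≤ ρ + 2 * ε := by
    by_cases hs : τ ≤ ρ ∧ r ≤ ρ + ε
    · refine Eventually.of_forall fun t ht => ?_
      rcases ht with h | h
      · linarith [tri2 t, hs.2]
      · linarith [hs.1]
    · have hsub : {t | |z t| ≤ ρ} ⊆ {t | |z t + ε| ≤ r ∨ |z t| ≤ τ} := by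
        intro t ht
        have ht : |z t| ≤ ρ := ht
        by_cases h1 : τ ≤ ρ
        · have : ρ + ε < r := not_le.1 fun h => hs ⟨h1, h⟩
          exact Or.inl (by linarith [tri1 t])
        · exact Or.inr (by linarith)
      filter_upwards [eventuallyEq_set.1
        (ae_eq_of_subset_of_measureReal_eq hsub msP (mP.trans mP'.symm))] with t ht h
      have : |z t| ≤ ρ := ht.2 h
      linarith
  have F2 : ∀ᵐ t ∂μ, |z t| < ρ - 2 * ε → |z t + ε| ≤ r ∨ |z t| ≤ τ := by
    by_cases hs : ρ - 2 * ε ≤ τ ∨ ρ - ε ≤ r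
    · refine Eventually.of_forall fun t ht => ?_
      rcases hs with h | h
      · exact Or.inr (by linarith)
      · exact Or.inl (by linarith [tri1 t])
    · push Not at hs
      have hsub : {t | |z t + ε| ≤ r ∨ |z t| ≤ τ} ⊆ {t | |z t| ≤ ρ} := by
        intro t ht
        have : |z t| ≤ ρ := by
          rcases ht with h | h
          · linarith [tri2 t, hs.2]
          · linarith [hs.1]
        exact this
      filter_upwards [eventuallyEq_set.1
        (ae_eq_of_subset_of_measureReal_eq hsub msP' (mP'.trans mP.symm))] with t ht h
      exact ht.2 (show |z t| ≤ ρ by linarith)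
  -- the measures of the sets that occur in the comparison
  have mz : Measurable fun t => |z t| := by fun_prop
  have mzε : Measurable fun t => |z t + ε| := by fun_prop
  have msA : MeasurableSet {t | |z t + ε| ≤ r ∧ (|z t + ε| < |z t| ∨ τ < |z t|)} :=
    (measurableSet_le mzε measurable_const).inter
      ((measurableSet_lt mzε mz).union (measurableSet_lt measurable_const mz))
  have msB : MeasurableSet
      {t | (|z t + ε| ≤ r ∧ (|z t + ε| < |z t| ∨ τ < |z t|)) ∧ 2 * ε < z t} :=
    msA.inter (measurableSet_lt measurable_const hzm)
  have msE : MeasurableSet {t | |z t| ≤ 2 * ε ∨ |(|z t| - ρ)| ≤ 2 * ε} :=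
    (measurableSet_le mz measurable_const).union
      (measurableSet_le (mz.sub_const ρ).norm measurable_const)
  have msL : MeasurableSet {t | |z t| ≤ ρ ∧ z t ≤ 0} :=
    msP.inter (measurableSet_le hzm measurable_const)
  have mA : μ.real {t | |z t + ε| ≤ r ∧ (|z t + ε| < |z t| ∨ τ < |z t|)} = q j := by
    rw [← hR'.2 j]
    apply measureReal_congr_ae
    filter_upwards [hμ.ae_mem_served_iff_of_ne hjk hne hR'.1] with t ht
    rw [ht, dj, dk]
  have mE : μ.real {t | |z t| ≤ 2 * ε ∨ |(|z t| - ρ)| ≤ 2 * ε} < q j / 6 := by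
    have hsub : {t | |z t| ≤ 2 * ε ∨ |(|z t| - ρ)| ≤ 2 * ε} ⊆
        (Icc (c - 2 * ε) (c + 2 * ε) ∪ Icc (c + ρ - 2 * ε) (c + ρ + 2 * ε)) ∪
          Icc (c - ρ - 2 * ε) (c - ρ + 2 * ε) := by
      intro t ht
      simp only [mem_ofPred_eq, ← dc] at ht
      rcases ht with ht | ht
      · rw [abs_le] at ht
        exact Or.inl (Or.inl ⟨by linarith, by linarith⟩)
      · rw [abs_le] at ht
        rcases abs_choice (t - c) with h | h
        · rw [h] at ht
          exact Or.inl (Or.inr ⟨by linarith, by linarith⟩)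
        · rw [h] at ht
          exact Or.inr ⟨by linarith, by linarith⟩
    have h1 := measureReal_mono (μ := μ) hsub
    have h2 := measureReal_union_le (μ := μ)
      (Icc (c - 2 * ε) (c + 2 * ε) ∪ Icc (c + ρ - 2 * ε) (c + ρ + 2 * ε))
      (Icc (c - ρ - 2 * ε) (c - ρ + 2 * ε))
    have h3 := measureReal_union_le (μ := μ) (Icc (c - 2 * ε) (c + 2 * ε))
      (Icc (c + ρ - 2 * ε) (c + ρ + 2 * ε))
    linarith
  -- Far-side service requires `r > τ + ε`. Then `j` serves its whole own side up to the exceptional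
  -- set, which by `hside` already has mass `q j`; only the mass of the exceptional set can remain
  -- for the far side.
  have mB : μ.real {t | (|z t + ε| ≤ r ∧ (|z t + ε| < |z t| ∨ τ < |z t|)) ∧ 2 * ε < z t} ≤
      μ.real {t | |z t| ≤ 2 * ε ∨ |(|z t| - ρ)| ≤ 2 * ε} := by
    by_cases hrτ : τ + ε < r
    · obtain ⟨iA, eA⟩ := integral_ite_mul (μ := μ) 1 msA
      obtain ⟨iB, eB⟩ := integral_ite_mul (μ := μ) 1 msB
      obtain ⟨iE, eE⟩ := integral_ite_mul (μ := μ) 1 msE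
      obtain ⟨iL, eL⟩ := integral_ite_mul (μ := μ) 1 msL
      have := integral_mono_ae iL ((iA.sub iB).add iE) (by
        filter_upwards [F2] with t h2
        simp only [Pi.add_apply, Pi.sub_apply, one_mul]
        exact own_side_of_shift hε hrτ h2)
      rw [integral_add' (iA.sub iB) iE, integral_sub' iA iB, eA, eB, eE, eL, mA] at this
      have hside' : q j ≤ μ.real {t | |z t| ≤ ρ ∧ z t ≤ 0} := hside
      linarith
    · have : {t | (|z t + ε| ≤ r ∧ (|z t + ε| < |z t| ∨ τ < |z t|)) ∧ 2 * ε < z t} = ∅ := by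
        ext t
        simp only [mem_ofPred_eq, mem_empty_iff_false, iff_false]
        rintro ⟨⟨h1, h2⟩, h3⟩
        have e1 : |z t + ε| = z t + ε := abs_of_pos (by linarith)
        have e2 : |z t| = z t := abs_of_pos (by linarith)
        rcases h2 with h2 | h2 <;> linarith
      rw [this, measureReal_empty]
      exact measureReal_nonneg
  -- integrate the pointwise gain
  obtain ⟨iA, eA⟩ := integral_ite_mul (μ := μ) ε msA
  obtain ⟨iB, eB⟩ := integral_ite_mul (μ := μ) (2 * ε) msB
  obtain ⟨iE, eE⟩ := integral_ite_mul (μ := μ) (4 * ε) msE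
  obtain ⟨iP, eP⟩ := integral_ite_mul (μ := μ) (1 - ρ) msP
  obtain ⟨iP', eP'⟩ := integral_ite_mul (μ := μ) (1 - ρ) msP'
  have hp := integrable_payoff (μ := μ) (y := y) hR.1
  have hp' := integrable_payoff (μ := μ) (y := y') hR'.1
  have key := integral_mono_ae ((hp.add ((iA.sub iE).sub iB)).add (iP'.sub iP)) hp' (by
    filter_upwards [F1, F2] with t h1 h2
    simp only [Pi.add_apply, Pi.sub_apply]
    rw [payoff_diagonal hyy hR.1, payoff_eq hjk]
    unfold offer
    rw [dj, dk, ← hc, dc, ← hρ]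
    exact gain_of_shift hε h1 h2)
  rw [integral_add' (hp.add ((iA.sub iE).sub iB)) (iP'.sub iP), integral_add' hp ((iA.sub iE).sub iB),
    integral_sub' (iA.sub iE) iB, integral_sub' iA iE, integral_sub' iP' iP, eA, eB, eE, eP, eP', mA,
    mP, mP', hR.integral_payoff_eq hμ hQ hy, hR'.integral_payoff_eq hμ hQ hy's] at key
  have hfin : 0 < ε * (q j - 4 * μ.real {t | |z t| ≤ 2 * ε ∨ |(|z t| - ρ)| ≤ 2 * ε} -
      2 * μ.real {t | (|z t + ε| ≤ r ∧ (|z t + ε| < |z t| ∨ τ < |z t|)) ∧ 2 * ε < z t}) :=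
    mul_pos hε (by linarith)
  linarith

/-- The ball around a common location has mass `q 0 + q 1`, so one of its halves has at least the
mass of the smaller capacity. Moving that facility towards this half lowers the cost. -/
lemma IsRegular.ne_of_mem_minimisers (hμ : IsRegular μ) (hq : ∀ j, 0 < q j) (hQ : q 0 + q 1 < 1)
    (hy : y ∈ minimisers μ q) : y 0 ≠ y 1 := by
  intro hyy
  obtain ⟨R, hR⟩ := hμ.exists_isRadii hq hQ hy.1
  have hj : ∃ j k : Fin 2, j ≠ k ∧ q j ≤ q k := by
    rcases le_total (q 0) (q 1) with h | h
    · exact ⟨0, 1, zero_ne_one, h⟩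
    · exact ⟨1, 0, one_ne_zero, h⟩
  obtain ⟨j, k, hjk, hle⟩ := hj
  have hcov := hR.measureReal_covered hμ
  have hsum : q 0 + q 1 = q j + q k := by rw [← Fin.sum_univ_two (f := q), sum_fin_two hjk]
  have hsplit : covered y R ⊆
      {t | |1 * (t - y 0)| ≤ max (R 0) (R 1) ∧ 1 * (t - y 0) ≤ 0} ∪
      {t | |(-1) * (t - y 0)| ≤ max (R 0) (R 1) ∧ (-1) * (t - y 0) ≤ 0} := by
    intro t ht
    rw [mem_covered_iff zero_ne_one, ← hyy, ← le_max_iff] at ht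
    rcases le_total (t - y 0) 0 with h | h
    · exact Or.inl ⟨by rwa [one_mul], by linarith⟩
    · exact Or.inr ⟨by rwa [neg_one_mul, abs_neg], by linarith⟩
  have h1 := (measureReal_mono (μ := μ) hsplit).trans (measureReal_union_le _ _)
  rw [hcov, hsum] at h1
  have hex : ∃ σ : ℝ, (σ = 1 ∨ σ = -1) ∧
      q j ≤ μ.real {t | |σ * (t - y 0)| ≤ max (R 0) (R 1) ∧ σ * (t - y 0) ≤ 0} := by
    by_cases h : q j ≤ μ.real {t | |1 * (t - y 0)| ≤ max (R 0) (R 1) ∧ 1 * (t - y 0) ≤ 0}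
    · exact ⟨1, Or.inl rfl, h⟩
    · exact ⟨-1, Or.inr rfl, by linarith⟩
  obtain ⟨σ, hσ, hside⟩ := hex
  obtain ⟨y', hy', hlt⟩ := hμ.exists_functionalW_lt hq hQ hy.1 hyy hjk hσ hR rfl hside
  exact absurd (hy.2 y' hy') (not_le.2 hlt)

end Diagonal

/-! ### Expected welfare -/

section Expectation

set_option linter.unusedSectionVars false

variable {μ : Measure ℝ} [IsProbabilityMeasure μ] {q p y : Fin 2 → ℝ}
  {tie : ∀ n : ℕ, Fin 2 → Equiv.Perm (Fin n)} {N : ℕ → ℕ} {x : ∀ m, Fin (N m) → ℝ}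

/-- Convergence along all approximating sequences is uniform. -/
lemma exists_uniform_of_approximates {g : ∀ n : ℕ, (Fin n → ℝ) → ℝ} {c : ℝ}
    (h : ∀ (N : ℕ → ℕ) (x : ∀ m, Fin (N m) → ℝ), Approximates μ N x →
      Tendsto (fun m => g (N m) (x m) / N m) atTop (𝓝 c)) {δ : ℝ} (hδ : 0 < δ) :
    ∃ η > 0, ∃ n₀ : ℕ, ∀ n ≥ n₀, ∀ x : Fin n → ℝ, (∀ i, x i ∈ Icc (0 : ℝ) 1) → Close μ x η →
      |g n x / n - c| < δ := by
  by_contra hn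
  push Not at hn
  choose N hN x hx hclose hbad using fun m : ℕ =>
    hn (1 / ((m : ℝ) + 1)) (by positivity) (m + 1)
  have happ : Approximates μ N x :=
    ⟨fun m => (Nat.succ_pos m).trans_le (hN m),
      tendsto_atTop_mono (fun m => (Nat.le_succ m).trans (hN m)) tendsto_id, hx,
      fun m => 1 / ((m : ℝ) + 1), tendsto_one_div_add_atTop_nhds_zero_nat, hclose⟩
  obtain ⟨m, hm⟩ := ((Metric.tendsto_nhds.1 (h N x happ)) δ hδ).exists
  rw [Real.dist_eq] at hm
  exact absurd hm (not_lt.2 (hbad m))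

/-- On close samples `g` is uniformly near `c n`; the others have vanishing probability and
contribute at most `n` times it. Both bounds compare with measurable functions, so measurability of
`g`, here a supremum over equilibria, is not needed. -/
lemma IsRegular.tendsto_lintegral_div (hμ : IsRegular μ) {g : ∀ n : ℕ, (Fin n → ℝ) → ℝ} {c : ℝ}
    (hg : ∀ n, 0 < n → ∀ x : Fin n → ℝ, (∀ i, x i ∈ Icc (0 : ℝ) 1) → g n x ≤ n)
    (h : ∀ (N : ℕ → ℕ) (x : ∀ m, Fin (N m) → ℝ), Approximates μ N x →
      Tendsto (fun m => g (N m) (x m) / N m) atTop (𝓝 c)) :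
    Tendsto (fun n : ℕ => (∫⁻ x : Fin n → ℝ, ENNReal.ofReal (g n x) ∂(Measure.pi fun _ => μ)) / n)
      atTop (𝓝 (ENNReal.ofReal c)) := by
  have key : ∀ δ : ℝ, 0 < δ → ∃ b : ℕ → ENNReal, Tendsto b atTop (𝓝 0) ∧ ∀ᶠ n : ℕ in atTop,
      ENNReal.ofReal (c - δ) * (1 - b n) ≤
        (∫⁻ x : Fin n → ℝ, ENNReal.ofReal (g n x) ∂(Measure.pi fun _ => μ)) / n ∧
      (∫⁻ x : Fin n → ℝ, ENNReal.ofReal (g n x) ∂(Measure.pi fun _ => μ)) / n ≤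
        ENNReal.ofReal (c + δ) + b n := by
    intro δ hδ
    obtain ⟨η, hη, n₀, hn₀⟩ := exists_uniform_of_approximates h hδ
    obtain ⟨B, hBm, hB, hB0⟩ := hμ.exists_bad_event hη
    refine ⟨_, hB0, ?_⟩
    filter_upwards [eventually_ge_atTop n₀, eventually_gt_atTop 0] with n h1 hpos
    have hn : (0 : ℝ) < n := by exact_mod_cast hpos
    have hn0 : (n : ENNReal) ≠ 0 := by exact_mod_cast hpos.ne'
    have hnt : (n : ENNReal) ≠ ⊤ := ENNReal.natCast_ne_top n
    have hofn : ∀ a : ℝ, ENNReal.ofReal a * n = ENNReal.ofReal (a * n) := fun a => by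
      rw [ENNReal.ofReal_mul' hn.le, ENNReal.ofReal_natCast]
    have hbd : ∀ x : Fin n → ℝ, (∀ i, x i ∈ Icc (0 : ℝ) 1) → x ∉ B n →
        (c - δ) * n ≤ g n x ∧ g n x ≤ (c + δ) * n := by
      intro x hx hxB
      have := abs_lt.1 (hn₀ n h1 x hx (hB n x hxB))
      exact ⟨(le_div_iff₀ hn).1 (by linarith), (div_le_iff₀ hn).1 (by linarith)⟩
    constructor
    · rw [ENNReal.le_div_iff_mul_le (Or.inl hn0) (Or.inl hnt), ← prob_compl_eq_one_sub (hBm n),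
        mul_right_comm, ← lintegral_indicator_const (hBm n).compl]
      refine lintegral_mono_ae ?_
      filter_upwards [hμ.ae_pi_mem n] with x hx
      by_cases hxB : x ∈ B n
      · simp [hxB]
      · rw [indicator_of_mem (show x ∈ (B n)ᶜ from hxB), hofn]
        exact ENNReal.ofReal_le_ofReal (hbd x hx hxB).1
    · refine ENNReal.div_le_of_le_mul ?_
      rw [add_mul, mul_comm (Measure.pi _ _), ← lintegral_indicator_const (hBm n)]
      calc _ ≤ ∫⁻ x : Fin n → ℝ, (ENNReal.ofReal (c + δ) * n + (B n).indicator (fun _ => (n : ENNReal)) x)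
            ∂(Measure.pi fun _ => μ) := by
            refine lintegral_mono_ae ?_
            filter_upwards [hμ.ae_pi_mem n] with x hx
            by_cases hxB : x ∈ B n
            · rw [indicator_of_mem hxB]
              refine le_add_left ?_
              rw [← ENNReal.ofReal_natCast n]
              exact ENNReal.ofReal_le_ofReal (hg n hpos x hx)
            · rw [indicator_of_notMem hxB, add_zero, hofn]
              exact ENNReal.ofReal_le_ofReal (hbd x hx hxB).2
        _ = _ := by
            rw [lintegral_add_left measurable_const, lintegral_const, measure_univ, mul_one]
  have hcont : ∀ ε : ℝ, Tendsto (fun δ : ℝ => ENNReal.ofReal (c + ε * δ)) (𝓝[>] 0)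
      (𝓝 (ENNReal.ofReal c)) := by
    intro ε
    have h1 : Continuous fun δ : ℝ => ENNReal.ofReal (c + ε * δ) :=
      ENNReal.continuous_ofReal.comp (by fun_prop)
    have h2 := h1.tendsto 0
    rw [mul_zero, add_zero] at h2
    exact h2.mono_left nhdsWithin_le_nhds
  have hpos : ∀ᶠ δ in 𝓝[>] (0 : ℝ), 0 < δ := self_mem_nhdsWithin
  rw [tendsto_order]
  constructor
  · intro a ha
    obtain ⟨δ, hδ, hδa⟩ := (hpos.and ((hcont (-1)).eventually_const_lt ha)).exists
    obtain ⟨b, hb, hev⟩ := key δ hδ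
    have hlim : Tendsto (fun n => ENNReal.ofReal (c - δ) * (1 - b n)) atTop
        (𝓝 (ENNReal.ofReal (c - δ) * (1 - 0))) :=
      ENNReal.Tendsto.const_mul (ENNReal.Tendsto.sub tendsto_const_nhds hb (Or.inl ENNReal.one_ne_top))
        (Or.inr ENNReal.ofReal_ne_top)
    rw [tsub_zero, mul_one] at hlim
    have hδa' : a < ENNReal.ofReal (c - δ) := by
      rwa [neg_one_mul, ← sub_eq_add_neg] at hδa
    filter_upwards [hev, hlim.eventually_const_lt hδa'] with n h1 h2
    exact h2.trans_le h1.1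
  · intro a ha
    obtain ⟨δ, hδ, hδa⟩ := (hpos.and ((hcont 1).eventually_lt_const ha)).exists
    obtain ⟨b, hb, hev⟩ := key δ hδ
    have hlim : Tendsto (fun n => ENNReal.ofReal (c + δ) + b n) atTop
        (𝓝 (ENNReal.ofReal (c + δ) + 0)) := tendsto_const_nhds.add hb
    rw [add_zero] at hlim
    rw [one_mul] at hδa
    filter_upwards [hev, hlim.eventually_lt_const hδa] with n h1 h2
    exact h1.2.trans_lt h2

/-! ### The welfare of percentile mechanisms and the optimal welfare -/

lemma welfare_le {n : ℕ} {tie : Fin 2 → Equiv.Perm (Fin n)} (x : Fin n → ℝ) (y : Fin 2 → ℝ)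
    (s : Fin n → Fin 2) : welfare tie q x y s ≤ n := by
  have := Finset.sum_le_card_nsmul Finset.univ (utility tie q x y s) 1 fun i _ => utility_le_one i
  simpa [welfare] using this

lemma exists_isNash_eqWelfare_eq {n : ℕ} (tie : Fin 2 → Equiv.Perm (Fin n)) (q : Fin 2 → ℝ)
    {x : Fin n → ℝ} (hx : ∀ i, x i ∈ Icc (0 : ℝ) 1) (hy : y ∈ square) :
    ∃ s, IsNash tie q x y s ∧ eqWelfare tie q x y = welfare tie q x y s := by
  obtain ⟨s, hs, _⟩ := exists_isNash tie q y hx hy (zero_ne_one (α := Fin 2))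
  have hfin : {w : ℝ | ∃ s, IsNash tie q x y s ∧ w = welfare tie q x y s}.Finite :=
    (Set.finite_range fun s => welfare tie q x y s).subset (by
      rintro w ⟨s, _, rfl⟩
      exact ⟨s, rfl⟩)
  have hne : {w : ℝ | ∃ s, IsNash tie q x y s ∧ w = welfare tie q x y s}.Nonempty :=
    ⟨_, s, hs, rfl⟩
  exact hne.csSup_mem hfin

lemma tendsto_percentile_index (hN : Tendsto N atTop atTop) (hpos : ∀ m, 0 < N m) {p : ℝ}
    (hp : p ∈ Icc (0 : ℝ) 1) :
    Tendsto (fun m => (⌊p * ((N m : ℝ) - 1)⌋₊ : ℝ) / N m) atTop (𝓝 p) := by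
  have hN' : Tendsto (fun m => (N m : ℝ)) atTop atTop := tendsto_natCast_atTop_atTop.comp hN
  have hlow : Tendsto (fun m => p - 2 / (N m : ℝ)) atTop (𝓝 p) := by
    simpa using tendsto_const_nhds.sub (hN'.const_div_atTop 2)
  refine tendsto_of_tendsto_of_tendsto_of_le_of_le hlow tendsto_const_nhds (fun m => ?_) fun m => ?_
  · have h0 : (0 : ℝ) < N m := by exact_mod_cast hpos m
    simp only
    rw [le_div_iff₀ h0, sub_mul, div_mul_cancel₀ _ h0.ne']
    linarith [Nat.lt_floor_add_one (p * ((N m : ℝ) - 1)), hp.2]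
  · have h0 : (1 : ℝ) ≤ N m := by exact_mod_cast hpos m
    simp only
    rw [div_le_iff₀ (by linarith)]
    have := Nat.floor_le (mul_nonneg hp.1 (by linarith : (0 : ℝ) ≤ (N m : ℝ) - 1))
    nlinarith [hp.1]

lemma Approximates.tendsto_percentile (hμ : IsRegular μ) (hx : Approximates μ N x)
    (hp : p ∈ square) (hy : y ∈ square) (hyp : ∀ j, cdf μ (y j) = p j) :
    Tendsto (fun m => percentile p (x m)) atTop (𝓝 y) := by
  rw [tendsto_pi_nhds]
  intro j
  refine hx.tendsto_leftmost hμ (fun m => percentile_index_lt (hp j) (hx.pos m)) (hy j) ?_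
  rw [hyp j]
  exact tendsto_percentile_index hx.tendsto hx.pos (hp j)

lemma IsRegular.tendsto_eqWelfare_percentile (hμ : IsRegular μ) (hq : ∀ j, 0 < q j)
    (hQ : q 0 + q 1 < 1) (hp : p ∈ square) (hy : y ∈ square) (hyp : ∀ j, cdf μ (y j) = p j)
    (hx : Approximates μ N x) :
    Tendsto (fun m => eqWelfare (tie (N m)) q (x m) (percentile p (x m)) / N m) atTop
      (𝓝 (q 0 + q 1 - functionalW μ q y)) := by
  have hsq : ∀ m, percentile p (x m) ∈ square := fun m =>
    percentile_mem_square hp (hx.pos m) (hx.mem m)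
  choose s hs hw using fun m => exists_isNash_eqWelfare_eq (tie (N m)) q (hx.mem m) (hsq m)
  simp_rw [hw]
  exact hμ.tendsto_welfare hq hQ hx hsq (hx.tendsto_percentile hμ hp hy hyp) hs

lemma bddAbove_welfare {n : ℕ} (tie : Fin 2 → Equiv.Perm (Fin n)) (q : Fin 2 → ℝ) (x : Fin n → ℝ) :
    BddAbove {w : ℝ | ∃ y ∈ square, ∃ s, IsNash tie q x y s ∧ w = welfare tie q x y s} := by
  refine ⟨n, ?_⟩
  rintro w ⟨y, _, s, _, rfl⟩
  exact welfare_le x y s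

/-- A fixed minimiser gives the lower bound. For the upper bound, nearly optimal locations depend on
the population, but they converge along a subsequence to some `y'`, and the limit welfare there
cannot exceed that of a minimiser. -/
lemma IsRegular.tendsto_optWelfare (hμ : IsRegular μ) (hq : ∀ j, 0 < q j)
    (hQ : q 0 + q 1 < 1) (hy : y ∈ minimisers μ q) (hx : Approximates μ N x) :
    Tendsto (fun m => optWelfare (tie (N m)) q (x m) / N m) atTop
      (𝓝 (q 0 + q 1 - functionalW μ q y)) := by
  have hpos : ∀ m, (0 : ℝ) < N m := fun m => by exact_mod_cast hx.pos m
  choose s hs _ using fun m =>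
    exists_isNash (tie (N m)) q y (hx.mem m) hy.1 (zero_ne_one (α := Fin 2))
  have hlow : ∀ m, welfare (tie (N m)) q (x m) y (s m) / N m ≤
      optWelfare (tie (N m)) q (x m) / N m := fun m => by
    gcongr
    exact le_csSup (bddAbove_welfare _ _ _) ⟨y, hy.1, s m, hs m, rfl⟩
  have hlim := hμ.tendsto_welfare hq hQ hx (fun _ => hy.1) tendsto_const_nhds hs
  -- The supremum need not be attained; a loss of 1 disappears after division by the number of
  -- agents.
  have hnear : ∀ m, ∃ y' ∈ square, ∃ s', IsNash (tie (N m)) q (x m) y' s' ∧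
      optWelfare (tie (N m)) q (x m) - 1 < welfare (tie (N m)) q (x m) y' s' := by
    intro m
    have hne : {w : ℝ | ∃ y ∈ square, ∃ s, IsNash (tie (N m)) q (x m) y s ∧
        w = welfare (tie (N m)) q (x m) y s}.Nonempty := ⟨_, y, hy.1, s m, hs m, rfl⟩
    obtain ⟨w, ⟨y', hy', s', hs', rfl⟩, hlt⟩ := exists_lt_of_lt_csSup hne
      (sub_one_lt (optWelfare (tie (N m)) q (x m)))
    exact ⟨y', hy', s', hs', hlt⟩
  choose yy hyy s' hs' hlt using hnear
  refine tendsto_of_subseq_tendsto fun ψ hψ => ?_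
  obtain ⟨y', hy', φ, hφ, hφlim⟩ := isCompact_square.tendsto_subseq fun m => hyy (ψ m)
  refine ⟨φ, ?_⟩
  have hψφ : Tendsto (fun m => ψ (φ m)) atTop atTop := hψ.comp hφ.tendsto_atTop
  have hxx := hx.comp hψφ
  have hlim' := hμ.tendsto_welfare hq hQ hxx (fun m => hyy (ψ (φ m))) hφlim
    (fun m => hs' (ψ (φ m)))
  have hinv : Tendsto (fun m => 1 / (N (ψ (φ m)) : ℝ)) atTop (𝓝 0) :=
    (tendsto_natCast_atTop_atTop.comp hxx.tendsto).const_div_atTop 1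
  have hup := hlim'.add hinv
  rw [add_zero] at hup
  have hle : ∀ m, optWelfare (tie (N (ψ (φ m)))) q (x (ψ (φ m))) / N (ψ (φ m)) ≤
      welfare (tie (N (ψ (φ m)))) q (x (ψ (φ m))) (yy (ψ (φ m))) (s' (ψ (φ m))) / N (ψ (φ m)) +
        1 / (N (ψ (φ m)) : ℝ) := fun m => by
    rw [← add_div]
    have := hpos (ψ (φ m))
    gcongr
    linarith [hlt (ψ (φ m))]
  have hge := hlim.comp hψφ
  have hVle := le_of_tendsto_of_tendsto' hge hup fun m => (hlow (ψ (φ m))).trans (hle m)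
  have hV : functionalW μ q y' = functionalW μ q y :=
    le_antisymm (by linarith) (hy.2 y' hy')
  rw [hV] at hup
  exact tendsto_of_tendsto_of_tendsto_of_le_of_le hge hup (fun m => hlow (ψ (φ m))) hle

/-- The covered set has positive mass and almost every agent in it has positive payoff. This keeps
the limits in the approximation ratio away from zero. -/
lemma IsRegular.functionalW_lt (hμ : IsRegular μ) (hq : ∀ j, 0 < q j) (hQ : q 0 + q 1 < 1)
    (hy : y ∈ square) : functionalW μ q y < q 0 + q 1 := by
  obtain ⟨R, hR⟩ := hμ.exists_isRadii hq hQ hy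
  rw [← sub_pos, ← hR.integral_payoff_eq hμ hQ hy]
  have hoff : ∀ t j, 0 ≤ offer y R t j := fun t j => by
    unfold offer
    split_ifs with h
    · linarith [(hR.1 j).2]
    · exact le_rfl
  have hnn : 0 ≤ payoff y R := fun t => (hoff t 0).trans (le_max_left _ _)
  refine lt_of_le_of_ne (integral_nonneg hnn) fun h0 => ?_
  have hz := (integral_eq_zero_iff_of_nonneg hnn (integrable_payoff hR.1)).1 h0.symm
  have hc : μ.real (covered y R) = 0 := by
    rw [← measureReal_empty (μ := μ)]
    apply measureReal_congr_ae
    filter_upwards [hz, hμ.ae_mem, hμ.ae_ne 0, hμ.ae_ne 1] with t ht hmem h0 h1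
    simp only [mem_empty_iff_false, iff_false]
    rintro ⟨j, hj⟩
    have hlt : |t - y j| < 1 := by
      have := lt_of_le_of_ne hmem.1 h0.symm
      have := lt_of_le_of_ne hmem.2 h1
      rw [abs_lt]
      constructor <;> linarith [(hy j).1, (hy j).2]
    have hle : offer y R t j ≤ payoff y R t := by
      rcases fin_two_eq_or zero_ne_one j with rfl | rfl
      · exact le_max_left _ _
      · exact le_max_right _ _
    rw [ht, offer, if_pos hj, Pi.zero_apply] at hle
    linarith
  rw [hR.measureReal_covered hμ] at hc
  linarith [hq 0, hq 1]

lemma IsRegular.asymptoticallyOptimal_iff (hμ : IsRegular μ) (hq : ∀ j, 0 < q j)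
    (hQ : q 0 + q 1 < 1) (hp : p ∈ square) (hy : y ∈ square) (hyp : ∀ j, cdf μ (y j) = p j) :
    AsymptoticallyOptimal tie μ q p ↔ y ∈ minimisers μ q := by
  obtain ⟨z, hz⟩ := hμ.minimisers_nonempty hq hQ
  have hopt := hμ.tendsto_lintegral_div (g := fun n x => optWelfare (tie n) q x)
    (fun n hn x hx => by
      obtain ⟨s, hs, _⟩ := exists_isNash (tie n) q z hx hz.1 (zero_ne_one (α := Fin 2))
      refine csSup_le ⟨_, z, hz.1, s, hs, rfl⟩ ?_
      rintro w ⟨y, _, s, _, rfl⟩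
      exact welfare_le x y s)
    (fun N x hx => hμ.tendsto_optWelfare hq hQ hz hx)
  have heq := hμ.tendsto_lintegral_div (g := fun n x => eqWelfare (tie n) q x (percentile p x))
    (fun n hn x hx => by
      obtain ⟨s, _, hs⟩ := exists_isNash_eqWelfare_eq (tie n) q hx (percentile_mem_square hp hn hx)
      rw [hs]
      exact welfare_le x _ s)
    (fun N x hx => hμ.tendsto_eqWelfare_percentile hq hQ hp hy hyp hx)
  have hV := sub_pos.2 (hμ.functionalW_lt hq hQ hz.1)
  have hV' := sub_pos.2 (hμ.functionalW_lt hq hQ hy)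
  have hlim : Tendsto (bayesRatio tie μ q p) atTop
      (𝓝 (ENNReal.ofReal (q 0 + q 1 - functionalW μ q z) /
        ENNReal.ofReal (q 0 + q 1 - functionalW μ q y))) := by
    refine (ENNReal.Tendsto.div hopt (Or.inl ?_) heq (Or.inl ENNReal.ofReal_ne_top)).congr' ?_
    · exact (ENNReal.ofReal_pos.2 hV).ne'
    · filter_upwards [eventually_gt_atTop 0] with n hn
      have hn0 : (n : ENNReal) ≠ 0 := by exact_mod_cast hn.ne'
      rw [div_eq_mul_inv _ (n : ENNReal), div_eq_mul_inv _ (n : ENNReal)]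
      exact ENNReal.mul_div_mul_right _ _ (ENNReal.inv_ne_zero.2 (ENNReal.natCast_ne_top n))
        (ENNReal.inv_ne_top.2 hn0)
  have hiff : AsymptoticallyOptimal tie μ q p ↔ functionalW μ q y = functionalW μ q z := by
    constructor
    · intro h
      have h1 := tendsto_nhds_unique hlim h
      rw [ENNReal.div_eq_one_iff (ENNReal.ofReal_pos.2 hV').ne' ENNReal.ofReal_ne_top,
        ENNReal.ofReal_eq_ofReal_iff hV.le hV'.le] at h1
      linarith
    · intro h
      rwa [h, ENNReal.div_self (ENNReal.ofReal_pos.2 hV).ne' ENNReal.ofReal_ne_top] at hlim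
  rw [hiff]
  exact ⟨fun h => ⟨hy, fun y' hy' => h.trans_le (hz.2 y' hy')⟩,
    fun h => le_antisymm (h.2 z hz.1) (hz.2 y hy)⟩

end Expectation

/-! ### The characterisation -/

/-- Absolute continuity with respect to Lebesgue measure on `[0,1]` excludes atoms and mass outside.
-/
lemma isRegular_of_density {μ : Measure ℝ} {f : ℝ → ENNReal}
    (hμ : μ = (volume.restrict (Icc 0 1)).withDensity f)
    (hF : StrictMonoOn (cdf μ) (Icc 0 1)) : IsRegular μ := by
  have hac : μ ≪ volume.restrict (Icc 0 1) := hμ ▸ withDensity_absolutelyContinuous _ _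
  refine ⟨fun t => hac ?_, hac.ae_le (ae_restrict_mem measurableSet_Icc), hF⟩
  exact measure_singleton t

section Characterisation

set_option linter.unusedSectionVars false

variable {μ : Measure ℝ} [IsProbabilityMeasure μ] {q p y : Fin 2 → ℝ}
  {tie : ∀ n : ℕ, Fin 2 → Equiv.Perm (Fin n)}

lemma IsRegular.existsUnique_cost (hμ : IsRegular μ) (hq : ∀ j, 0 < q j) (hQ : q 0 + q 1 < 1)
    (hy : y ∈ square) : ∃! c : ℝ, ∃ R, IsRadii μ q y R ∧ cost μ y R = c := by
  obtain ⟨R, hR⟩ := hμ.exists_isRadii hq hQ hy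
  refine ⟨cost μ y R, ⟨R, hR, rfl⟩, ?_⟩
  rintro c ⟨R', hR', rfl⟩
  exact hR'.cost_eq hμ hQ hy hR

/-- The limit locations of a stable and asymptotically optimal percentile mechanism. -/
lemma IsRegular.exists_minimiser_of_mechanism (hμ : IsRegular μ) (hq : ∀ j, 0 < q j)
    (hQ : q 0 + q 1 < 1) (hp : p ∈ square) (hES : EquilibriumStable tie q p)
    (hAO : AsymptoticallyOptimal tie μ q p) :
    ∃ y ∈ minimisers μ q, (∀ j, cdf μ (y j) = p j) ∧
      ∀ j k : Fin 2, j ≠ k → p j ≤ p k → q j + q k ≤ cdf μ (y k) - cdf μ (y j) := by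
  choose y hy hyp using fun j => hμ.exists_cdf_eq (hp j)
  have hmin := (hμ.asymptoticallyOptimal_iff hq hQ hp hy hyp).1 hAO
  refine ⟨y, hmin, hyp, fun j k hjk hle => ?_⟩
  rw [hyp, hyp]
  -- Equal percentiles mean coincident limit locations, which a minimiser does not have; only then
  -- does instability for small gaps apply.
  have hne : p j ≠ p k := by
    intro h
    have hyy : y j = y k := hμ.strictMonoOn.injOn (hy j) (hy k) (by rw [hyp, hyp, h])
    apply hμ.ne_of_mem_minimisers hq hQ hmin
    rcases fin_two_eq_or hjk 0 with h0 | h0 <;> rcases fin_two_eq_or hjk 1 with h1 | h1 <;>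
      rw [h0, h1]
    · exact hyy
    · exact hyy.symm
  by_contra hlt
  exact not_equilibriumStable tie hq hQ hp hjk (lt_of_le_of_ne hle hne) (not_le.1 hlt) hES

/-- The percentiles are the values of `F` at the minimiser, so that the mechanism converges to it.
-/
lemma IsRegular.exists_mechanism_of_minimiser (hμ : IsRegular μ) (hq : ∀ j, 0 < q j)
    (hQ : q 0 + q 1 < 1) (hy : y ∈ minimisers μ q) {j k : Fin 2} (hjk : j ≠ k)
    (hle : q j + q k ≤ cdf μ (y k) - cdf μ (y j)) :
    ∃ p ∈ square, p j ≤ p k ∧ EquilibriumStable tie q p ∧ AsymptoticallyOptimal tie μ q p := by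
  have hp : (fun l => cdf μ (y l)) ∈ square := fun l => ⟨cdf_nonneg μ _, cdf_le_one μ _⟩
  exact ⟨_, hp, by linarith [hq j, hq k], equilibriumStable_of_le tie hq hQ hp hjk hle,
    (hμ.asymptoticallyOptimal_iff hq hQ hp hy.1 fun _ => rfl).2 hy⟩

end Characterisation

end FLPSR

end

theorem mainTheorem8
    (tie : ∀ n : ℕ, Fin 2 → Equiv.Perm (Fin n))
    (μ : Measure ℝ) [IsProbabilityMeasure μ]
    (f : ℝ → ℝ) (hf : ContinuousOn f (Icc 0 1)) (hf0 : ∀ x ∈ Icc (0 : ℝ) 1, 0 ≤ f x)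
    (hμ : μ = (volume.restrict (Icc 0 1)).withDensity fun x => ENNReal.ofReal (f x))
    (hF : StrictMonoOn (cdf μ) (Icc 0 1))
    (q : Fin 2 → ℝ) (hq : ∀ j, 0 < q j) (hQ : q 0 + q 1 < 1) :
    -- the functional is well defined: radii exist, and the cost does not depend on their choice
    (∀ y ∈ FLPSR.square, ∃! c : ℝ, ∃ R, FLPSR.IsRadii μ q y R ∧ FLPSR.cost μ y R = c) ∧
    (FLPSR.minimisers μ q).Nonempty ∧
    -- mechanisms that place the first facility to the left of the second one
    ((∃ p ∈ FLPSR.square, p 0 ≤ p 1 ∧ FLPSR.EquilibriumStable tie q p ∧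
        FLPSR.AsymptoticallyOptimal tie μ q p) ↔
      ∃ y ∈ FLPSR.minimisers μ q, q 0 + q 1 ≤ cdf μ (y 1) - cdf μ (y 0)) ∧
    -- all percentile mechanisms
    ((∃ p ∈ FLPSR.square, FLPSR.EquilibriumStable tie q p ∧
        FLPSR.AsymptoticallyOptimal tie μ q p) ↔
      ∃ y ∈ FLPSR.minimisers μ q, q 0 + q 1 ≤ |cdf μ (y 1) - cdf μ (y 0)|) := by
  have hreg := FLPSR.isRegular_of_density hμ hF
  refine ⟨fun y hy => hreg.existsUnique_cost hq hQ hy, hreg.minimisers_nonempty hq hQ, ⟨?_, ?_⟩,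
    ⟨?_, ?_⟩⟩
  · rintro ⟨p, hp, hle, hES, hAO⟩
    obtain ⟨y, hy, _, h⟩ := hreg.exists_minimiser_of_mechanism hq hQ hp hES hAO
    exact ⟨y, hy, h 0 1 zero_ne_one hle⟩
  · rintro ⟨y, hy, hle⟩
    exact hreg.exists_mechanism_of_minimiser hq hQ hy zero_ne_one hle
  · rintro ⟨p, hp, hES, hAO⟩
    obtain ⟨y, hy, _, h⟩ := hreg.exists_minimiser_of_mechanism hq hQ hp hES hAO
    refine ⟨y, hy, ?_⟩
    rcases le_total (p 0) (p 1) with hle | hle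
    · exact (h 0 1 zero_ne_one hle).trans (le_abs_self _)
    · rw [abs_sub_comm, add_comm]
      exact (h 1 0 one_ne_zero hle).trans (le_abs_self _)
  · rintro ⟨y, hy, hle⟩
    rcases le_abs.1 hle with h | h
    · obtain ⟨p, hp, _, hES, hAO⟩ := hreg.exists_mechanism_of_minimiser (tie := tie) hq hQ hy
        zero_ne_one h
      exact ⟨p, hp, hES, hAO⟩
    · obtain ⟨p, hp, _, hES, hAO⟩ := hreg.exists_mechanism_of_minimiser (tie := tie) hq hQ hy
        (one_ne_zero (α := Fin 2)) (by linarith)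
      exact ⟨p, hp, hES, hAO⟩
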